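/- **Definitions.** Let $\mathcal W_n$ be the set of words of length $n$ without repeated letters in the alphabet $\{1,\dots,N\}$, and let $\mathcal S_n$ be the set of permutations of $n$, in one-line notation (the case $N=n$). A *D$_0$ graph* is a graph on a vertex set $W\subseteq\mathcal W_n$ with edges colored from $\{2,\dots,n-1\}$ such that (i) each $i$-edge is one of the pairs $\{v\,bac\,w,\ v\,bca\,w\}$, $\{v\,acb\,w,\ v\,cab\,w\}$, $\{v\,bac\,w,\ v\,acb\,w\}$, $\{v\,bca\,w,\ v\,cab\,w\}$ with letters $a<b<c$ and words $v,w$, $|v|=i-2$; and (ii) for all such $a<b<c$, $v$, $w$, each element of $W\cap\{v\,bac\,w,\ v\,bca\,w,\ v\,acb\,w,\ v\,cab\,w\}$ belongs to exactly one $i$-edge. Its *generating function* is $\sum_{w\in W}Q_{\mathrm{Des}(w)}(\mathbf x)$, where $Q_{\mathrm{Des}(w)}$ is Gessel's fundamental quasisymmetric function of degree $n$ and $\mathrm{Des}(w)=\{i\mid w_i>w_{i+1}\}$. A *signed, colored graph of degree $n$* is a finite graph with edges colored from $\{2,\dots,n-1\}$ and a signature $\sigma(v)\in\{\pm1\}^{n-1}$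 for every vertex $v$. Its generating function is $\sum_v Q_{\{i\,\mid\,\sigma(v)_i=-1\}}(\mathbf x)$. A D$_0$ graph is regarded as one by setting $\sigma(w)_i=-1$ iff $i\in\mathrm{Des}(w)$. *Axiom 0* says that every vertex is in at most one $i$-edge, for each $i$; then $E_i(v)=w$ means that $\{v,w\}$ is an $i$-edge, and $v$ *admits an $i$-neighbor* if $E_i(v)$ is defined. A vertex $v$ *has $i$-type W* if it admits an $i$-neighbor and an $(i-1)$-neighbor and $\sigma(v)_i=-\sigma(E_{i-1}(v))_i$. For $4\le i<n$, a *flat $i$-chain* (resp. *weak flat $i$-chain*) is a sequence $(x^1,\dots,x^{2h})$ of distinct vertices admitting $(i-2)$-neighbors such that $x^{2j-1}=E_i(x^{2j})$ for $1\le j\le h$ and, for $1\le j<h$, - (flat) $x^{2j+1}=E_{i-2}(E_{i-1}E_{i-2})^{m_j}(x^{2j})$ for some $m_j\ge0$ such that $(E_{i-1}E_{i-2})^{m_j}(x^{2j})$ does not have $(i-1)$-type W; - (weak flat) $x^{2j+1}$ lies in the connected component of $x^{2j}$ in the graph of $(i-2)$- and $(i-1)$-edges, and $E_{i-2}(x^{2j+1})$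 does not have $(i-1)$-type W. For an interval $K=\{k+1,\dots,k+d\}\subseteq\{1,\dots,n\}$, the restriction $\mathrm{Res}_K$ is the signed, colored graph of degree $d$ on the same vertices whose $t$-edges ($2\le t\le d-1$) are the $(k+t)$-edges and whose signature is $(\sigma_{k+1},\dots,\sigma_{k+d-1})$. A function is *Schur positive* if it is a linear combination of Schur functions with nonnegative coefficients. The axioms are (all indices of $\sigma$ within $1,\dots,n-1$): - *Axiom 1*: axiom 0 holds, and $w$ admits an $i$-neighbor iff $\sigma(w)_{i-1}=-\sigma(w)_i$. - *Axiom 2*: for each $i$-edge $\{w,x\}$, $\sigma(w)_j=-\sigma(x)_j$ for $j=i-1,i$, and $\sigma(w)_h=\sigma(x)_h$ for $h<i-2$ and $h>i+1$. - *Axiom 3*: for each $i$-edge $\{w,x\}$, if $\sigma(w)_{i-2}=-\sigma(x)_{i-2}$ then $\sigma(w)_{i-2}=-\sigma(w)_{i-1}$, and if $\sigma(w)_{i+1}=-\sigma(x)_{i+1}$ then $\sigma(w)_{i+1}=-\sigma(w)_i$. - *Axiom 4'a*: if $\{w,v\}$ is an $(i-1)$-edge but not an $i$-edge, $\sigma(w)_{i-3}\ne\sigma(v)_{i-3}$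 and $\sigma(w)_i\ne\sigma(v)_i$, then the components of $w$ in $\mathrm{Res}_{[i-3,i]}$ and in $\mathrm{Res}_{[i-2,i+1]}$ have the same generating function. - *Axiom 4'b* (resp. *4''b*): for every flat (resp. weak flat) $i$-chain $(x^1,\dots,x^{2h})$ and every $2<j<2h-1$ such that $x^j$ has $(i+1)$-type W, all of $x^1,\dots,x^j$ or all of $x^j,\dots,x^{2h}$ have $(i+1)$-type W. - *Axiom 5*: if $\{w,x\}$ is an $i$-edge and $\{x,y\}$ a $j$-edge with $|i-j|\ge3$, then there is a vertex $v$ such that $\{w,v\}$ is a $j$-edge and $\{v,y\}$ an $i$-edge. - *LSP$_d$*: every connected component of every restriction to an interval of size $d$ has a Schur positive generating function. A *D graph* (in the sense of Assaf) is a signed, colored graph satisfying axioms 1, 2, 3, 4'a, 4'b, 5, LSP$_4$ and LSP$_5$. **Theorem.** There exists a D$_0$ graph $\mathcal G^*$ whose vertex set consists of 4950 permutations in $\mathcal S_8$ and which satisfies axioms 4''b, 4'b and 5, such that the generating function of $\mathcal G^*$ is a linear combination of Schur functions in which the coefficient of $s_{(2,2,2,2)}$ is $-1$; in particular it is not Schur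 positive. Moreover $\mathcal G^*$ is a D graph. Hence there are D graphs whose generating functions are not Schur positive. -/

import Mathlib

/-! ### Quasisymmetric functions and Schur functions

Power series in countably many commuting variables `x_0, x_1, x_2, …` with integer coefficients. -/

/-- Gessel's fundamental quasisymmetric function of degree `n` attached to `D ⊆ {1, …, n - 1}`: the
sum of the monomials `x_{s_1} ⋯ x_{s_n}` over all `s_1 ≤ ⋯ ≤ s_n` such that `s_j < s_{j+1}` for all
`j ∈ D`.  (The entry `s_{j+1}` is `s ⟨j, _⟩` below.) -/
noncomputable def fundamentalQSym (n : ℕ) (D : Set ℕ) : MvPowerSeries ℕ ℤ := fun m =>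
  (Nat.card {s : Fin n → ℕ // Monotone s ∧
    (∀ (j : ℕ) (hj : j + 1 < n), j + 1 ∈ D → s ⟨j, by omega⟩ < s ⟨j + 1, hj⟩) ∧
    ∑ j, Finsupp.single (s j) 1 = m} : ℤ)

/-- The Schur function `s_μ`, the sum of `x^T` over all semistandard Young tableaux `T` of
shape `μ`. -/
noncomputable def schurFunction (μ : YoungDiagram) : MvPowerSeries ℕ ℤ := fun m =>
  (Nat.card {T : SemistandardYoungTableau μ //
    ∑ c ∈ μ.cells, Finsupp.single (T c.1 c.2) 1 = m} : ℤ)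

/-- `f = ∑_μ c_μ s_μ`, a finite integral combination of Schur functions. -/
def HasSchurExpansion (f : MvPowerSeries ℕ ℤ) (c : YoungDiagram →₀ ℤ) : Prop :=
  f = c.sum fun μ a => a • schurFunction μ

/-- `f` has an expansion in Schur functions, and the coefficient of `s_μ` in it is `a`. -/
def HasSchurCoeff (f : MvPowerSeries ℕ ℤ) (μ : YoungDiagram) (a : ℤ) : Prop :=
  (∃ c, HasSchurExpansion f c) ∧ ∀ c, HasSchurExpansion f c → c μ = a

/-- `f` is Schur positive: a combination of Schur functions with nonnegative coefficients. -/
def SchurPositive (f : MvPowerSeries ℕ ℤ) : Prop :=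
  ∃ c, HasSchurExpansion f c ∧ ∀ μ, 0 ≤ c μ

/-- The partition `(2, 2, 2, 2)`. -/
def shape2222 : YoungDiagram := YoungDiagram.ofRowLens [2, 2, 2, 2] (by decide)

/-! ### Signed, colored graphs -/

/-- A signed, colored graph of degree `n` on `V`: edges colored by `{2, …, n - 1}` (an edge may
carry several colors) and a signature `σ v = (σ v 1, …, σ v (n - 1))` of signs for every vertex.
Values of `σ v` outside the index range `1, …, n - 1` are irrelevant and never used. -/
structure SignedColoredGraph (n : ℕ) (V : Type*) where
  /-- the graph of the `i`-edges -/
  edge : ℕ → SimpleGraph V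
  /-- the signature function -/
  σ : V → ℕ → ℤˣ
  color_mem : ∀ i v w, (edge i).Adj v w → 2 ≤ i ∧ i < n

namespace SignedColoredGraph

variable {n : ℕ} {V : Type*} (G : SignedColoredGraph n V)

/-- `v` admits an `i`-neighbor. -/
def Admits (i : ℕ) (v : V) : Prop := ∃ w, (G.edge i).Adj v w

/-- `v` has `i`-type W: it admits an `i`-neighbor and an `(i-1)`-neighbor, and
`σ(v)_i = -σ(E_{i-1}(v))_i`. -/
def TypeW (i : ℕ) (v : V) : Prop :=
  G.Admits i v ∧ ∃ u, (G.edge (i - 1)).Adj v u ∧ G.σ v i = -G.σ u i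

/-- The graph of all edges, with colors forgotten. -/
def underlying : SimpleGraph V := ⨆ i, G.edge i

/-- The restriction of `G` to the interval `{k + 1, …, k + d}`, a graph of degree `d`: the color
`k + t` becomes `t` for `2 ≤ t ≤ d - 1`, other edges are dropped, and signatures are shifted
accordingly. -/
def restrict (k d : ℕ) : SignedColoredGraph d V where
  edge t := if 2 ≤ t ∧ t < d then G.edge (k + t) else ⊥
  σ v s := G.σ v (k + s)
  color_mem t v w h := by
    by_contra hc
    rw [if_neg hc] at h
    exact h

open Classical in
/-- The generating function of the connected component of `v`. -/
noncomputable def componentGenFun [Fintype V] (v : V) : MvPowerSeries ℕ ℤ :=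
  ∑ w : V with G.underlying.Reachable v w, fundamentalQSym n {i | G.σ w i = -1}

/-- The generating function of `G`. -/
noncomputable def genFun [Fintype V] : MvPowerSeries ℕ ℤ :=
  ∑ w : V, fundamentalQSym n {i | G.σ w i = -1}

/-- Each vertex has at most one `i`-neighbor. -/
def Axiom0 : Prop :=
  ∀ i v w w', (G.edge i).Adj v w → (G.edge i).Adj v w' → w = w'

def Axiom1 : Prop :=
  G.Axiom0 ∧ ∀ i w, 2 ≤ i → i < n → (G.Admits i w ↔ G.σ w (i - 1) = -G.σ w i)

def Axiom2 : Prop :=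
  ∀ i w x, (G.edge i).Adj w x →
    G.σ w (i - 1) = -G.σ x (i - 1) ∧ G.σ w i = -G.σ x i ∧
    ∀ h, 1 ≤ h → h < n → (h + 2 < i ∨ i + 1 < h) → G.σ w h = G.σ x h

def Axiom3 : Prop :=
  ∀ i w x, (G.edge i).Adj w x →
    (3 ≤ i → G.σ w (i - 2) = -G.σ x (i - 2) → G.σ w (i - 2) = -G.σ w (i - 1)) ∧
    (i + 1 < n → G.σ w (i + 1) = -G.σ x (i + 1) → G.σ w (i + 1) = -G.σ w i)

/-- The two restrictions are those to `[i-3, i]` and to `[i-2, i+1]`. -/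
def Axiom4a [Fintype V] : Prop :=
  ∀ i w v, 4 ≤ i → i < n → (G.edge (i - 1)).Adj w v → ¬ (G.edge i).Adj w v →
    G.σ w (i - 3) ≠ G.σ v (i - 3) → G.σ w i ≠ G.σ v i →
    (G.restrict (i - 4) 4).componentGenFun w = (G.restrict (i - 3) 4).componentGenFun w

/-- `z = E_{i-2} (E_{i-1} E_{i-2})^m y` for some `m ≥ 0` for which `(E_{i-1} E_{i-2})^m y` does not
have `(i-1)`-type W; all the `E`'s are applied along edges. -/
def FlatStep (i : ℕ) (y z : V) : Prop :=
  ∃ u, Relation.ReflTransGen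
      (fun p q => ∃ r, (G.edge (i - 2)).Adj p r ∧ (G.edge (i - 1)).Adj r q) y u ∧
    ¬ G.TypeW (i - 1) u ∧ (G.edge (i - 2)).Adj u z

/-- `z` lies on the `(i-2)`-`(i-1)`-string containing `y`, and `E_{i-2} z` does not have
`(i-1)`-type W. -/
def WeakFlatStep (i : ℕ) (y z : V) : Prop :=
  (G.edge (i - 2) ⊔ G.edge (i - 1)).Reachable y z ∧
    ∃ u, (G.edge (i - 2)).Adj z u ∧ ¬ G.TypeW (i - 1) u

/-- `(x 1, …, x (2 * h))` is a sequence of distinct vertices admitting `(i-2)`-neighbors such that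
`x (2 * j - 1) = E_i (x (2 * j))`, and `x (2 * j)`, `x (2 * j + 1)` are related by `step`. -/
def IsChain (step : V → V → Prop) (i h : ℕ) (x : ℕ → V) : Prop :=
  Set.InjOn x (Set.Icc 1 (2 * h)) ∧
  (∀ j, 1 ≤ j → j ≤ 2 * h → G.Admits (i - 2) (x j)) ∧
  (∀ j, 1 ≤ j → j ≤ h → (G.edge i).Adj (x (2 * j)) (x (2 * j - 1))) ∧
  (∀ j, 1 ≤ j → j < h → step (x (2 * j)) (x (2 * j + 1)))

/-- Flat `i`-chains of length `2 * h`. -/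
def FlatChain (i h : ℕ) (x : ℕ → V) : Prop := G.IsChain (G.FlatStep i) i h x

/-- Weak flat `i`-chains of length `2 * h`. -/
def WeakFlatChain (i h : ℕ) (x : ℕ → V) : Prop := G.IsChain (G.WeakFlatStep i) i h x

/-- If `x j` has `(i+1)`-type W for some `2 < j < 2 * h - 1`, then so do all of `x 1, …, x j` or
all of `x j, …, x (2 * h)`. -/
def ChainCondition (i h : ℕ) (x : ℕ → V) : Prop :=
  ∀ j, 2 < j → j < 2 * h - 1 → G.TypeW (i + 1) (x j) →
    (∀ k, 1 ≤ k → k ≤ j → G.TypeW (i + 1) (x k)) ∨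
    (∀ k, j ≤ k → k ≤ 2 * h → G.TypeW (i + 1) (x k))

/-- Axiom 4'b (for graphs that satisfy axiom 0). -/
def Axiom4b : Prop :=
  ∀ i h x, 4 ≤ i → i < n → G.FlatChain i h x → G.ChainCondition i h x

/-- Axiom 4''b (for graphs that satisfy axiom 0). -/
def Axiom4bStrong : Prop :=
  ∀ i h x, 4 ≤ i → i < n → G.WeakFlatChain i h x → G.ChainCondition i h x

def Axiom5 : Prop :=
  ∀ i j w x y, (i + 3 ≤ j ∨ j + 3 ≤ i) → (G.edge i).Adj w x → (G.edge j).Adj x y →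
    ∃ v, (G.edge j).Adj w v ∧ (G.edge i).Adj v y

/-- Local Schur positivity for degree `d`: each component of each restriction of `G` to an interval
of size `d` in `{1, …, n}` has a Schur positive generating function. -/
def LSP [Fintype V] (d : ℕ) : Prop :=
  ∀ k, k + d ≤ n → ∀ v, SchurPositive ((G.restrict k d).componentGenFun v)

/-- D graphs in the sense of Assaf. -/
def IsDGraph [Fintype V] : Prop :=
  G.Axiom1 ∧ G.Axiom2 ∧ G.Axiom3 ∧ G.Axiom4a ∧ G.Axiom4b ∧ G.Axiom5 ∧ G.LSP 4 ∧ G.LSP 5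

end SignedColoredGraph

/-! ### Words and D₀ graphs -/

/-- Words of length `n` without repeated letters in the alphabet `{1, …, N}`; for `N = n` these are
the permutations of `n` in one-line notation. -/
def IsWord (n N : ℕ) (w : List ℕ) : Prop :=
  w.length = n ∧ w.Nodup ∧ ∀ a ∈ w, 1 ≤ a ∧ a ≤ N

/-- The descent set `{i ∈ {1, …, n - 1} | w_i > w_{i+1}}` of a word of length `n`; the letter `w_i`
is `w.getD (i - 1) 0`. -/
def descentSet (w : List ℕ) : Set ℕ :=
  {i | 1 ≤ i ∧ i < w.length ∧ w.getD i 0 < w.getD (i - 1) 0}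

/-- `{x, y}` is `{v bac w, v bca w}` or `{v acb w, v cab w}` with `a < b < c` and `|v| = i - 2`. -/
def KnuthPair (i : ℕ) (x y : List ℕ) : Prop :=
  ∃ (v w : List ℕ) (a b c : ℕ), a < b ∧ b < c ∧ v.length + 2 = i ∧
    (({x, y} : Set (List ℕ)) = {v ++ [b, a, c] ++ w, v ++ [b, c, a] ++ w} ∨
     ({x, y} : Set (List ℕ)) = {v ++ [a, c, b] ++ w, v ++ [c, a, b] ++ w})

/-- `{x, y}` is `{v bac w, v acb w}` or `{v bca w, v cab w}` with `a < b < c` and `|v| = i - 2`. -/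
def RotationPair (i : ℕ) (x y : List ℕ) : Prop :=
  ∃ (v w : List ℕ) (a b c : ℕ), a < b ∧ b < c ∧ v.length + 2 = i ∧
    (({x, y} : Set (List ℕ)) = {v ++ [b, a, c] ++ w, v ++ [a, c, b] ++ w} ∨
     ({x, y} : Set (List ℕ)) = {v ++ [b, c, a] ++ w, v ++ [c, a, b] ++ w})

/-- The four words `v bac w`, `v bca w`, `v acb w`, `v cab w`. -/
def krSquare (v w : List ℕ) (a b c : ℕ) : Set (List ℕ) :=
  {v ++ [b, a, c] ++ w, v ++ [b, c, a] ++ w, v ++ [a, c, b] ++ w, v ++ [c, a, b] ++ w}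

/-- A D₀ graph of degree `n` over the alphabet `{1, …, N}`. -/
structure D0Graph (n N : ℕ) where
  /-- the vertex set -/
  verts : Finset (List ℕ)
  isWord : ∀ w ∈ verts, IsWord n N w
  /-- the graph of the `i`-edges -/
  edge : ℕ → SimpleGraph {w : List ℕ // w ∈ verts}
  color_mem : ∀ i x y, (edge i).Adj x y → 2 ≤ i ∧ i < n
  edge_type : ∀ i x y, (edge i).Adj x y → KnuthPair i x y ∨ RotationPair i x y
  existsUnique_edge : ∀ (v w : List ℕ) (a b c : ℕ), a < b → b < c →
    ∀ x : {w : List ℕ // w ∈ verts}, (x : List ℕ) ∈ krSquare v w a b c →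
      ∃! y, (edge (v.length + 2)).Adj x y

namespace D0Graph

variable {n N : ℕ} (G : D0Graph n N)

/-- The generating function `∑_w Q_{Des(w)}` over the vertices `w`. -/
noncomputable def genFun : MvPowerSeries ℕ ℤ :=
  ∑ w ∈ G.verts, fundamentalQSym n (descentSet w)

open Classical in
/-- A D₀ graph as a signed, colored graph: `σ(w)_i = -1` exactly if `i` is a descent of `w`. -/
noncomputable def toSignedColoredGraph :
    SignedColoredGraph n {w : List ℕ // w ∈ G.verts} where
  edge := G.edge
  σ w i := if i ∈ descentSet w.1 then -1 else 1
  color_mem := G.color_mem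

end D0Graph

/-! The graph is the disjoint union of an exceptional part of 126 words (`coreData`), some of whose
edges are rotation edges, and of 4824 words forming full inverse descent classes, all of whose edges
are Knuth edges. A Knuth move preserves the inverse descent set, so such a class is closed under its
moves, and it contributes a ribbon Schur function to the generating function. None of the chosen
ribbon functions involves the shape (2,2,2,2): these classes only raise the number of vertices to
4950, and the coefficient -1 comes from the exceptional part.

Most axioms hold for structural reasons. Axioms 1, 2 and 3 follow from the shape of a single move.
Axiom 5 holds because the kind of a move (Knuth or rotation) is unaffected by moves of disjoint
windows, which is part of `IsMoveSystem`. LSP_4 and LSP_5 hold for every system of moves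
(`lsp_of_localCheck`): on permutations of d letters, the indicator of "all descents are cuts of c"
equals a sum of Kostka numbers, weighted by indicator functions of the permutation, plus functions
that change sign under both kinds of move of one window. Summed over a component, the sign-changing
part cancels along the edges.

Axiom 4'a can only be violated at a rotation edge, since a Knuth move keeps the first or the last
letter of its window; this leaves a finite check on the exceptional part. For axiom 4''b, a Knuth
component contains no weak flat chain of six vertices, a fact about patterns of five letters; on the
exceptional part the chains are checked directly (`chainCheck`). Axiom 4'b is a special case of
4''b.

For the generating function, coefficients are compared monomial by monomial. Those of a Schur
function are Kostka numbers, computed by stripping off the largest letter (`ncard_fillings`); those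
of a fundamental quasisymmetric function are 0 or 1 (`fundamentalQSym_apply`). Only compositions of
8 matter, and they are handled by one computation (`expansionCheck_schurTerms`). Triangularity of
the Kostka numbers makes the expansion unique (`eq_zero_of_sum_schurFunction_eq_zero`), so the
coefficient -1 excludes Schur positivity. -/

/-! ### Counting semistandard tableaux by their largest entry -/

/-- The `i`-th part of `l`, with `0` beyond the end of the list. -/
def part (l : List ℕ) (i : ℕ) : ℕ := l.getD i 0

@[simp] theorem part_nil (i : ℕ) : part [] i = 0 := rfl

@[simp] theorem part_cons_zero (x : ℕ) (t : List ℕ) : part (x :: t) 0 = x := rfl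

@[simp] theorem part_cons_succ (x : ℕ) (t : List ℕ) (i : ℕ) : part (x :: t) (i + 1) = part t i :=
  rfl

theorem part_of_length_le {l : List ℕ} {i : ℕ} (h : l.length ≤ i) : part l i = 0 :=
  List.getD_eq_default _ _ h

theorem list_sum_eq_sum_part (l : List ℕ) : l.sum = ∑ i ∈ Finset.range l.length, part l i := by
  induction l with
  | nil => rfl
  | cons x t ih => rw [List.sum_cons, ih, List.length_cons, Finset.sum_range_succ']; simp [add_comm]

/-- The partitions `ν`, padded with zeros to the length of `l`, such that `l / ν` is a horizontal
strip of size `a`. -/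
def strips : ℕ → List ℕ → List (List ℕ)
  | 0, [] => [[]]
  | _ + 1, [] => []
  | a, x :: t => (List.range (min a (x - part t 0) + 1)).flatMap fun k =>
      (strips (a - k) t).map ((x - k) :: ·)

/-- The number of semistandard tableaux of shape `l` with `c_1` entries equal to the largest
letter, `c_2` entries equal to the second largest letter, and so on. -/
def kostka : List ℕ → List ℕ → ℕ
  | [], l => if l.sum = 0 then 1 else 0
  | a :: c, l => ((strips a l).map (kostka c)).sum

/-- `l` is weakly decreasing. -/
def IsShape (l : List ℕ) : Prop := ∀ i, part l (i + 1) ≤ part l i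

/-- `l / ν` is a horizontal strip. -/
def Interlaces (ν l : List ℕ) : Prop :=
  ν.length = l.length ∧ ∀ i, part l (i + 1) ≤ part ν i ∧ part ν i ≤ part l i

theorem IsShape.tail {x : ℕ} {t : List ℕ} (h : IsShape (x :: t)) : IsShape t := fun i => by
  simpa using h (i + 1)

theorem Interlaces.isShape {ν l : List ℕ} (h : Interlaces ν l) : IsShape ν := fun i =>
  (h.2 (i + 1)).2.trans (h.2 i).1

theorem interlaces_cons {y x : ℕ} {ν t : List ℕ} :
    Interlaces (y :: ν) (x :: t) ↔ part t 0 ≤ y ∧ y ≤ x ∧ Interlaces ν t := by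
  constructor
  · rintro ⟨h1, h2⟩
    exact ⟨by simpa using (h2 0).1, by simpa using (h2 0).2, by simpa using h1, fun i => by
      simpa using h2 (i + 1)⟩
  · rintro ⟨h1, h2, h3, h4⟩
    refine ⟨by simpa using h3, fun i => ?_⟩
    cases i with
    | zero => exact ⟨by simpa using h1, by simpa using h2⟩
    | succ i => simpa using h4 i

theorem Interlaces.sum_le {ν l : List ℕ} (h : Interlaces ν l) : ν.sum ≤ l.sum := by
  rw [list_sum_eq_sum_part, list_sum_eq_sum_part, h.1]
  exact Finset.sum_le_sum fun i _ => (h.2 i).2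

/-- At most `x - part t 0` cells may leave the first row, so that it still covers the second row of
`l`. The subtraction is truncated, which is why `l` has to be weakly decreasing. -/
theorem mem_strips {a : ℕ} {l ν : List ℕ} (hl : IsShape l) :
    ν ∈ strips a l ↔ Interlaces ν l ∧ ν.sum + a = l.sum := by
  induction l generalizing a ν with
  | nil =>
    have h : Interlaces ν [] ↔ ν = [] := by
      constructor
      · rintro ⟨h, -⟩; simpa using h
      · rintro rfl; exact ⟨rfl, by simp⟩
    cases a with
    | zero => simp [strips, h]; rintro rfl; rfl
    | succ a => simp [strips, h]
  | cons x t ih =>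
    have hx : part t 0 ≤ x := by simpa using hl 0
    rw [strips, List.mem_flatMap]
    cases ν with
    | nil =>
      simp [Interlaces]
    | cons y ν =>
      rw [interlaces_cons]
      simp only [List.mem_range, List.mem_map, List.cons.injEq, List.sum_cons]
      constructor
      · rintro ⟨k, hk, ν', h1, h2, rfl⟩
        obtain ⟨h3, h4⟩ := (ih hl.tail).1 h1
        refine ⟨⟨?_, ?_, h3⟩, ?_⟩ <;> omega
      · rintro ⟨⟨h1, h2, h3⟩, h4⟩
        have h5 := h3.sum_le
        exact ⟨x - y, by omega, ν, (ih hl.tail).2 ⟨h3, by omega⟩, by omega, rfl⟩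

theorem nodup_strips (a : ℕ) (l : List ℕ) : (strips a l).Nodup := by
  induction l generalizing a with
  | nil => cases a <;> simp [strips]
  | cons x t ih =>
    rw [strips, List.nodup_flatMap]
    refine ⟨fun k _ => (ih _).map fun _ _ h => (List.cons.inj h).2, ?_⟩
    refine List.Pairwise.imp_of_mem ?_ List.nodup_range
    intro k k' hk hk' hne
    rw [Function.onFun, List.disjoint_left]
    intro ν h1 h2
    simp only [List.mem_map, List.mem_range] at h1 h2 hk hk'
    obtain ⟨_, _, rfl⟩ := h1
    obtain ⟨_, _, h⟩ := h2
    have := (List.cons.inj h).1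
    omega

/-- The semistandard fillings of shape `l` with entries smaller than `N`, among them `m v` entries
`v` for each `v < N`; the filling is `0` outside of the shape. -/
def fillings (l : List ℕ) (N : ℕ) (m : ℕ → ℕ) : Set (ℕ → ℕ → ℕ) :=
  {T | (∀ i j, j + 1 < part l i → T i j ≤ T i (j + 1)) ∧
    (∀ i j, j < part l (i + 1) → T i j < T (i + 1) j) ∧
    (∀ i j, part l i ≤ j → T i j = 0) ∧
    (∀ i j, j < part l i → T i j < N) ∧
    ∀ v < N, ∑ i ∈ Finset.range l.length,
      ((Finset.range (part l i)).filter fun j => T i j = v).card = m v}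

/-- Fill the cells of `l / ν` with `N`. -/
def fillStrip (l ν : List ℕ) (N : ℕ) (T : ℕ → ℕ → ℕ) (i j : ℕ) : ℕ :=
  if j < part ν i then T i j else if j < part l i then N else 0

theorem row_le_of_mem_fillings {l : List ℕ} {N : ℕ} {m : ℕ → ℕ} {T : ℕ → ℕ → ℕ}
    (h : T ∈ fillings l N m) {i j k : ℕ} (hjk : j ≤ k) (hk : k < part l i) : T i j ≤ T i k := by
  induction k, hjk using Nat.le_induction with
  | base => exact le_rfl
  | succ k hjk ih => exact (ih (by omega)).trans (h.1 i k hk)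

theorem fillStrip_lt_iff {l ν : List ℕ} {N : ℕ} {m : ℕ → ℕ} {T : ℕ → ℕ → ℕ}
    (hT : T ∈ fillings ν N m) {i j : ℕ} (hj : j < part l i) :
    fillStrip l ν N T i j < N ↔ j < part ν i := by
  unfold fillStrip
  split_ifs with h1
  · exact iff_of_true (hT.2.2.2.1 i j h1) h1
  · exact iff_of_false (lt_irrefl _) h1

/-- The new cells lie in different columns because they form a horizontal strip, so columns stay
strict when all of them receive the largest entry `N`. -/
theorem fillStrip_mem {l ν : List ℕ} {N : ℕ} {m : ℕ → ℕ} {T : ℕ → ℕ → ℕ}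
    (hν : Interlaces ν l) (hs : ν.sum + m N = l.sum) (hT : T ∈ fillings ν N m) :
    fillStrip l ν N T ∈ fillings l (N + 1) m := by
  have hb := hT.2.2.2.1
  refine ⟨fun i j h => ?_, fun i j h => ?_, fun i j h => ?_, fun i j h => ?_, fun v hv => ?_⟩
  · unfold fillStrip
    have := hb i j
    split_ifs <;> first | omega | exact hT.1 i j ‹_›
  · have h1 := (hν.2 i).1
    have h2 := hb i j (by omega)
    unfold fillStrip
    rw [if_pos (by omega : j < part ν i)]
    split_ifs with h3
    · exact hT.2.1 i j h3
    · exact h2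
  · have := (hν.2 i).2
    unfold fillStrip
    rw [if_neg (by omega), if_neg (by omega)]
  · unfold fillStrip
    have := hb i j
    split_ifs <;> omega
  · rcases Nat.lt_succ_iff_lt_or_eq.1 hv with h | rfl
    · rw [← hT.2.2.2.2 v h, hν.1]
      refine Finset.sum_congr rfl fun i _ => congrArg _ ?_
      ext j
      have h1 := (hν.2 i).2
      simp only [Finset.mem_filter, Finset.mem_range]
      unfold fillStrip
      split_ifs <;> omega
    · have h1 : ∀ i, ((Finset.range (part l i)).filter fun j => fillStrip l ν v T i j = v).card
          = part l i - part ν i := by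
        intro i
        have h1 := (hν.2 i).2
        have : ((Finset.range (part l i)).filter fun j => fillStrip l ν v T i j = v)
            = Finset.Ico (part ν i) (part l i) := by
          ext j
          have := hb i j
          simp only [Finset.mem_filter, Finset.mem_range, Finset.mem_Ico]
          unfold fillStrip
          split_ifs <;> omega
        rw [this, Nat.card_Ico]
      rw [Finset.sum_congr rfl fun i _ => h1 i]
      have h2 : ∑ i ∈ Finset.range l.length, (part l i - part ν i)
          + ∑ i ∈ Finset.range l.length, part ν i = ∑ i ∈ Finset.range l.length, part l i := by
        rw [← Finset.sum_add_distrib]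
        refine Finset.sum_congr rfl fun i _ => ?_
        have := (hν.2 i).2
        omega
      rw [← list_sum_eq_sum_part, ← hν.1, ← list_sum_eq_sum_part] at h2
      rw [← hν.1]
      omega

/-- Rows increase weakly, so the entries smaller than `N` form an initial segment of each row; their
numbers are the parts of `ν`. -/
theorem exists_fillStrip_eq {l : List ℕ} (hl : IsShape l) {N : ℕ} {m : ℕ → ℕ} {T : ℕ → ℕ → ℕ}
    (hT : T ∈ fillings l (N + 1) m) :
    ∃ ν, (Interlaces ν l ∧ ν.sum + m N = l.sum) ∧ ∃ S ∈ fillings ν N m, fillStrip l ν N S = T := by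
  set ν : List ℕ := (List.range l.length).map fun i =>
    ((Finset.range (part l i)).filter fun j => T i j < N).card with hνdef
  have hlen : ν.length = l.length := by simp [ν]
  have hget : ∀ i, part ν i = ((Finset.range (part l i)).filter fun j => T i j < N).card := by
    intro i
    by_cases hi : i < l.length
    · rw [part, List.getD_eq_getElem _ _ (by omega)]
      simp [ν]
    · rw [part_of_length_le (by omega), part_of_length_le (by omega)]
      simp
  have hle : ∀ i, part ν i ≤ part l i := by
    intro i
    rw [hget]
    exact (Finset.card_filter_le _ _).trans (by simp)
  have key : ∀ i j, j < part l i → (T i j < N ↔ j < part ν i) := by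
    intro i j hj
    constructor
    · intro h
      have : Finset.range (j + 1) ⊆ (Finset.range (part l i)).filter fun j => T i j < N := by
        intro k hk
        simp only [Finset.mem_range, Finset.mem_filter] at hk ⊢
        exact ⟨by omega, (row_le_of_mem_fillings hT (by omega : k ≤ j) hj).trans_lt h⟩
      have := Finset.card_le_card this
      rw [Finset.card_range, ← hget] at this
      omega
    · intro h
      by_contra hc
      have : ((Finset.range (part l i)).filter fun j => T i j < N) ⊆ Finset.range j := by
        intro k hk
        simp only [Finset.mem_range, Finset.mem_filter] at hk ⊢
        by_contra hjk
        exact hc ((row_le_of_mem_fillings hT (by omega : j ≤ k) hk.1).trans_lt hk.2)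
      have := Finset.card_le_card this
      rw [Finset.card_range, ← hget] at this
      omega
  have hN : ∀ i j, j < part l i → ¬ j < part ν i → T i j = N := by
    intro i j hj h
    have := hT.2.2.2.1 i j hj
    rw [← key i j hj] at h
    omega
  have hint : Interlaces ν l := by
    refine ⟨hlen, fun i => ⟨?_, hle i⟩⟩
    -- Otherwise the first cell of row `i` filled with `N` would have a cell of the shape below it,
    -- whose entry would exceed `N`.
    by_contra hc
    have h1 : part ν i < part l (i + 1) := by omega
    have h2 := hT.2.1 i _ h1
    have h3 := hT.2.2.2.1 (i + 1) _ h1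
    have := (key i _ (h1.trans_le (hl i))).1 (by omega)
    omega
  have hsum : ν.sum + m N = l.sum := by
    have h1 : ∀ i, ((Finset.range (part l i)).filter fun j => T i j = N).card
        = part l i - part ν i := by
      intro i
      have : ((Finset.range (part l i)).filter fun j => T i j = N)
          = Finset.Ico (part ν i) (part l i) := by
        ext j
        have h1 := key i j
        have h2 := hN i j
        simp only [Finset.mem_filter, Finset.mem_range, Finset.mem_Ico]
        constructor
        · rintro ⟨h3, h4⟩
          have := (h1 h3).2
          omega
        · rintro ⟨h3, h4⟩
          exact ⟨h4, h2 h4 (by omega)⟩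
      rw [this, Nat.card_Ico]
    rw [← hT.2.2.2.2 N (by omega), Finset.sum_congr rfl fun i _ => h1 i, list_sum_eq_sum_part ν,
      list_sum_eq_sum_part l, hlen, ← Finset.sum_add_distrib]
    refine Finset.sum_congr rfl fun i _ => ?_
    have := hle i
    omega
  refine ⟨ν, ⟨hint, hsum⟩, fun i j => if j < part ν i then T i j else 0,
    ⟨fun i j h => ?_, fun i j h => ?_, fun i j h => ?_, fun i j h => ?_, fun v hv => ?_⟩, ?_⟩
  · dsimp only
    rw [if_pos (by omega), if_pos h]
    exact hT.1 i j (h.trans_le (hle i))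
  · dsimp only
    rw [if_pos h, if_pos (h.trans_le (hint.isShape i))]
    exact hT.2.1 i j (h.trans_le (hle _))
  · exact if_neg (by omega)
  · dsimp only
    rw [if_pos h]
    exact (key i j (h.trans_le (hle i))).2 h
  · rw [← hT.2.2.2.2 v (by omega), hlen]
    refine Finset.sum_congr rfl fun i _ => congrArg _ ?_
    ext j
    have h1 := key i j
    have h2 := hle i
    simp only [Finset.mem_filter, Finset.mem_range]
    constructor
    · rintro ⟨h3, h4⟩
      rw [if_pos h3] at h4
      exact ⟨by omega, h4⟩
    · rintro ⟨h3, h4⟩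
      have := (h1 h3).1 (by omega)
      rw [if_pos this]
      exact ⟨this, h4⟩
  · funext i j
    have h1 := hle i
    unfold fillStrip
    dsimp only
    split_ifs with h2 h3
    · rfl
    · exact (hN i j h3 h2).symm
    · exact (hT.2.2.1 i j (by omega)).symm

/-- The inner shape is recovered as the set of cells with entries smaller than `N`, and the inner
filling as the restriction to it. -/
theorem fillStrip_injective {l ν ν' : List ℕ} {N : ℕ} {m : ℕ → ℕ} {S S' : ℕ → ℕ → ℕ}
    (hν : Interlaces ν l) (hν' : Interlaces ν' l) (hS : S ∈ fillings ν N m)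
    (hS' : S' ∈ fillings ν' N m) (h : fillStrip l ν N S = fillStrip l ν' N S') :
    ν = ν' ∧ S = S' := by
  have h1 : ∀ i, part ν i = part ν' i := by
    intro i
    have key : ∀ j, j < part l i → (j < part ν i ↔ j < part ν' i) := fun j hj => by
      rw [← fillStrip_lt_iff hS hj, ← fillStrip_lt_iff hS' hj, h]
    have h2 := (hν.2 i).2
    have h3 := (hν'.2 i).2
    by_contra hne
    rcases lt_or_gt_of_ne hne with h4 | h4
    · have := key (part ν i) (by omega)
      omega
    · have := key (part ν' i) (by omega)
      omega
  have h2 : ν = ν' := by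
    refine List.ext_getElem (hν.1.trans hν'.1.symm) fun i hi hi' => ?_
    have := h1 i
    rwa [part, part, List.getD_eq_getElem _ _ hi, List.getD_eq_getElem _ _ hi'] at this
  subst h2
  refine ⟨rfl, ?_⟩
  funext i j
  by_cases hj : j < part ν i
  · have := congrFun (congrFun h i) j
    simpa [fillStrip, hj] using this
  · rw [hS.2.2.1 i j (by omega), hS'.2.2.1 i j (by omega)]

/-- Induction on the number of letters, removing the cells with the largest one. Producing a finite
set gives finiteness together with the count; `Nat.card` alone would not see an infinite set. -/
theorem exists_finset_fillings (l : List ℕ) (hl : IsShape l) (N : ℕ) (m : ℕ → ℕ) :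
    ∃ s : Finset (ℕ → ℕ → ℕ), (s : Set (ℕ → ℕ → ℕ)) = fillings l N m ∧
      s.card = kostka ((List.range N).map m).reverse l := by
  classical
  induction N generalizing l with
  | zero =>
    by_cases h : l.sum = 0
    · have hz : ∀ i, part l i = 0 := by
        intro i
        by_cases hi : i < l.length
        · rw [list_sum_eq_sum_part, Finset.sum_eq_zero_iff] at h
          exact h i (Finset.mem_range.2 hi)
        · exact part_of_length_le (by omega)
      refine ⟨{fun _ _ => 0}, ?_, by simp [kostka, h]⟩
      ext T
      simp only [Finset.coe_singleton, Set.mem_singleton_iff]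
      constructor
      · rintro rfl
        simp [fillings, hz]
      · intro hT
        funext i j
        exact hT.2.2.1 i j (by simp [hz])
    · refine ⟨∅, ?_, by simp [kostka, h]⟩
      rw [Finset.coe_empty, eq_comm, Set.eq_empty_iff_forall_notMem]
      intro T hT
      refine h ?_
      rw [list_sum_eq_sum_part]
      refine Finset.sum_eq_zero fun i _ => ?_
      by_contra hi
      exact absurd (hT.2.2.2.1 i 0 (by omega)) (by omega)
  | succ N ih =>
    choose! s hs hc using ih
    refine ⟨(strips (m N) l).toFinset.biUnion fun ν => (s ν).image (fillStrip l ν N), ?_, ?_⟩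
    · ext T
      simp only [Finset.coe_biUnion, List.mem_toFinset, Finset.coe_image, Set.mem_iUnion,
        Set.mem_image, exists_prop, SetLike.mem_coe, mem_strips hl]
      constructor
      · rintro ⟨ν, ⟨h1, h2⟩, S, h3, rfl⟩
        rw [← Finset.mem_coe, hs ν h1.isShape] at h3
        exact fillStrip_mem h1 h2 h3
      · intro hT
        obtain ⟨ν, h1, S, h2, h3⟩ := exists_fillStrip_eq hl hT
        rw [← hs ν h1.1.isShape] at h2
        exact ⟨ν, h1, S, h2, h3⟩
    · have hmem : ∀ ν ∈ (strips (m N) l).toFinset, Interlaces ν l := fun ν h =>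
        ((mem_strips hl).1 (List.mem_toFinset.1 h)).1
      rw [Finset.card_biUnion]
      · rw [List.range_succ, List.map_append, List.reverse_append]
        simp only [List.map_cons, List.map_nil, List.reverse_singleton, List.singleton_append,
          kostka]
        rw [← List.sum_toFinset _ (nodup_strips _ _)]
        refine Finset.sum_congr rfl fun ν hν => ?_
        rw [← hc ν (hmem ν hν).isShape]
        refine Finset.card_image_of_injOn fun S hS S' hS' h => ?_
        rw [hs ν (hmem ν hν).isShape] at hS hS'
        exact (fillStrip_injective (hmem ν hν) (hmem ν hν) hS hS' h).2
      · intro ν hν ν' hν' hne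
        rw [Function.onFun, Finset.disjoint_left]
        intro T h1 h2
        rw [Finset.mem_image] at h1 h2
        obtain ⟨S, hS, rfl⟩ := h1
        obtain ⟨S', hS', h⟩ := h2
        rw [← Finset.mem_coe, hs _ (hmem _ ‹_›).isShape] at hS hS'
        exact hne (fillStrip_injective (hmem ν' hν') (hmem ν hν) hS' hS h).1.symm

theorem ncard_fillings (l : List ℕ) (hl : IsShape l) (N : ℕ) (m : ℕ → ℕ) :
    Nat.card (fillings l N m) = kostka ((List.range N).map m).reverse l := by
  obtain ⟨s, hs, hc⟩ := exists_finset_fillings l hl N m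
  rw [← hs, ← hc]
  simp

/-! ### Kostka numbers as coefficients of Schur functions -/

/-- The Young diagram with row lengths `l`, if `l` is weakly decreasing. -/
def diagram (l : List ℕ) : YoungDiagram :=
  if h : l.SortedGE then YoungDiagram.ofRowLens l h else ⊥

theorem isShape_of_sortedGE {l : List ℕ} (h : l.SortedGE) : IsShape l := by
  intro i
  by_cases hi : i + 1 < l.length
  · rw [part, part, List.getD_eq_getElem _ _ hi, List.getD_eq_getElem _ _ (by omega)]
    exact h.getElem_ge_getElem_of_le (by omega)
  · rw [part_of_length_le (by omega)]
    exact Nat.zero_le _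

theorem mem_diagram {l : List ℕ} (h : l.SortedGE) {i j : ℕ} :
    (i, j) ∈ diagram l ↔ j < part l i := by
  rw [diagram, dif_pos h, YoungDiagram.mem_ofRowLens]
  constructor
  · rintro ⟨h1, h2⟩
    rwa [part, List.getD_eq_getElem _ _ h1]
  · intro h1
    by_cases hi : i < l.length
    · exact ⟨hi, by rwa [part, List.getD_eq_getElem _ _ hi] at h1⟩
    · rw [part_of_length_le (by omega)] at h1
      omega

theorem finsupp_sum_single_apply {ι : Type*} (s : Finset ι) (f : ι → ℕ) (v : ℕ) :
    (∑ c ∈ s, Finsupp.single (f c) 1 : ℕ →₀ ℕ) v = (s.filter fun c => f c = v).card := by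
  rw [Finsupp.finsetSum_apply, Finset.card_filter]
  exact Finset.sum_congr rfl fun c _ => by rw [Finsupp.single_apply]

theorem card_filter_cells {l : List ℕ} (h : l.SortedGE) (T : ℕ → ℕ → ℕ) (v : ℕ) :
    ((diagram l).cells.filter fun c => T c.1 c.2 = v).card =
      ∑ i ∈ Finset.range l.length, ((Finset.range (part l i)).filter fun j => T i j = v).card := by
  rw [← Finset.card_sigma]
  refine Finset.card_bij' (fun c _ => ⟨c.1, c.2⟩) (fun c _ => (c.1, c.2)) ?_ ?_ ?_ ?_
  · rintro ⟨i, j⟩ hc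
    rw [Finset.mem_filter, YoungDiagram.mem_cells, mem_diagram h] at hc
    simp only [Finset.mem_sigma, Finset.mem_range, Finset.mem_filter]
    refine ⟨?_, hc⟩
    by_contra hi
    rw [part_of_length_le (by omega)] at hc
    exact absurd hc.1 (by omega)
  · rintro ⟨i, j⟩ hc
    simp only [Finset.mem_sigma, Finset.mem_range, Finset.mem_filter] at hc
    rw [Finset.mem_filter, YoungDiagram.mem_cells, mem_diagram h]
    exact hc.2
  · intros; rfl
  · intros; rfl

/-- An entry `v ≥ N` would force a nonzero exponent `m v`, so tableaux of content `m` have all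
entries below `N` and are exactly the fillings counted before. -/
theorem schurFunction_diagram_apply {l : List ℕ} (h : l.SortedGE) {m : ℕ →₀ ℕ} {N : ℕ}
    (hm : ∀ v, N ≤ v → m v = 0) :
    schurFunction (diagram l) m = (kostka ((List.range N).map m).reverse l : ℤ) := by
  rw [← ncard_fillings l (isShape_of_sortedGE h) N m]
  refine congrArg Nat.cast (Nat.card_congr ?_)
  have hcount : ∀ T : ℕ → ℕ → ℕ, (∑ c ∈ (diagram l).cells, Finsupp.single (T c.1 c.2) 1 = m) ↔
      ∀ v, ∑ i ∈ Finset.range l.length,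
        ((Finset.range (part l i)).filter fun j => T i j = v).card = m v := by
    intro T
    rw [Finsupp.ext_iff]
    refine forall_congr' fun v => ?_
    rw [finsupp_sum_single_apply _ (fun c : ℕ × ℕ => T c.1 c.2), card_filter_cells h]
  refine
    { toFun := fun T => ⟨T.1, ?_⟩
      invFun := fun T => ⟨⟨T.1, ?_, ?_, ?_⟩, ?_⟩
      left_inv := fun _ => rfl
      right_inv := fun _ => rfl }
  · obtain ⟨T, hT⟩ := T
    have hT' := (hcount T).1 hT
    refine ⟨fun i j hj => T.row_weak (by omega) ((mem_diagram h).2 hj),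
      fun i j hj => T.col_strict (by omega) ((mem_diagram h).2 hj),
      fun i j hj => T.zeros fun hc => ?_, fun i j hj => ?_, fun v _ => hT' v⟩
    · exact absurd ((mem_diagram h).1 hc) (by omega)
    · by_contra hN
      have h1 := hT' (T i j)
      rw [hm _ (not_lt.1 hN), Finset.sum_eq_zero_iff] at h1
      have h2 := h1 i (Finset.mem_range.2 (by
        by_contra hi
        rw [part_of_length_le (by omega)] at hj
        omega))
      rw [Finset.card_eq_zero, Finset.filter_eq_empty_iff] at h2
      exact h2 (Finset.mem_range.2 hj) rfl
  · intro i j k hjk hk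
    exact row_le_of_mem_fillings T.2 hjk.le ((mem_diagram h).1 hk)
  · intro i i' j hi hj
    induction i', hi using Nat.le_induction with
    | base => exact T.2.2.1 i j ((mem_diagram h).1 hj)
    | succ i' hi ih =>
      have hj' := (mem_diagram h).1 hj
      exact (ih ((mem_diagram h).2 (hj'.trans_le (isShape_of_sortedGE h i')))).trans
        (T.2.2.1 i' j hj')
  · intro i j hj
    rw [mem_diagram h] at hj
    exact T.2.2.2.1 i j (by omega)
  · refine (hcount T.1).2 fun v => ?_
    by_cases hv : v < N
    · exact T.2.2.2.2.2 v hv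
    · rw [hm v (by omega)]
      refine Finset.sum_eq_zero fun i _ => ?_
      rw [Finset.card_eq_zero, Finset.filter_eq_empty_iff]
      intro j hj
      have := T.2.2.2.2.1 i j (Finset.mem_range.1 hj)
      omega

/-! ### Coefficients of fundamental quasisymmetric functions -/

/-- The sums of the suffixes of a list. -/
def suffixSums : List ℕ → List ℕ
  | [] => [0]
  | a :: c => (a + c.sum) :: suffixSums c

theorem sum_filter_pos (c : List ℕ) : (c.filter fun a => 0 < a).sum = c.sum := by
  induction c with
  | nil => rfl
  | cons a c ih =>
    by_cases h : 0 < a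
    · simp [h, ih]
    · have : a = 0 := by omega
      simp [this, ih]

theorem suffixSums_filter_pos (c : List ℕ) (x : ℕ) :
    x ∈ suffixSums (c.filter fun a => 0 < a) ↔ x ∈ suffixSums c := by
  induction c with
  | nil => rfl
  | cons a c ih =>
    by_cases h : 0 < a
    · simp only [h, decide_true, List.filter_cons_of_pos, suffixSums, List.mem_cons, ih,
        sum_filter_pos]
    · have h0 : a = 0 := by omega
      subst h0
      have hmem : c.sum ∈ suffixSums c := by cases c <;> simp [suffixSums]
      simp only [lt_irrefl, decide_false, Bool.false_eq_true, not_false_eq_true,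
        List.filter_cons_of_neg, ih, suffixSums, List.mem_cons, zero_add]
      exact ⟨Or.inr, fun h => h.elim (fun h => h ▸ hmem) id⟩

/-- The content is listed from the largest letter down, as in `kostka`; hence its suffix sums are
the partial sums starting at the smallest letter. -/
theorem mem_suffixSums_reverse_map (m : ℕ → ℕ) (N x : ℕ) :
    x ∈ suffixSums ((List.range N).map m).reverse ↔
      ∃ v ≤ N, ∑ u ∈ Finset.range v, m u = x := by
  have hsum : ∀ N, ((List.range N).map m).reverse.sum = ∑ u ∈ Finset.range N, m u := by
    intro N
    rw [List.sum_reverse]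
    induction N with
    | zero => rfl
    | succ N ih =>
      rw [List.range_succ, List.map_append, List.sum_append, ih, Finset.sum_range_succ]
      simp
  induction N with
  | zero => simp [suffixSums, eq_comm]
  | succ N ih =>
    rw [List.range_succ, List.map_append, List.reverse_append]
    simp only [List.map_cons, List.map_nil, List.reverse_singleton, List.singleton_append,
      suffixSums, List.mem_cons, ih, hsum]
    constructor
    · rintro (rfl | ⟨v, hv, rfl⟩)
      · exact ⟨N + 1, le_rfl, by rw [Finset.sum_range_succ, add_comm]⟩
      · exact ⟨v, by omega, rfl⟩
    · rintro ⟨v, hv, rfl⟩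
      rcases Nat.le_succ_iff.1 hv with h | rfl
      · exact Or.inr ⟨v, h, rfl⟩
      · exact Or.inl (by rw [Finset.sum_range_succ, add_comm])

theorem card_lt_eq_sum {n : ℕ} {s : Fin n → ℕ} {m : ℕ → ℕ}
    (hm : ∀ v, (Finset.univ.filter fun j => s j = v).card = m v) (v : ℕ) :
    (Finset.univ.filter fun j => s j < v).card = ∑ u ∈ Finset.range v, m u := by
  induction v with
  | zero => simp
  | succ v ih =>
    rw [Finset.sum_range_succ, ← ih, ← hm v, ← Finset.card_union_of_disjoint]
    · congr 1
      ext j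
      simp only [Finset.mem_filter, Finset.mem_univ, true_and, Finset.mem_union]
      omega
    · rw [Finset.disjoint_filter]
      intros
      omega

/-- In a weakly increasing sequence the entries below `v` occupy an initial segment, so the content
determines the sequence. -/
theorem Monotone.lt_iff_lt_card {n : ℕ} {s : Fin n → ℕ} (hs : Monotone s) (j : Fin n) (v : ℕ) :
    s j < v ↔ (j : ℕ) < (Finset.univ.filter fun j => s j < v).card := by
  constructor
  · intro h
    have : Finset.Iic j ⊆ Finset.univ.filter fun j => s j < v := by
      intro k hk
      rw [Finset.mem_filter]
      exact ⟨Finset.mem_univ _, (hs (Finset.mem_Iic.1 hk)).trans_lt h⟩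
    have := Finset.card_le_card this
    rw [Fin.card_Iic] at this
    omega
  · intro h
    by_contra hc
    have : (Finset.univ.filter fun j => s j < v) ⊆ Finset.Iio j := by
      intro k hk
      rw [Finset.mem_filter] at hk
      rw [Finset.mem_Iio]
      by_contra hjk
      exact hc ((hs (not_lt.1 hjk)).trans_lt hk.2)
    have := Finset.card_le_card this
    rw [Fin.card_Iio] at this
    omega

-- There is at most one weakly increasing sequence with a given content, so the coefficient is 0 or
-- 1. The sequence increases strictly after its `j`-th entry precisely if `j` is a partial sum of
-- the content, and this has to happen for all `j` in `D`.
open Classical in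
theorem fundamentalQSym_apply (n : ℕ) (D : Set ℕ) {m : ℕ →₀ ℕ} {N : ℕ}
    (hm : ∀ v, N ≤ v → m v = 0) :
    fundamentalQSym n D m = if ((List.range N).map m).reverse.sum = n ∧
      ∀ j, 1 ≤ j → j < n → j ∈ D → j ∈ suffixSums ((List.range N).map m).reverse
      then 1 else 0 := by
  have hsum : ((List.range N).map m).reverse.sum = ∑ u ∈ Finset.range N, m u := by
    rw [List.sum_reverse]
    clear hm
    induction N with
    | zero => rfl
    | succ N ih =>
      rw [List.range_succ, List.map_append, List.sum_append, ih, Finset.sum_range_succ]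
      simp
  set M : ℕ → ℕ := fun v => ∑ u ∈ Finset.range v, m u with hM
  have hMmono : Monotone M := fun a b h =>
    Finset.sum_le_sum_of_subset (Finset.range_subset_range.2 h)
  have hMN : ∀ v, N ≤ v → M v = M N := by
    intro v hv
    induction v, hv using Nat.le_induction with
    | base => rfl
    | succ v hv ih => rw [← ih]; simp [M, Finset.sum_range_succ, hm v hv]
  have hcontent : ∀ s : Fin n → ℕ, (∑ j, Finsupp.single (s j) 1 = m) ↔
      ∀ v, (Finset.univ.filter fun j => s j = v).card = m v := by
    intro s
    rw [Finsupp.ext_iff]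
    exact forall_congr' fun v => by rw [finsupp_sum_single_apply]
  have hlt : ∀ s : Fin n → ℕ, Monotone s → (∑ j, Finsupp.single (s j) 1 = m) →
      ∀ j v, s j < v ↔ (j : ℕ) < M v := by
    intro s hs hc j v
    rw [hs.lt_iff_lt_card, card_lt_eq_sum ((hcontent s).1 hc)]
  have hcut : ∀ s : Fin n → ℕ, (∀ j v, s j < v ↔ (j : ℕ) < M v) → ∀ (j : ℕ) (hj : j + 1 < n),
      s ⟨j, by omega⟩ < s ⟨j + 1, hj⟩ ↔ j + 1 ∈ suffixSums ((List.range N).map m).reverse := by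
    intro s hs j hj
    rw [mem_suffixSums_reverse_map]
    constructor
    · intro h
      have h1 := (hs ⟨j, by omega⟩ (s ⟨j + 1, hj⟩)).1 h
      have h2 := (hs ⟨j + 1, hj⟩ (s ⟨j + 1, hj⟩)).not.1 (lt_irrefl _)
      have h3 : M (s ⟨j + 1, hj⟩) = j + 1 := by simp only at h1 h2; omega
      -- The partial sums are constant from `N` on, so `N` replaces a larger index.
      rcases le_total (s ⟨j + 1, hj⟩) N with h4 | h4
      · exact ⟨_, h4, h3⟩
      · exact ⟨N, le_rfl, (hMN _ h4).symm.trans h3⟩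
    · rintro ⟨v, -, hv⟩
      have h1 := (hs ⟨j, by omega⟩ v).2 (by simp only [M, hv]; omega)
      have h2 := (hs ⟨j + 1, hj⟩ v).not.2 (by simp only [M, hv]; omega)
      omega
  have hsub : Subsingleton {s : Fin n → ℕ // Monotone s ∧
      (∀ (j : ℕ) (hj : j + 1 < n), j + 1 ∈ D → s ⟨j, by omega⟩ < s ⟨j + 1, hj⟩) ∧
      ∑ j, Finsupp.single (s j) 1 = m} := by
    refine ⟨fun s s' => Subtype.ext (funext fun j => ?_)⟩
    have h1 := hlt s.1 s.2.1 s.2.2.2 j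
    have h2 := hlt s'.1 s'.2.1 s'.2.2.2 j
    have h3 := (h1 (s'.1 j)).trans (h2 (s'.1 j)).symm
    have h4 := (h1 (s.1 j)).trans (h2 (s.1 j)).symm
    omega
  rw [fundamentalQSym]
  split_ifs with h
  · obtain ⟨h1, h2⟩ := h
    rw [hsum] at h1
    -- The sequence with content `m` has as entry of index `j` the least `v` for which more than `j`
    -- entries are at most `v`.
    have hex : ∀ j : Fin n, ∃ v, (j : ℕ) < M (v + 1) := fun j =>
      ⟨N, by rw [hMN _ (by omega)]; exact h1.symm ▸ j.2⟩
    have hfind : ∀ j v, Nat.find (hex j) < v ↔ (j : ℕ) < M v := by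
      intro j v
      rw [Nat.find_lt_iff]
      constructor
      · rintro ⟨u, hu, h⟩
        exact h.trans_le (hMmono hu)
      · intro h
        cases v with
        | zero => simp [M] at h
        | succ v => exact ⟨v, by omega, h⟩
    have hmono : Monotone fun j => Nat.find (hex j) := by
      intro a b hab
      have := (hfind a (Nat.find (hex b) + 1)).2
        (lt_of_le_of_lt hab ((hfind b _).1 (Nat.lt_succ_self _)))
      exact Nat.lt_succ_iff.1 this
    have : Nonempty {s : Fin n → ℕ // Monotone s ∧
        (∀ (j : ℕ) (hj : j + 1 < n), j + 1 ∈ D → s ⟨j, by omega⟩ < s ⟨j + 1, hj⟩) ∧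
        ∑ j, Finsupp.single (s j) 1 = m} := by
      refine ⟨⟨fun j => Nat.find (hex j), hmono, fun j hj hD => ?_, ?_⟩⟩
      · exact (hcut _ hfind j hj).2 (h2 _ (by omega) hj hD)
      · refine (hcontent _).2 fun v => ?_
        have h3 : (Finset.univ.filter fun j => Nat.find (hex j) = v)
            = Finset.univ.filter fun j : Fin n => M v ≤ (j : ℕ) ∧ (j : ℕ) < M (v + 1) := by
          ext j
          simp only [Finset.mem_filter, Finset.mem_univ, true_and]
          have a1 := hfind j v
          have a2 := hfind j (v + 1)
          omega
        have h4 : M (v + 1) ≤ n := by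
          rw [← h1]
          exact (hMmono (le_max_left (v + 1) N)).trans (hMN _ (le_max_right _ _)).le
        rw [h3, ← Finset.card_map Fin.valEmbedding]
        have h5 : (Finset.univ.filter fun j : Fin n =>
            M v ≤ (j : ℕ) ∧ (j : ℕ) < M (v + 1)).map Fin.valEmbedding
            = Finset.Ico (M v) (M (v + 1)) := by
          ext x
          simp only [Finset.mem_map, Finset.mem_filter, Finset.mem_univ, true_and,
            Fin.valEmbedding_apply, Finset.mem_Ico]
          exact ⟨fun ⟨j, hj, h⟩ => h ▸ hj, fun h => ⟨⟨x, by omega⟩, h, rfl⟩⟩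
        rw [h5, Nat.card_Ico]
        simp [M, Finset.sum_range_succ]
    have := (Nat.card_eq_one_iff_unique).2 ⟨hsub, this⟩
    rw [this]
    rfl
  · have : IsEmpty {s : Fin n → ℕ // Monotone s ∧
        (∀ (j : ℕ) (hj : j + 1 < n), j + 1 ∈ D → s ⟨j, by omega⟩ < s ⟨j + 1, hj⟩) ∧
        ∑ j, Finsupp.single (s j) 1 = m} := by
      refine ⟨fun s => h ⟨?_, fun j h1 hj hD => ?_⟩⟩
      · rw [hsum]
        have h1 := card_lt_eq_sum ((hcontent s.1).1 s.2.2.2) N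
        rw [← h1]
        have h2 : (Finset.univ.filter fun j => s.1 j < N) = Finset.univ := by
          rw [Finset.filter_eq_self]
          intro j _
          by_contra hc
          have h3 := hm (s.1 j) (not_lt.1 hc)
          rw [← (hcontent s.1).1 s.2.2.2, Finset.card_eq_zero, Finset.filter_eq_empty_iff] at h3
          exact h3 (Finset.mem_univ j) rfl
        rw [h2, Finset.card_univ, Fintype.card_fin]
      · obtain ⟨j, rfl⟩ : ∃ k, j = k + 1 := ⟨j - 1, by omega⟩
        exact (hcut s.1 (hlt s.1 s.2.1 s.2.2.2) j hj).1 (s.2.2.1 j hj hD)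
    rw [Nat.card_of_isEmpty]
    rfl

/-! ### Reduction to exponents that form compositions -/

theorem kostka_eq_zero {c l : List ℕ} (hl : IsShape l) (h : c.sum ≠ l.sum) : kostka c l = 0 := by
  induction c generalizing l with
  | nil =>
    rw [kostka, if_neg]
    simpa [eq_comm] using h
  | cons a c ih =>
    rw [kostka, List.sum_eq_zero]
    intro x hx
    obtain ⟨ν, hν, rfl⟩ := List.mem_map.1 hx
    obtain ⟨h1, h2⟩ := (mem_strips hl).1 hν
    refine ih h1.isShape ?_
    rw [List.sum_cons] at h
    omega

theorem strips_zero {l : List ℕ} (hl : IsShape l) : strips 0 l = [l] := by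
  induction l with
  | nil => rfl
  | cons x t ih => simp [strips, ih hl.tail]

theorem kostka_filter_pos {c l : List ℕ} (hl : IsShape l) :
    kostka (c.filter fun a => 0 < a) l = kostka c l := by
  induction c generalizing l with
  | nil => rfl
  | cons a c ih =>
    by_cases h : 0 < a
    · simp only [h, decide_true, List.filter_cons_of_pos, kostka]
      refine congrArg _ (List.map_congr_left fun ν hν => ?_)
      exact ih ((mem_strips hl).1 hν).1.isShape
    · have h0 : a = 0 := by omega
      subst h0
      simp [kostka, strips_zero hl, ih hl]

open Classical in
/-- A sum of fundamental quasisymmetric functions is a given combination of Schur functions as soon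
as the coefficients of the monomials `x_0^{a_0} ⋯ x_k^{a_k}` with all `a_i` positive agree. -/
theorem sum_fundamentalQSym_eq {ι : Type*} (S : Finset ι) (D : ι → Set ℕ) (n : ℕ)
    (L : List (ℤ × List ℕ)) (hL : ∀ p ∈ L, p.2.SortedGE ∧ p.2.sum = n)
    (h : ∀ c : List ℕ, (∀ a ∈ c, 0 < a) → c.sum = n →
      (∑ x ∈ S, if ∀ j, 1 ≤ j → j < n → j ∈ D x → j ∈ suffixSums c then (1 : ℤ) else 0) =
        (L.map fun p => p.1 * (kostka c p.2 : ℤ)).sum) :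
    ∑ x ∈ S, fundamentalQSym n (D x) =
      (L.map fun p => p.1 • schurFunction (diagram p.2)).sum := by
  funext m
  obtain ⟨N, hN⟩ : ∃ N, ∀ v, N ≤ v → m v = 0 := by
    refine ⟨m.support.sup id + 1, fun v hv => ?_⟩
    by_contra hc
    have := Finset.le_sup (f := id) (Finsupp.mem_support_iff.2 hc)
    simp only [id] at this
    omega
  have e1 : (∑ x ∈ S, fundamentalQSym n (D x)) m = ∑ x ∈ S, fundamentalQSym n (D x) m :=
    map_sum (MvPowerSeries.coeff (R := ℤ) m) _ _
  have e2 : (L.map fun p => p.1 • schurFunction (diagram p.2)).sum m =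
      (L.map fun p => p.1 * schurFunction (diagram p.2) m).sum := by
    have := map_list_sum (MvPowerSeries.coeff (R := ℤ) m)
      (L.map fun p => p.1 • schurFunction (diagram p.2))
    rw [List.map_map] at this
    refine this.trans (congrArg _ (List.map_congr_left fun p _ => ?_))
    rfl
  rw [e1, e2]
  set c := ((List.range N).map m).reverse with hc
  have e3 : (L.map fun p => p.1 * schurFunction (diagram p.2) m) =
      L.map fun p => p.1 * (kostka c p.2 : ℤ) :=
    List.map_congr_left fun p hp => by rw [schurFunction_diagram_apply (hL p hp).1 hN]
  rw [e3, Finset.sum_congr rfl fun x _ => fundamentalQSym_apply n (D x) hN, ← hc]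
  -- In degree `n`, letters with exponent 0 can be deleted without changing the set of cuts or the
  -- Kostka numbers; in other degrees both sides vanish.
  by_cases hn : c.sum = n
  · have := h (c.filter fun a => 0 < a) (fun a ha => by simpa using (List.mem_filter.1 ha).2)
      (by rw [sum_filter_pos, hn])
    simp only [suffixSums_filter_pos] at this
    have e4 : (L.map fun p => p.1 * (kostka (c.filter fun a => 0 < a) p.2 : ℤ)) =
        L.map fun p => p.1 * (kostka c p.2 : ℤ) :=
      List.map_congr_left fun p hp => by rw [kostka_filter_pos (isShape_of_sortedGE (hL p hp).1)]
    rw [e4] at this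
    simpa only [hn, true_and] using this
  · simp only [hn, false_and, if_false, Finset.sum_const_zero]
    rw [eq_comm, List.sum_eq_zero]
    intro x hx
    obtain ⟨p, hp, rfl⟩ := List.mem_map.1 hx
    rw [kostka_eq_zero (isShape_of_sortedGE (hL p hp).1) (by rw [(hL p hp).2]; exact hn)]
    simp

/-! ### Linear independence of Schur functions -/

theorem sum_range_sum_single {α : Type*} (s : Finset α) (f : α → ℕ) (k : ℕ) :
    ∑ v ∈ Finset.range k, (∑ c ∈ s, Finsupp.single (f c) 1 : ℕ →₀ ℕ) v =
      (s.filter fun c => f c < k).card := by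
  simp only [Finsupp.finsetSum_apply]
  rw [Finset.sum_comm, Finset.card_filter]
  refine Finset.sum_congr rfl fun c _ => ?_
  simp [Finsupp.single_apply]

namespace YoungDiagram

/-- The number of cells in the first `k` rows. -/
def rowsCard (μ : YoungDiagram) (k : ℕ) : ℕ := (μ.cells.filter fun c => c.1 < k).card

/-- The content of the tableau whose `i`-th row is filled with `i`. -/
noncomputable def highestContent (μ : YoungDiagram) : ℕ →₀ ℕ :=
  ∑ c ∈ μ.cells, Finsupp.single c.1 1

theorem rowsCard_succ (μ : YoungDiagram) (k : ℕ) :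
    μ.rowsCard (k + 1) = μ.rowsCard k + μ.rowLen k := by
  rw [rowsCard, rowsCard, rowLen_eq_card, row, ← Finset.card_union_of_disjoint]
  · congr 1
    ext c
    simp only [Finset.mem_filter, Finset.mem_union]
    constructor
    · rintro ⟨h1, h2⟩
      rcases Nat.lt_succ_iff_lt_or_eq.1 h2 with h | h
      · exact .inl ⟨h1, h⟩
      · exact .inr ⟨h1, h⟩
    · rintro (⟨h1, h2⟩ | ⟨h1, h2⟩)
      · exact ⟨h1, by omega⟩
      · exact ⟨h1, by omega⟩
  · rw [Finset.disjoint_left]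
    intro c h1 h2
    have := (Finset.mem_filter.1 h1).2
    have := (Finset.mem_filter.1 h2).2
    omega

theorem ext_rowLen {μ ν : YoungDiagram} (h : ∀ i, μ.rowLen i = ν.rowLen i) : μ = ν := by
  ext ⟨i, j⟩
  rw [mem_cells, mem_cells, mem_iff_lt_rowLen, mem_iff_lt_rowLen, h]

end YoungDiagram

namespace SemistandardYoungTableau

variable {μ : YoungDiagram}

theorem le_entry (T : SemistandardYoungTableau μ) {i j : ℕ} (h : (i, j) ∈ μ) : i ≤ T i j := by
  induction i with
  | zero => exact Nat.zero_le _
  | succ i ih =>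
    have h1 := ih (μ.up_left_mem (Nat.le_succ i) le_rfl h)
    exact h1.trans_lt (T.col_strict (Nat.lt_succ_self i) h)

theorem filter_entry_subset (T : SemistandardYoungTableau μ) (k : ℕ) :
    (μ.cells.filter fun c => T c.1 c.2 < k) ⊆ μ.cells.filter fun c => c.1 < k := by
  intro c hc
  rw [Finset.mem_filter] at hc ⊢
  exact ⟨hc.1, (T.le_entry hc.1).trans_lt hc.2⟩

/-- Entries smaller than `k` lie in the first `k` rows because columns are strict. This is the
statement that a nonzero Kostka number implies dominance. -/
theorem rowsCard_le_of_content {ν : YoungDiagram} (T : SemistandardYoungTableau μ)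
    (h : ∑ c ∈ μ.cells, Finsupp.single (T c.1 c.2) 1 = ν.highestContent) (k : ℕ) :
    ν.rowsCard k ≤ μ.rowsCard k := by
  have h1 := sum_range_sum_single μ.cells (fun c => T c.1 c.2) k
  rw [h, YoungDiagram.highestContent, sum_range_sum_single] at h1
  rw [YoungDiagram.rowsCard, h1]
  exact Finset.card_le_card (T.filter_entry_subset k)

/-- In the extreme case the entries smaller than `k` fill the first `k` rows completely, for every
`k`, so row `i` consists of entries `i`. -/
theorem eq_highestWeight_of_content (T : SemistandardYoungTableau μ)
    (h : ∑ c ∈ μ.cells, Finsupp.single (T c.1 c.2) 1 = μ.highestContent) :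
    T = highestWeight μ := by
  ext i j
  rw [highestWeight_apply]
  split_ifs with hc
  · have h1 := sum_range_sum_single μ.cells (fun c => T c.1 c.2) (i + 1)
    rw [h, YoungDiagram.highestContent, sum_range_sum_single] at h1
    have h2 := Finset.eq_of_subset_of_card_le (T.filter_entry_subset (i + 1)) h1.le
    have h3 : (i, j) ∈ μ.cells.filter fun c => c.1 < i + 1 :=
      Finset.mem_filter.2 ⟨hc, Nat.lt_succ_self i⟩
    rw [← h2, Finset.mem_filter] at h3
    exact Nat.le_antisymm (Nat.lt_succ_iff.1 h3.2) (T.le_entry hc)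
  · exact T.zeros hc

end SemistandardYoungTableau

theorem schurFunction_highestContent (μ : YoungDiagram) :
    schurFunction μ μ.highestContent = 1 := by
  rw [schurFunction, Nat.cast_eq_one, Nat.card_eq_one_iff_unique]
  refine ⟨⟨fun T T' => Subtype.ext ?_⟩, ⟨⟨SemistandardYoungTableau.highestWeight μ, ?_⟩⟩⟩
  · rw [T.1.eq_highestWeight_of_content T.2, T'.1.eq_highestWeight_of_content T'.2]
  · refine Finset.sum_congr rfl fun c hc => ?_
    rw [SemistandardYoungTableau.highestWeight_apply, if_pos (by simpa using hc)]

theorem rowsCard_le_of_schurFunction_ne_zero {μ ν : YoungDiagram}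
    (h : schurFunction μ ν.highestContent ≠ 0) (k : ℕ) : ν.rowsCard k ≤ μ.rowsCard k := by
  rw [schurFunction, Nat.cast_ne_zero] at h
  obtain ⟨T⟩ := (Nat.card_ne_zero.1 h).1
  exact T.1.rowsCard_le_of_content T.2 k

/-- The matrix of Kostka numbers is unitriangular for dominance: at the content of a maximal shape
in the support only that shape contributes, with Kostka number 1. -/
theorem eq_zero_of_sum_schurFunction_eq_zero (c : YoungDiagram →₀ ℤ)
    (h : (c.sum fun μ a => a • schurFunction μ) = 0) : c = 0 := by
  by_contra hc
  obtain ⟨B, hB⟩ : ∃ B, ∀ μ ∈ c.support, ∀ i, B ≤ i → μ.rowLen i = 0 := by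
    refine ⟨c.support.sup fun μ => μ.colLen 0, fun μ hμ i hi => ?_⟩
    by_contra h0
    have h1 : (i, 0) ∈ μ := YoungDiagram.mem_iff_lt_rowLen.2 (by omega)
    have h2 := YoungDiagram.mem_iff_lt_colLen.1 h1
    have h3 := Finset.le_sup (f := fun μ : YoungDiagram => μ.colLen 0) hμ
    omega
  -- The sum of the numbers of cells in the first `k` rows is a linear extension of dominance: if
  -- `ν` dominates `μ` and has no larger sum, all these numbers agree and so do the rows. The bound
  -- `B` on the numbers of rows makes finitely many `k` sufficient.
  obtain ⟨μ, hμ, hmax⟩ := Finset.exists_max_image c.support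
    (fun μ => ∑ k ∈ Finset.range (B + 1), μ.rowsCard k) (Finsupp.support_nonempty_iff.2 hc)
  have h1 : ∑ ν ∈ c.support, c ν * schurFunction ν μ.highestContent = 0 := by
    have h2 := map_sum (MvPowerSeries.coeff (R := ℤ) μ.highestContent)
      (fun ν => c ν • schurFunction ν) c.support
    have h3 : (∑ ν ∈ c.support, c ν • schurFunction ν) = 0 := h
    rw [h3, map_zero] at h2
    exact h2.symm
  rw [Finset.sum_eq_single_of_mem μ hμ, schurFunction_highestContent, mul_one] at h1
  · exact Finsupp.mem_support_iff.1 hμ h1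
  · intro ν hν hne
    by_contra h0
    have h2 := rowsCard_le_of_schurFunction_ne_zero (right_ne_zero_of_mul h0)
    have h3 := (Finset.sum_eq_sum_iff_of_le fun k _ => h2 k).1
      (le_antisymm (Finset.sum_le_sum fun k _ => h2 k) (hmax ν hν))
    refine hne (YoungDiagram.ext_rowLen fun i => ?_)
    by_cases hi : i < B
    · have h4 := h3 i (Finset.mem_range.2 (by omega))
      have h5 := h3 (i + 1) (Finset.mem_range.2 (by omega))
      rw [YoungDiagram.rowsCard_succ, YoungDiagram.rowsCard_succ] at h5
      omega
    · rw [hB ν hν i (by omega), hB μ hμ i (by omega)]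

theorem HasSchurExpansion.unique {f : MvPowerSeries ℕ ℤ} {c c' : YoungDiagram →₀ ℤ}
    (h : HasSchurExpansion f c) (h' : HasSchurExpansion f c') : c = c' := by
  rw [← sub_eq_zero]
  refine eq_zero_of_sum_schurFunction_eq_zero _ ?_
  rw [Finsupp.sum_sub_index fun μ a b => sub_smul a b _, ← h, ← h', sub_self]

theorem hasSchurExpansion_list_sum (L : List (ℤ × List ℕ)) :
    HasSchurExpansion (L.map fun p => p.1 • schurFunction (diagram p.2)).sum
      (L.map fun p => Finsupp.single (diagram p.2) p.1).sum := by
  unfold HasSchurExpansion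
  induction L with
  | nil => simp
  | cons p L ih =>
    rw [List.map_cons, List.sum_cons, List.map_cons, List.sum_cons,
      Finsupp.sum_add_index' (h := fun μ (a : ℤ) => a • schurFunction μ)
        (fun μ => zero_smul _ _) (fun μ a b => add_smul a b _), ← ih,
      Finsupp.sum_single_index (h := fun μ (a : ℤ) => a • schurFunction μ) (zero_smul _ _)]

theorem schurPositive_list_sum {L : List (ℤ × List ℕ)} (hL : ∀ p ∈ L, 0 ≤ p.1) :
    SchurPositive (L.map fun p => p.1 • schurFunction (diagram p.2)).sum := by
  refine ⟨_, hasSchurExpansion_list_sum L, fun μ => ?_⟩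
  induction L with
  | nil => simp
  | cons p L ih =>
    rw [List.map_cons, List.sum_cons, Finsupp.add_apply]
    refine add_nonneg ?_ (ih fun q hq => hL q (List.mem_cons_of_mem _ hq))
    classical
    rw [Finsupp.single_apply]
    split_ifs
    · exact hL p List.mem_cons_self
    · exact le_rfl

theorem rowLen_diagram {l : List ℕ} (h : l.SortedGE) (i : ℕ) : (diagram l).rowLen i = part l i := by
  refine Nat.le_antisymm ?_ ?_ <;> by_contra! hc
  · exact absurd ((mem_diagram h).1 (YoungDiagram.mem_iff_lt_rowLen.2 hc)) (lt_irrefl _)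
  · exact absurd (YoungDiagram.mem_iff_lt_rowLen.1 ((mem_diagram h).2 hc)) (lt_irrefl _)

theorem diagram_injOn {l l' : List ℕ} (h : l.SortedGE) (h' : l'.SortedGE)
    (hp : ∀ a ∈ l, 0 < a) (hp' : ∀ a ∈ l', 0 < a) (he : diagram l = diagram l') : l = l' := by
  have h1 : ∀ i, part l i = part l' i := fun i => by
    rw [← rowLen_diagram h, ← rowLen_diagram h', he]
  have h2 : ∀ {l : List ℕ}, (∀ a ∈ l, 0 < a) → ∀ i, i < l.length ↔ 0 < part l i := by
    intro l hl i
    by_cases hi : i < l.length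
    · rw [part, List.getD_eq_getElem _ _ hi]
      exact iff_of_true hi (hl _ (List.getElem_mem hi))
    · rw [part_of_length_le (by omega)]
      omega
  have h3 : l.length = l'.length := by
    refine Nat.le_antisymm ?_ ?_ <;> by_contra! hc
    · exact absurd ((h2 hp' _).2 (h1 _ ▸ (h2 hp _).1 hc)) (lt_irrefl _)
    · exact absurd ((h2 hp _).2 ((h1 _).symm ▸ (h2 hp' _).1 hc)) (lt_irrefl _)
  refine List.ext_getElem h3 fun i hi hi' => ?_
  have := h1 i
  rwa [part, part, List.getD_eq_getElem _ _ hi, List.getD_eq_getElem _ _ hi'] at this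

/-- Uniqueness of the expansion reduces this to reading off the list. Parts are required to be
positive since trailing zeros would give different lists for the same diagram. -/
theorem hasSchurCoeff_list_sum {L : List (ℤ × List ℕ)} (hL : ∀ p ∈ L, p.2.SortedGE)
    (hp : ∀ p ∈ L, ∀ a ∈ p.2, 0 < a) {l : List ℕ} (hl : l.SortedGE) (hl' : ∀ a ∈ l, 0 < a) :
    HasSchurCoeff (L.map fun p => p.1 • schurFunction (diagram p.2)).sum (diagram l)
      ((L.filter fun p => p.2 = l).map Prod.fst).sum := by
  refine ⟨⟨_, hasSchurExpansion_list_sum L⟩, fun c hc => ?_⟩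
  rw [hc.unique (hasSchurExpansion_list_sum L)]
  clear hc c
  induction L with
  | nil => simp
  | cons p L ih =>
    rw [List.map_cons, List.sum_cons, Finsupp.add_apply,
      ih (fun q hq => hL q (List.mem_cons_of_mem _ hq))
        (fun q hq => hp q (List.mem_cons_of_mem _ hq))]
    by_cases h : p.2 = l
    · simp [h]
    · have : diagram p.2 ≠ diagram l := fun he =>
        h (diagram_injOn (hL p List.mem_cons_self) hl (hp p List.mem_cons_self) hl' he)
      simp [h, Finsupp.single_eq_of_ne, this.symm]

theorem HasSchurCoeff.not_schurPositive {f : MvPowerSeries ℕ ℤ} {μ : YoungDiagram} {a : ℤ}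
    (h : HasSchurCoeff f μ a) (ha : a < 0) : ¬ SchurPositive f := by
  rintro ⟨c, hc, hpos⟩
  have := hpos μ
  rw [h.2 c hc] at this
  omega

/-! ### A certified Schur expansion of a sum of fundamental quasisymmetric functions -/

/-- Add `q` times the shape `l` to a formal combination of shapes. -/
def addTerm (q : ℤ) (l : List ℕ) : List (ℤ × List ℕ) → List (ℤ × List ℕ)
  | [] => [(q, l)]
  | p :: L => if p.2 = l then (p.1 + q, l) :: L else p :: addTerm q l L

/-- Remove horizontal strips of size `a` from a formal combination of shapes. -/
def peel (a : ℕ) : List (ℤ × List ℕ) → List (ℤ × List ℕ)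
  | [] => []
  | p :: L => (strips a p.2).foldr (addTerm p.1) (peel a L)

theorem sum_addTerm (g : List ℕ → ℤ) (q : ℤ) (l : List ℕ) (L : List (ℤ × List ℕ)) :
    ((addTerm q l L).map fun p => p.1 * g p.2).sum =
      q * g l + (L.map fun p => p.1 * g p.2).sum := by
  induction L with
  | nil => simp [addTerm]
  | cons p L ih =>
    rw [addTerm]
    split_ifs with h
    · subst h
      simp only [List.map_cons, List.sum_cons]
      ring
    · simp only [List.map_cons, List.sum_cons, ih]
      ring

theorem sum_foldr_addTerm (g : List ℕ → ℤ) (q : ℤ) (M : List (List ℕ)) (L : List (ℤ × List ℕ)) :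
    ((M.foldr (addTerm q) L).map fun p => p.1 * g p.2).sum =
      q * (M.map g).sum + (L.map fun p => p.1 * g p.2).sum := by
  induction M with
  | nil => simp
  | cons l M ih =>
    rw [List.foldr_cons, sum_addTerm, ih, List.map_cons, List.sum_cons]
    ring

/-- The recursion of `kostka` on the first letter is linear in the shape, so it can be applied to a
whole combination at once; merging equal shapes keeps the combination short. -/
theorem sum_peel (a : ℕ) (c : List ℕ) (L : List (ℤ × List ℕ)) :
    ((peel a L).map fun p => p.1 * (kostka c p.2 : ℤ)).sum =
      (L.map fun p => p.1 * (kostka (a :: c) p.2 : ℤ)).sum := by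
  induction L with
  | nil => rfl
  | cons p L ih =>
    rw [peel, sum_foldr_addTerm (fun l => (kostka c l : ℤ)), ih, List.map_cons, List.sum_cons,
      kostka]
    congr 2
    induction strips a p.2 with
    | nil => rfl
    | cons l M ih => simp [ih]

/-- The sum of the digits `d < m` of `K` in base `X` with `2 * d` a submask of `T`. -/
def submaskSum (X K T : ℕ) : ℕ → ℕ
  | 0 => 0
  | d + 1 => bif Nat.beq (Nat.land (2 * d) T) (2 * d)
      then submaskSum X K T d + K / X ^ d % X else submaskSum X K T d

/-- Compare a formal combination `L` of shapes of size `r` with the digits of `K` in base `X`, read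
as multiplicities of descent sets, on all compositions of `r`. -/
def expansionCheck (X K m : ℕ) : ℕ → ℕ → ℕ → List (ℤ × List ℕ) → Bool
  | _, 0, T, L => (submaskSum X K T m : ℤ) == (L.map fun p => p.1 * (kostka [] p.2 : ℤ)).sum
  | 0, _ + 1, _, _ => false
  | fuel + 1, r + 1, T, L => (List.range (r + 1)).all fun s =>
      expansionCheck X K m fuel s (Nat.lor T (2 ^ s)) (peel (r + 1 - s) L)

/-- With fewer than `X` summands no carries occur in base `X`, so the digits of the sum are the
multiplicities of the values of `f`. -/
theorem sum_pow_div_mod {ι : Type*} (S : Finset ι) (f : ι → ℕ) {X : ℕ} (hS : S.card < X) (d : ℕ) :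
    (∑ x ∈ S, X ^ f x) / X ^ d % X = (S.filter fun x => f x = d).card := by
  have hX : 0 < X := by omega
  obtain ⟨B, hB⟩ : X ^ (d + 1) ∣ ∑ x ∈ S.filter fun x => d < f x, X ^ f x :=
    Finset.dvd_sum fun x hx => pow_dvd_pow _ (Finset.mem_filter.1 hx).2
  have hA : ∑ x ∈ S.filter fun x => f x < d, X ^ f x < X ^ d := by
    cases d with
    | zero => simp
    | succ d =>
      calc ∑ x ∈ S.filter fun x => f x < d + 1, X ^ f x
          ≤ ∑ x ∈ S.filter fun x => f x < d + 1, X ^ d := Finset.sum_le_sum fun x hx =>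
            Nat.pow_le_pow_right hX (Nat.lt_succ_iff.1 (Finset.mem_filter.1 hx).2)
        _ = (S.filter fun x => f x < d + 1).card * X ^ d := by rw [Finset.sum_const, smul_eq_mul]
        _ < X * X ^ d := Nat.mul_lt_mul_of_pos_right
            ((Finset.card_filter_le _ _).trans_lt hS) (by positivity)
        _ = X ^ (d + 1) := (pow_succ' _ _).symm
  have hC : ∑ x ∈ S.filter fun x => f x = d, X ^ f x =
      (S.filter fun x => f x = d).card * X ^ d := by
    rw [Finset.sum_congr rfl fun x hx => by rw [(Finset.mem_filter.1 hx).2], Finset.sum_const,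
      smul_eq_mul]
  have hsplit : ∑ x ∈ S, X ^ f x = (∑ x ∈ S.filter fun x => f x < d, X ^ f x) +
      X ^ d * ((S.filter fun x => f x = d).card + X * B) := by
    rw [← Finset.sum_filter_add_sum_filter_not S (fun x => f x < d),
      ← Finset.sum_filter_add_sum_filter_not (S.filter fun x => ¬ f x < d) (fun x => f x = d),
      Finset.filter_filter, Finset.filter_filter]
    have e1 : (S.filter fun x => ¬ f x < d ∧ f x = d) = S.filter fun x => f x = d :=
      Finset.filter_congr fun x _ => by omega
    have e2 : (S.filter fun x => ¬ f x < d ∧ ¬ f x = d) = S.filter fun x => d < f x :=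
      Finset.filter_congr fun x _ => by omega
    rw [e1, e2, hC, hB]
    ring
  rw [hsplit, Nat.add_mul_div_left _ _ (by positivity), Nat.div_eq_of_lt hA, zero_add,
    Nat.add_mul_mod_self_left, Nat.mod_eq_of_lt ((Finset.card_filter_le _ _).trans_lt hS)]

theorem land_eq_left_iff (a b : ℕ) : a &&& b = a ↔ ∀ j, a.testBit j → b.testBit j := by
  constructor
  · intro h j hj
    rw [← h, Nat.testBit_and, Bool.and_eq_true] at hj
    exact hj.2
  · intro h
    refine Nat.eq_of_testBit_eq fun j => ?_
    rw [Nat.testBit_and]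
    cases ha : a.testBit j
    · rfl
    · rw [h j ha]; rfl

-- The doubling accounts for a shift of indices: bit `p` of a descent mask stands for the descent `p
-- + 1`, whereas bit `j` of `T` stands for a cut at position `j`.
open Classical in
theorem submaskSum_eq {ι : Type*} (S : Finset ι) (f : ι → ℕ) {X : ℕ} (hS : S.card < X) (T m : ℕ) :
    submaskSum X (∑ x ∈ S, X ^ f x) T m =
      (S.filter fun x => f x < m ∧ ∀ j, (2 * f x).testBit j → T.testBit j).card := by
  induction m with
  | zero => simp [submaskSum]
  | succ d ih =>
    rw [submaskSum, sum_pow_div_mod S f hS, ih]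
    by_cases h : 2 * d &&& T = 2 * d
    · have hb : Nat.beq (Nat.land (2 * d) T) (2 * d) = true := by rw [Nat.beq_eq]; exact h
      rw [hb, cond_true, ← Finset.card_union_of_disjoint]
      · congr 1
        ext x
        rw [land_eq_left_iff] at h
        simp only [Finset.mem_union, Finset.mem_filter, Nat.lt_succ_iff_lt_or_eq]
        constructor
        · rintro (⟨h1, h2, h3⟩ | ⟨h1, rfl⟩)
          exacts [⟨h1, .inl h2, h3⟩, ⟨h1, .inr rfl, h⟩]
        · rintro ⟨h1, h2 | h2, h3⟩
          exacts [.inl ⟨h1, h2, h3⟩, .inr ⟨h1, h2⟩]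
      · rw [Finset.disjoint_left]
        intro x h1 h2
        have h1 := (Finset.mem_filter.1 h1).2.1
        have h2 := (Finset.mem_filter.1 h2).2
        omega
    · have hb : Nat.beq (Nat.land (2 * d) T) (2 * d) = false :=
        Bool.eq_false_iff.2 fun hc => h (Nat.eq_of_beq_eq_true hc)
      rw [hb, cond_false]
      congr 1
      refine Finset.filter_congr fun x _ => ?_
      rw [land_eq_left_iff] at h
      constructor
      · rintro ⟨h1, h2⟩
        exact ⟨by omega, h2⟩
      · rintro ⟨h1, h2⟩
        refine ⟨lt_of_le_of_ne (by omega) ?_, h2⟩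
        rintro rfl
        exact h h2

theorem sum_mem_suffixSums (c : List ℕ) : c.sum ∈ suffixSums c := by
  cases c <;> simp [suffixSums]

-- Invariant of the search: `T` records the cuts chosen so far, including `r`, and `c` is the still
-- unread part of the composition. Reading the entry `a` adds the cut `c.sum` to `T` and strips the
-- letter off the shapes.
open Classical in
theorem expansionCheck_spec {ι : Type*} {S : Finset ι} {f : ι → ℕ} {X m : ℕ} (hS : S.card < X)
    (hf : ∀ x ∈ S, f x < m) {fuel r T : ℕ} {L : List (ℤ × List ℕ)} (hT : T.testBit r)
    (h : expansionCheck X (∑ x ∈ S, X ^ f x) m fuel r T L = true) (c : List ℕ)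
    (hc : ∀ a ∈ c, 0 < a) (hr : c.sum = r) :
    ((S.filter fun x => ∀ j, (2 * f x).testBit j → T.testBit j ∨ j ∈ suffixSums c).card : ℤ) =
      (L.map fun p => p.1 * (kostka c p.2 : ℤ)).sum := by
  induction c generalizing fuel r T L with
  | nil =>
    subst hr
    rw [List.sum_nil, expansionCheck, beq_iff_eq, submaskSum_eq S f hS] at h
    rw [← h]
    congr 2
    refine Finset.filter_congr fun x hx => ?_
    simp only [suffixSums, List.mem_singleton]
    constructor
    · intro h1
      -- Position 0 is a suffix sum of every composition, but the doubled mask never has bit 0.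
      refine ⟨hf x hx, fun j hj => (h1 j hj).resolve_right ?_⟩
      rintro rfl
      simp at hj
    · exact fun h1 j hj => .inl (h1.2 j hj)
  | cons a c ih =>
    have ha := hc a List.mem_cons_self
    rw [List.sum_cons] at hr
    obtain ⟨r, rfl⟩ : ∃ r', r = r' + 1 := ⟨r - 1, by omega⟩
    cases fuel with
    | zero => simp [expansionCheck] at h
    | succ fuel =>
      rw [expansionCheck, List.all_eq_true] at h
      have h1 := h c.sum (List.mem_range.2 (by omega))
      rw [show r + 1 - c.sum = a by omega] at h1
      have hlor : ∀ j, (Nat.lor T (2 ^ c.sum)).testBit j = (T.testBit j || decide (c.sum = j)) := by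
        intro j
        rw [← Nat.testBit_two_pow]
        exact Nat.testBit_or _ _ _
      have h2 := ih (by rw [hlor]; simp) h1 (fun b hb => hc b (List.mem_cons_of_mem _ hb)) rfl
      rw [← sum_peel, ← h2]
      congr 2
      refine Finset.filter_congr fun x _ => forall₂_congr fun j _ => ?_
      rw [hlor, suffixSums, List.mem_cons, hr]
      have := sum_mem_suffixSums c
      simp only [Bool.or_eq_true, decide_eq_true_eq]
      constructor
      · rintro (h3 | rfl | h3)
        exacts [.inl (.inl h3), .inl (.inl hT), .inr h3]
      · rintro ((h3 | rfl) | h3)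
        exacts [.inl h3, .inr (.inr this), .inr (.inr h3)]

-- The search starts with the cut `n`, which is the full sum of every composition of `n`; descents
-- are smaller than `n`, so this extra cut is harmless.
open Classical in
theorem sum_fundamentalQSym_eq_of_check {ι : Type*} {S : Finset ι} {D : ι → Set ℕ} {f : ι → ℕ}
    {n m X K : ℕ} {L : List (ℤ × List ℕ)} (hS : S.card < X) (hf : ∀ x ∈ S, f x < m)
    (hD : ∀ x ∈ S, ∀ j, (f x).testBit j ↔ j + 1 < n ∧ j + 1 ∈ D x)
    (hK : ∑ x ∈ S, X ^ f x = K) (hL : ∀ p ∈ L, p.2.SortedGE ∧ p.2.sum = n)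
    (h : expansionCheck X K m n n (2 ^ n) L = true) :
    ∑ x ∈ S, fundamentalQSym n (D x) =
      (L.map fun p => p.1 • schurFunction (diagram p.2)).sum := by
  subst hK
  refine sum_fundamentalQSym_eq S D n L hL fun c hc hn => ?_
  rw [← expansionCheck_spec hS hf (by simp) h c hc hn, Finset.card_filter, Nat.cast_sum]
  refine Finset.sum_congr rfl fun x hx => ?_
  rw [Nat.cast_ite, Nat.cast_one, Nat.cast_zero]
  have hn' := sum_mem_suffixSums c
  rw [hn] at hn'
  have key : (∀ j, 1 ≤ j → j < n → j ∈ D x → j ∈ suffixSums c) ↔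
      ∀ j, (2 * f x).testBit j → (2 ^ n).testBit j ∨ j ∈ suffixSums c := by
    constructor
    · intro h1 j hj
      cases j with
      | zero => simp at hj
      | succ j =>
        rw [Nat.testBit_succ, Nat.mul_div_cancel_left _ (by norm_num), hD x hx] at hj
        exact .inr (h1 _ (by omega) hj.1 hj.2)
    · intro h1 j hj1 hj2 hj
      obtain ⟨j, rfl⟩ : ∃ i, j = i + 1 := ⟨j - 1, by omega⟩
      refine (h1 (j + 1) ?_).resolve_left ?_
      · rw [Nat.testBit_succ, Nat.mul_div_cancel_left _ (by norm_num), hD x hx]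
        exact ⟨hj2, hj⟩
      · rw [Nat.testBit_two_pow]
        simp only [decide_eq_true_eq]
        omega
  split_ifs with h1 h2 h2
  · rfl
  · exact absurd (key.1 h1) h2
  · exact absurd (key.2 h2) h1
  · rfl

/-! ### Moves on words -/

/-- There is a descent between the letters of indices `p` and `p + 1`. -/
def desc : List ℕ → ℕ → Bool
  | x :: y :: _, 0 => Nat.blt y x
  | _ :: t, p + 1 => desc t p
  | _, _ => false

/-- The letters of indices `k`, `k + 1`, `k + 2` do not form a monotone sequence. -/
def adm : ℕ → List ℕ → Bool
  | 0, x :: y :: z :: _ => Nat.blt y x != Nat.blt z y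
  | k + 1, _ :: t => adm k t
  | _, _ => false

/-- Replace the letters of indices `k`, `k + 1`, `k + 2` by their Knuth neighbor if `r` is false, and
by their rotation neighbor if `r` is true. -/
def move (r : Bool) : ℕ → List ℕ → List ℕ
  | 0, x :: y :: z :: t =>
      bif Nat.blt x z == Nat.blt y x then bif r then y :: z :: x :: t else x :: z :: y :: t
      else bif r then z :: x :: y :: t else y :: x :: z :: t
  | k + 1, x :: t => x :: move r k t
  | _, l => l

/-- The descents of a word as a binary number. -/
def desMask : List ℕ → ℕ
  | x :: y :: t => bif Nat.blt y x then 2 * desMask (y :: t) + 1 else 2 * desMask (y :: t)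
  | _ => 0

theorem blt_eq_decide (a b : ℕ) : Nat.blt a b = decide (a < b) := by
  rw [Bool.eq_iff_iff, decide_eq_true_eq]
  exact Iff.of_eq Nat.blt_eq

@[simp] theorem desc_cons_succ (x : ℕ) (t : List ℕ) (p : ℕ) : desc (x :: t) (p + 1) = desc t p := by
  cases t <;> rfl

@[simp] theorem desc_cons_cons_zero (x y : ℕ) (t : List ℕ) :
    desc (x :: y :: t) 0 = decide (y < x) := by
  rw [← blt_eq_decide]; rfl

@[simp] theorem desc_nil (p : ℕ) : desc [] p = false := by cases p <;> rfl

@[simp] theorem desc_singleton (x p : ℕ) : desc [x] p = false := by cases p <;> simp [desc]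

@[simp] theorem adm_cons_succ (x : ℕ) (t : List ℕ) (k : ℕ) : adm (k + 1) (x :: t) = adm k t := rfl

@[simp] theorem adm_zero_cons (x y z : ℕ) (t : List ℕ) :
    adm 0 (x :: y :: z :: t) = (decide (y < x) != decide (z < y)) := by
  simp only [← blt_eq_decide]; rfl

@[simp] theorem move_cons_succ (r : Bool) (x : ℕ) (t : List ℕ) (k : ℕ) :
    move r (k + 1) (x :: t) = x :: move r k t := rfl

/-- On a non-monotone triple, the condition `x < z ↔ y < x` says that the first letter is the middle
one in size. A Knuth move then exchanges the other two letters; in the remaining case the last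
letter is the middle one and the first two are exchanged. The rotation directions are determined in
the same way. -/
theorem move_zero_cons (r : Bool) (x y z : ℕ) (t : List ℕ) :
    move r 0 (x :: y :: z :: t) =
      if (x < z ↔ y < x) then if r then y :: z :: x :: t else x :: z :: y :: t
      else if r then z :: x :: y :: t else y :: x :: z :: t := by
  simp only [move, blt_eq_decide, Bool.cond_eq_ite, beq_iff_eq, decide_eq_decide]

@[simp] theorem adm_nil (k : ℕ) : adm k [] = false := by cases k <;> rfl

/-- Induction over the position of a move. -/
theorem adm_induction {P : ℕ → List ℕ → Prop}
    (zero : ∀ x y z t, (decide (y < x) != decide (z < y)) = true → P 0 (x :: y :: z :: t))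
    (succ : ∀ k x t, adm k t = true → P k t → P (k + 1) (x :: t)) {k : ℕ} {w : List ℕ}
    (h : adm k w = true) : P k w := by
  induction k generalizing w with
  | zero =>
    match w, h with
    | x :: y :: z :: t, h => exact zero x y z t (by simpa using h)
  | succ k ih =>
    match w, h with
    | x :: t, h => exact succ k x t h (ih h)

theorem move_perm (r : Bool) (k : ℕ) (w : List ℕ) : (move r k w).Perm w := by
  induction k generalizing w with
  | zero =>
    match w with
    | [] | [_] | [_, _] => rfl
    | x :: y :: z :: t =>
      rw [move_zero_cons]
      have h1 : (y :: z :: x :: t).Perm (x :: y :: z :: t) :=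
        List.perm_middle (l₁ := [y, z]) (l₂ := t)
      have h2 : (z :: x :: y :: t).Perm (x :: y :: z :: t) :=
        (List.perm_middle (l₁ := [x, y]) (l₂ := t)).symm
      split_ifs
      exacts [h1, (List.Perm.swap _ _ _).cons _, h2, List.Perm.swap _ _ _]
  | succ k ih =>
    match w with
    | [] => rfl
    | x :: t => exact (ih t).cons x

theorem adm_move {k : ℕ} {w : List ℕ} (h : adm k w = true) (hw : w.Nodup) (r : Bool) :
    adm k (move r k w) = true := by
  refine adm_induction (P := fun k w => w.Nodup → adm k (move r k w) = true) ?_ ?_ h hw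
  · intro x y z t h hw
    rw [move_zero_cons]
    simp only [List.nodup_cons, List.mem_cons, not_or] at hw
    split_ifs <;> simp at h ⊢ <;> omega
  · intro k x t _ ih hw
    exact ih (List.nodup_cons.1 hw).2

theorem move_move {k : ℕ} {w : List ℕ} (h : adm k w = true) (hw : w.Nodup) (r : Bool) :
    move r k (move r k w) = w := by
  refine adm_induction (P := fun k w => w.Nodup → move r k (move r k w) = w) ?_ ?_ h hw
  · intro x y z t h hw
    rw [move_zero_cons]
    simp only [List.nodup_cons, List.mem_cons, not_or] at hw
    simp at h
    split_ifs <;> rw [move_zero_cons] <;> split_ifs <;> first | rfl | omega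
  · intro k x t _ ih hw
    rw [move_cons_succ, move_cons_succ, ih (List.nodup_cons.1 hw).2]

theorem desc_move {k : ℕ} {w : List ℕ} (h : adm k w = true) (hw : w.Nodup) (r : Bool) :
    desc (move r k w) k = !desc w k ∧ desc (move r k w) (k + 1) = !desc w (k + 1) := by
  refine adm_induction (P := fun k w => w.Nodup → desc (move r k w) k = !desc w k ∧
    desc (move r k w) (k + 1) = !desc w (k + 1)) ?_ ?_ h hw
  · intro x y z t h hw
    rw [move_zero_cons]
    simp only [List.nodup_cons, List.mem_cons, not_or] at hw
    simp at h
    split_ifs <;> simp <;> grind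
  · intro k x t _ ih hw
    simpa using ih (List.nodup_cons.1 hw).2

theorem adm_iff {k : ℕ} {w : List ℕ} (hk : k + 2 < w.length) :
    adm k w = true ↔ desc w k ≠ desc w (k + 1) := by
  induction k generalizing w with
  | zero =>
    match w, hk with
    | x :: y :: z :: t, _ => simp
  | succ k ih =>
    match w, hk with
    | x :: t, hk => simpa using ih (w := t) (by simp at hk; omega)

theorem lt_length_of_adm {k : ℕ} {w : List ℕ} (h : adm k w = true) : k + 2 < w.length :=
  adm_induction (P := fun k w => k + 2 < w.length) (by simp) (fun k x t _ ih => by simp; omega) h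

theorem desc_move_of_lt {r : Bool} {k p : ℕ} (w : List ℕ) (h : p + 1 < k) :
    desc (move r k w) p = desc w p := by
  induction k generalizing w p with
  | zero => omega
  | succ k ih =>
    match w with
    | [] => rfl
    | x :: t =>
      cases p with
      | succ p => simpa using ih t (by omega)
      | zero =>
        obtain ⟨k, rfl⟩ : ∃ k', k = k' + 1 := ⟨k - 1, by omega⟩
        match t with
        | [] => rfl
        | y :: t => simp

theorem desc_move_of_gt {r : Bool} {k p : ℕ} (w : List ℕ) (h : k + 2 < p) :
    desc (move r k w) p = desc w p := by
  induction k generalizing w p with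
  | zero =>
    match w with
    | [] | [_] | [_, _] => rfl
    | x :: y :: z :: t =>
      obtain ⟨p, rfl⟩ : ∃ p', p = p' + 3 := ⟨p - 3, by omega⟩
      rw [move_zero_cons]
      split_ifs <;> simp
  | succ k ih =>
    match w with
    | [] => rfl
    | x :: t =>
      obtain ⟨p, rfl⟩ : ∃ p', p = p' + 1 := ⟨p - 1, by omega⟩
      simpa using ih t (by omega)

/-- If the window ends with a descent, the move can only raise its last letter, and it can only
lower it otherwise. The comparison with the next letter changes only if that letter lies between the
old and the new last letter, hence on the side opposite to the last step of the window. -/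
theorem desc_move_right {k : ℕ} {w : List ℕ} (h : adm k w = true) (hw : w.Nodup) {r : Bool}
    (hd : desc (move r k w) (k + 2) ≠ desc w (k + 2)) : desc w (k + 2) ≠ desc w (k + 1) := by
  refine adm_induction (P := fun k w => w.Nodup → desc (move r k w) (k + 2) ≠ desc w (k + 2) →
    desc w (k + 2) ≠ desc w (k + 1)) ?_ ?_ h hw hd
  · intro x y z t h hw
    rw [move_zero_cons]
    simp only [List.nodup_cons, List.mem_cons, not_or] at hw
    match t with
    | [] => split_ifs <;> simp
    | u :: t =>
      simp at h hw
      split_ifs <;> simp <;> omega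
  · intro k x t _ ih hw
    simpa using ih (List.nodup_cons.1 hw).2

theorem desc_move_left {k : ℕ} {w : List ℕ} (h : adm (k + 1) w = true) (hw : w.Nodup) {r : Bool}
    (hd : desc (move r (k + 1) w) k ≠ desc w k) : desc w k ≠ desc w (k + 1) := by
  induction k generalizing w with
  | zero =>
    match w, h with
    | u :: x :: y :: z :: t, h =>
      rw [move_cons_succ, move_zero_cons] at hd
      simp only [List.nodup_cons, List.mem_cons, not_or] at hw
      simp at h
      revert hd
      split_ifs <;> simp <;> omega
  | succ k ih =>
    match w, h with
    | x :: t, h => simpa using ih h (List.nodup_cons.1 hw).2 (by simpa using hd)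

/-- A Knuth move exchanges two adjacent letters of its window and therefore fixes the first or the
last one; the comparison with the letter outside of that end is unaffected. Rotations move all three
letters, which is why only they matter for axiom 4'a. -/
theorem knuth_desc_left_or_right {k : ℕ} {w : List ℕ} (h : adm (k + 1) w = true) (hw : w.Nodup) :
    desc (move false (k + 1) w) k = desc w k ∨
      desc (move false (k + 1) w) (k + 3) = desc w (k + 3) := by
  induction k generalizing w with
  | zero =>
    match w, h with
    | u :: x :: y :: z :: t, h =>
      rw [move_cons_succ, move_zero_cons]
      simp only [List.nodup_cons, List.mem_cons, not_or] at hw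
      rw [if_neg Bool.false_ne_true, if_neg Bool.false_ne_true]
      split_ifs
      · exact .inl (by simp)
      · exact .inr (by simp [desc])
  | succ k ih =>
    match w, h with
    | x :: t, h => simpa using ih h (List.nodup_cons.1 hw).2

theorem move_comm {j k : ℕ} (h : j + 3 ≤ k) (r s : Bool) (w : List ℕ) :
    move r j (move s k w) = move s k (move r j w) := by
  induction j generalizing k w with
  | zero =>
    obtain ⟨k, rfl⟩ : ∃ k', k = k' + 3 := ⟨k - 3, by omega⟩
    match w with
    | [] | [_] | [_, _] => rfl
    | x :: y :: z :: t =>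
      simp only [move_cons_succ, move_zero_cons]
      split_ifs <;> simp
  | succ j ih =>
    obtain ⟨k, rfl⟩ : ∃ k', k = k' + 1 := ⟨k - 1, by omega⟩
    match w with
    | [] => rfl
    | x :: t => simp [ih (by omega : j + 3 ≤ k)]

theorem adm_move_of_le {j k : ℕ} (h : j + 3 ≤ k) (r : Bool) (w : List ℕ) :
    adm j (move r k w) = adm j w := by
  induction j generalizing k w with
  | zero =>
    obtain ⟨k, rfl⟩ : ∃ k', k = k' + 3 := ⟨k - 3, by omega⟩
    match w with
    | [] | [_] | [_, _] | x :: y :: z :: t => rfl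
  | succ j ih =>
    obtain ⟨k, rfl⟩ : ∃ k', k = k' + 1 := ⟨k - 1, by omega⟩
    match w with
    | [] => rfl
    | x :: t => simp [ih (by omega : j + 3 ≤ k)]

theorem adm_move_of_ge {j k : ℕ} (h : k + 3 ≤ j) (r : Bool) (w : List ℕ) :
    adm j (move r k w) = adm j w := by
  induction k generalizing j w with
  | zero =>
    obtain ⟨j, rfl⟩ : ∃ j', j = j' + 3 := ⟨j - 3, by omega⟩
    match w with
    | [] | [_] | [_, _] => rfl
    | x :: y :: z :: t =>
      rw [move_zero_cons]
      split_ifs <;> rfl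
  | succ k ih =>
    obtain ⟨j, rfl⟩ : ∃ j', j = j' + 1 := ⟨j - 1, by omega⟩
    match w with
    | [] => rfl
    | x :: t => simpa using ih (by omega : k + 3 ≤ j) t

theorem testBit_desMask (w : List ℕ) (p : ℕ) : (desMask w).testBit p = desc w p := by
  induction p generalizing w with
  | zero =>
    match w with
    | [] | [_] => simp [desMask]
    | x :: y :: t =>
      rw [desMask, blt_eq_decide, desc_cons_cons_zero]
      by_cases h : y < x <;> simp [h, Nat.testBit_zero]
  | succ p ih =>
    match w with
    | [] | [_] => simp [desMask]
    | x :: y :: t =>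
      rw [desMask, desc_cons_succ, ← ih]
      cases Nat.blt y x
      · rw [cond_false, Nat.testBit_succ, Nat.mul_div_cancel_left _ (by norm_num)]
      · rw [cond_true, Nat.testBit_succ]
        congr 1
        omega

theorem mem_descentSet {w : List ℕ} {p : ℕ} : p + 1 ∈ descentSet w ↔ desc w p = true := by
  have h : p + 1 ∈ descentSet w ↔ p + 1 < w.length ∧ w.getD (p + 1) 0 < w.getD p 0 := by
    simp [descentSet]
  rw [h]
  induction p generalizing w with
  | zero =>
    match w with
    | [] | [_] => simp
    | x :: y :: t => simp
  | succ p ih =>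
    match w with
    | [] => simp
    | x :: t =>
      have := ih (w := t) (by simp [descentSet])
      simpa using this

theorem desc_eq_false_of_length_le {w : List ℕ} {p : ℕ} (h : w.length ≤ p + 1) :
    desc w p = false := by
  rw [Bool.eq_false_iff, Ne, ← mem_descentSet]
  intro hc
  have : p + 1 < w.length := hc.2.1
  omega

theorem desMask_lt (w : List ℕ) {n : ℕ} (h : w.length ≤ n + 1) : desMask w < 2 ^ n := by
  refine Nat.lt_pow_two_of_testBit _ fun i hi => ?_
  rw [testBit_desMask]
  exact desc_eq_false_of_length_le (by omega)

/-! ### D₀ graphs given by moves -/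

/-- `S` is a set of permutations of `n` closed under the moves of kinds `rot`, and the kind of a
move is unchanged by the move itself and by moves of disjoint windows. -/
structure IsMoveSystem (n : ℕ) (S : Finset (List ℕ)) (rot : List ℕ → ℕ → Bool) : Prop where
  word : ∀ w ∈ S, IsWord n n w
  mem : ∀ w ∈ S, ∀ k, adm k w = true → move (rot w k) k w ∈ S
  rot_self : ∀ w ∈ S, ∀ k, adm k w = true → rot (move (rot w k) k w) k = rot w k
  rot_far : ∀ w ∈ S, ∀ j k, adm j w = true → adm k w = true → (j + 3 ≤ k ∨ k + 3 ≤ j) →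
    rot (move (rot w j) j w) k = rot w k

theorem exists_of_adm {k : ℕ} {w : List ℕ} (h : adm k w = true) :
    ∃ v x y z t, v.length = k ∧ w = v ++ x :: y :: z :: t ∧
      (decide (y < x) != decide (z < y)) = true := by
  refine adm_induction (P := fun k w => ∃ v x y z t, v.length = k ∧ w = v ++ x :: y :: z :: t ∧
      (decide (y < x) != decide (z < y)) = true) ?_ ?_ h
  · intro x y z t h
    exact ⟨[], x, y, z, t, rfl, rfl, h⟩
  · rintro k u t - ⟨v, x, y, z, s, rfl, rfl, h⟩
    exact ⟨u :: v, x, y, z, s, rfl, rfl, h⟩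

theorem adm_length_append (v u : List ℕ) : adm v.length (v ++ u) = adm 0 u := by
  induction v with
  | nil => rfl
  | cons x v ih => exact ih

theorem move_length_append (r : Bool) (v u : List ℕ) :
    move r v.length (v ++ u) = v ++ move r 0 u := by
  induction v with
  | nil => rfl
  | cons x v ih => simp [ih]

theorem knuthPair_or_rotationPair {k : ℕ} {w : List ℕ} (h : adm k w = true) (hw : w.Nodup)
    (r : Bool) : KnuthPair (k + 2) w (move r k w) ∨ RotationPair (k + 2) w (move r k w) := by
  obtain ⟨v, x, y, z, t, rfl, rfl, h0⟩ := exists_of_adm h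
  have hd : x ≠ y ∧ x ≠ z ∧ y ≠ z := by
    have := hw.of_append_right
    simp only [List.nodup_cons, List.mem_cons, not_or] at this
    exact ⟨this.1.1, this.1.2.1, this.2.1.1⟩
  rw [move_length_append, move_zero_cons]
  simp only [bne_iff_ne, ne_eq, decide_eq_decide] at h0
  cases r
  · left
    -- For a non-monotone triple, comparing the first letter with the two others determines the
    -- relative order of all three.
    rcases lt_or_gt_of_ne hd.1 with h1 | h1 <;> rcases lt_or_gt_of_ne hd.2.1 with h2 | h2
    · refine ⟨v, t, x, z, y, by omega, by omega, rfl, .inr ?_⟩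
      rw [if_neg (by omega)]
      simp
    · refine ⟨v, t, z, x, y, by omega, by omega, rfl, .inl ?_⟩
      rw [if_pos (by omega)]
      simp [Set.pair_comm]
    · refine ⟨v, t, y, x, z, by omega, by omega, rfl, .inl ?_⟩
      rw [if_pos (by omega)]
      simp
    · refine ⟨v, t, y, z, x, by omega, by omega, rfl, .inr ?_⟩
      rw [if_neg (by omega)]
      simp [Set.pair_comm]
  · right
    rcases lt_or_gt_of_ne hd.1 with h1 | h1 <;> rcases lt_or_gt_of_ne hd.2.1 with h2 | h2
    · refine ⟨v, t, x, z, y, by omega, by omega, rfl, .inl ?_⟩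
      rw [if_neg (by omega)]
      simp [Set.pair_comm]
    · refine ⟨v, t, z, x, y, by omega, by omega, rfl, .inr ?_⟩
      rw [if_pos (by omega)]
      simp
    · refine ⟨v, t, y, x, z, by omega, by omega, rfl, .inl ?_⟩
      rw [if_pos (by omega)]
      simp
    · refine ⟨v, t, y, z, x, by omega, by omega, rfl, .inr ?_⟩
      rw [if_neg (by omega)]
      simp [Set.pair_comm]

theorem adm_of_mem_krSquare {v w : List ℕ} {a b c : ℕ} (hab : a < b) (hbc : b < c) {x : List ℕ}
    (h : x ∈ krSquare v w a b c) : adm v.length x = true := by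
  simp only [krSquare, Set.mem_insert_iff, Set.mem_singleton_iff] at h
  rcases h with rfl | rfl | rfl | rfl <;> rw [List.append_assoc, adm_length_append] <;> simp <;>
    omega

/-! ### Axioms valid for every system of moves -/

namespace IsMoveSystem

variable {n : ℕ} {S : Finset (List ℕ)} {rot : List ℕ → ℕ → Bool}

/-- The D₀ graph of a system of moves. -/
def graph (h : IsMoveSystem n S rot) : D0Graph n n where
  verts := S
  isWord := h.word
  edge i :=
    { Adj := fun x y => 2 ≤ i ∧ adm (i - 2) x.1 = true ∧ y.1 = move (rot x.1 (i - 2)) (i - 2) x.1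
      symm := ⟨fun x y ⟨h1, h2, h3⟩ => by
        have hx := (h.word x.1 x.2).2.1
        refine ⟨h1, h3 ▸ adm_move h2 hx _, ?_⟩
        rw [h3, h.rot_self _ x.2 _ h2, move_move h2 hx]⟩
      loopless := ⟨fun x ⟨_, h2, h3⟩ => by
        have := (desc_move h2 (h.word x.1 x.2).2.1 (rot x.1 (i - 2))).1
        rw [← h3] at this
        simp at this⟩ }
  color_mem i x y := fun ⟨h1, h2, _⟩ => by
    have h3 := lt_length_of_adm h2
    rw [(h.word x.1 x.2).1] at h3
    omega
  edge_type i x y := fun ⟨h1, h2, h3⟩ => by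
    have := knuthPair_or_rotationPair h2 (h.word x.1 x.2).2.1 (rot x.1 (i - 2))
    rwa [show i - 2 + 2 = i by omega, ← h3] at this
  existsUnique_edge v w a b c hab hbc x hx := by
    have h1 : adm (v.length + 2 - 2) x.1 = true := adm_of_mem_krSquare hab hbc hx
    exact ⟨⟨_, h.mem x.1 x.2 _ h1⟩, ⟨by omega, h1, rfl⟩, fun y hy => Subtype.ext hy.2.2⟩

variable (h : IsMoveSystem n S rot)

/-- The signed, colored graph of a system of moves. -/
noncomputable abbrev signed : SignedColoredGraph n {w : List ℕ // w ∈ h.graph.verts} :=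
  h.graph.toSignedColoredGraph

variable {h}

theorem nodup (x : {w : List ℕ // w ∈ h.graph.verts}) : x.1.Nodup := (h.word x.1 x.2).2.1

theorem length (x : {w : List ℕ // w ∈ h.graph.verts}) : x.1.length = n := (h.word x.1 x.2).1

theorem adj_iff {i : ℕ} {x y : {w : List ℕ // w ∈ h.graph.verts}} :
    (h.signed.edge i).Adj x y ↔
      2 ≤ i ∧ adm (i - 2) x.1 = true ∧ y.1 = move (rot x.1 (i - 2)) (i - 2) x.1 := Iff.rfl

theorem adj_add_two_iff {k : ℕ} {x y : {w : List ℕ // w ∈ h.graph.verts}} :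
    (h.signed.edge (k + 2)).Adj x y ↔ adm k x.1 = true ∧ y.1 = move (rot x.1 k) k x.1 := by
  rw [adj_iff]
  simp

theorem admits_add_two_iff {k : ℕ} {x : {w : List ℕ // w ∈ h.graph.verts}} :
    h.signed.Admits (k + 2) x ↔ adm k x.1 = true := by
  constructor
  · rintro ⟨y, hy⟩
    exact (adj_add_two_iff.1 hy).1
  · intro hx
    exact ⟨⟨_, h.mem x.1 x.2 k hx⟩, adj_add_two_iff.2 ⟨hx, rfl⟩⟩

theorem σ_eq {p : ℕ} (x : {w : List ℕ // w ∈ h.graph.verts}) :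
    h.signed.σ x (p + 1) = if desc x.1 p = true then -1 else 1 := by
  unfold signed D0Graph.toSignedColoredGraph
  dsimp only
  split_ifs with h1 h2 h2
  · rfl
  · exact absurd (mem_descentSet.1 h1) h2
  · exact absurd (mem_descentSet.2 h2) h1
  · rfl

theorem σ_eq_σ_iff {p q : ℕ} {x y : {w : List ℕ // w ∈ h.graph.verts}} :
    h.signed.σ x (p + 1) = h.signed.σ y (q + 1) ↔ desc x.1 p = desc y.1 q := by
  rw [σ_eq, σ_eq]
  cases desc x.1 p <;> cases desc y.1 q <;> decide

theorem σ_eq_neg_σ_iff {p q : ℕ} {x y : {w : List ℕ // w ∈ h.graph.verts}} :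
    h.signed.σ x (p + 1) = -h.signed.σ y (q + 1) ↔ desc x.1 p ≠ desc y.1 q := by
  rw [σ_eq, σ_eq]
  cases desc x.1 p <;> cases desc y.1 q <;> decide

theorem exists_add_two_of_adj {i : ℕ} {x y : {w : List ℕ // w ∈ h.graph.verts}}
    (hxy : (h.signed.edge i).Adj x y) : ∃ k, i = k + 2 := ⟨i - 2, by have := hxy.1; omega⟩

theorem axiom0 : h.signed.Axiom0 := fun _ _ _ _ h1 h2 => Subtype.ext (h1.2.2.trans h2.2.2.symm)

theorem axiom1 : h.signed.Axiom1 := by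
  refine ⟨axiom0, fun i w h1 h2 => ?_⟩
  obtain ⟨k, rfl⟩ : ∃ k, i = k + 2 := ⟨i - 2, by omega⟩
  rw [admits_add_two_iff, show k + 2 - 1 = k + 1 by omega, σ_eq_neg_σ_iff,
    adm_iff (by rw [length]; omega)]

theorem axiom2 : h.signed.Axiom2 := by
  intro i w x hwx
  obtain ⟨k, rfl⟩ := exists_add_two_of_adj hwx
  obtain ⟨h1, h2⟩ := adj_add_two_iff.1 hwx
  have h3 := desc_move h1 (nodup w) (rot w.1 k)
  rw [show k + 2 - 1 = k + 1 by omega, σ_eq_neg_σ_iff, σ_eq_neg_σ_iff, h2, h3.1, h3.2]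
  refine ⟨by simp, by simp, fun j hj hj' hk => ?_⟩
  obtain ⟨p, rfl⟩ : ∃ p, j = p + 1 := ⟨j - 1, by omega⟩
  rw [σ_eq_σ_iff, h2]
  rcases hk with hk | hk
  · exact (desc_move_of_lt _ (by omega)).symm
  · exact (desc_move_of_gt _ (by omega)).symm

theorem axiom3 : h.signed.Axiom3 := by
  intro i w x hwx
  obtain ⟨k, rfl⟩ := exists_add_two_of_adj hwx
  obtain ⟨h1, h2⟩ := adj_add_two_iff.1 hwx
  constructor
  · intro h3
    obtain ⟨k, rfl⟩ : ∃ k', k = k' + 1 := ⟨k - 1, by omega⟩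
    rw [show k + 1 + 2 - 2 = k + 1 by omega, show k + 1 + 2 - 1 = k + 1 + 1 by omega,
      σ_eq_neg_σ_iff, σ_eq_neg_σ_iff, h2]
    exact fun h4 => desc_move_left h1 (nodup w) h4.symm
  · intro _
    rw [σ_eq_neg_σ_iff, σ_eq_neg_σ_iff, h2]
    exact fun h4 => desc_move_right h1 (nodup w) h4.symm

/-- Colors at distance at least 3 belong to disjoint windows, so the moves commute as soon as
neither changes the kind of the other. -/
theorem axiom5 : h.signed.Axiom5 := by
  intro i j w x y hij hwx hxy
  obtain ⟨k, rfl⟩ := exists_add_two_of_adj hwx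
  obtain ⟨l, rfl⟩ := exists_add_two_of_adj hxy
  obtain ⟨h1, h2⟩ := adj_add_two_iff.1 hwx
  obtain ⟨h3, h4⟩ := adj_add_two_iff.1 hxy
  have hkl : k + 3 ≤ l ∨ l + 3 ≤ k := by omega
  have h5 : adm l w.1 = true := by
    rw [← h3, h2]
    rcases hkl with h | h
    · exact (adm_move_of_ge h _ _).symm
    · exact (adm_move_of_le h _ _).symm
  refine ⟨⟨_, h.mem w.1 w.2 l h5⟩, adj_add_two_iff.2 ⟨h5, rfl⟩, adj_add_two_iff.2 ⟨?_, ?_⟩⟩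
  · rcases hkl with h | h
    · exact (adm_move_of_le h _ _).trans h1
    · exact (adm_move_of_ge h _ _).trans h1
  · rw [h4, h2, h.rot_far w.1 w.2 k l h1 h5 hkl, h.rot_far w.1 w.2 l k h5 h1 hkl.symm]
    rcases hkl with h | h
    · exact (move_comm h _ _ _).symm
    · exact move_comm h _ _ _

/-- The alternating path of a flat step stays in the component of its start, and its last edge shows
that `u` is the `(i-2)`-neighbor of `z`. Hence flat chains are weak flat chains. -/
theorem flatStep_weakFlatStep {i : ℕ} {y z : {w : List ℕ // w ∈ h.graph.verts}}
    (hyz : h.signed.FlatStep i y z) : h.signed.WeakFlatStep i y z := by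
  obtain ⟨u, h1, h2, h3⟩ := hyz
  refine ⟨?_, u, h3.symm, h2⟩
  have h4 : (h.signed.edge (i - 2) ⊔ h.signed.edge (i - 1)).Reachable y u := by
    clear h2 h3
    induction h1 with
    | refl => rfl
    | tail _ hpq ih =>
      obtain ⟨r, hr, hr'⟩ := hpq
      exact ih.trans ((SimpleGraph.Adj.reachable (Or.inl hr)).trans
        (SimpleGraph.Adj.reachable (Or.inr hr')))
  exact h4.trans (SimpleGraph.Adj.reachable (Or.inl h3))

theorem axiom4b (hb : h.signed.Axiom4bStrong) : h.signed.Axiom4b := by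
  intro i m x h1 h2 h3
  refine hb i m x h1 h2 ⟨h3.1, h3.2.1, h3.2.2.1, fun j h4 h5 => ?_⟩
  exact flatStep_weakFlatStep (h3.2.2.2 j h4 h5)

end IsMoveSystem

/-! ### Windows and patterns -/

/-- The subword of the letters of indices `k, …, k + d - 1`. -/
def window (k d : ℕ) (w : List ℕ) : List ℕ := (w.drop k).take d

/-- The pattern of a word: its `j`-th smallest letter is replaced by `j`. -/
def std (u : List ℕ) : List ℕ := u.map fun x => u.countP fun y => Nat.ble y x

theorem drop_move (r : Bool) (k t : ℕ) (w : List ℕ) :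
    (move r (k + t) w).drop k = move r t (w.drop k) := by
  induction k generalizing w with
  | zero => simp
  | succ k ih =>
    match w with
    | [] => cases t <;> simp [move]
    | x :: w =>
      rw [show k + 1 + t = k + t + 1 by omega, move_cons_succ, List.drop_succ_cons,
        List.drop_succ_cons, ih]

theorem take_move (r : Bool) {t d : ℕ} (h : t + 3 ≤ d) (w : List ℕ) :
    (move r t w).take d = move r t (w.take d) := by
  induction t generalizing w d with
  | zero =>
    obtain ⟨d, rfl⟩ : ∃ d', d = d' + 3 := ⟨d - 3, by omega⟩
    match w with
    | [] | [_] | [_, _] => simp [move]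
    | x :: y :: z :: w =>
      simp only [List.take_succ_cons, move_zero_cons]
      split_ifs <;> simp
  | succ t ih =>
    obtain ⟨d, rfl⟩ : ∃ d', d = d' + 1 := ⟨d - 1, by omega⟩
    match w with
    | [] => simp [move]
    | x :: w => simp [ih (by omega : t + 3 ≤ d)]

theorem window_move (r : Bool) (k : ℕ) {t d : ℕ} (h : t + 3 ≤ d) (w : List ℕ) :
    window k d (move r (k + t) w) = move r t (window k d w) := by
  rw [window, drop_move, take_move r h, window]

theorem adm_drop (k t : ℕ) (w : List ℕ) : adm t (w.drop k) = adm (k + t) w := by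
  induction k generalizing w with
  | zero => simp
  | succ k ih =>
    match w with
    | [] => simp
    | x :: w => rw [List.drop_succ_cons, ih, show k + 1 + t = k + t + 1 by omega, adm_cons_succ]

theorem adm_take {t d : ℕ} (h : t + 3 ≤ d) (w : List ℕ) : adm t (w.take d) = adm t w := by
  induction t generalizing w d with
  | zero =>
    obtain ⟨d, rfl⟩ : ∃ d', d = d' + 3 := ⟨d - 3, by omega⟩
    match w with
    | [] | [_] | [_, _] | x :: y :: z :: w => rfl
  | succ t ih =>
    obtain ⟨d, rfl⟩ : ∃ d', d = d' + 1 := ⟨d - 1, by omega⟩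
    match w with
    | [] => simp
    | x :: w => simp [ih (by omega : t + 3 ≤ d)]

theorem adm_window (k : ℕ) {t d : ℕ} (h : t + 3 ≤ d) (w : List ℕ) :
    adm t (window k d w) = adm (k + t) w := by
  rw [window, adm_take h, adm_drop]

theorem desc_drop (k p : ℕ) (w : List ℕ) : desc (w.drop k) p = desc w (k + p) := by
  induction k generalizing w with
  | zero => simp
  | succ k ih =>
    match w with
    | [] => simp
    | x :: w => rw [List.drop_succ_cons, ih, show k + 1 + p = k + p + 1 by omega, desc_cons_succ]

theorem desc_take {p d : ℕ} (h : p + 1 < d) (w : List ℕ) : desc (w.take d) p = desc w p := by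
  induction p generalizing w d with
  | zero =>
    obtain ⟨d, rfl⟩ : ∃ d', d = d' + 2 := ⟨d - 2, by omega⟩
    match w with
    | [] | [_] | x :: y :: w => rfl
  | succ p ih =>
    obtain ⟨d, rfl⟩ : ∃ d', d = d' + 1 := ⟨d - 1, by omega⟩
    match w with
    | [] => simp
    | x :: w => simp [ih (by omega : p + 1 < d)]

theorem desc_window (k : ℕ) {p d : ℕ} (h : p + 1 < d) (w : List ℕ) :
    desc (window k d w) p = desc w (k + p) := by
  rw [window, desc_take h, desc_drop]

theorem length_window {k d : ℕ} {w : List ℕ} (h : k + d ≤ w.length) : (window k d w).length = d := by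
  simp [window]
  omega

theorem nodup_window {k d : ℕ} {w : List ℕ} (h : w.Nodup) : (window k d w).Nodup :=
  h.sublist ((List.take_sublist _ _).trans (List.drop_sublist _ _))

section Map

variable {f : ℕ → ℕ} {u : List ℕ}

theorem move_map (hf : ∀ x ∈ u, ∀ y ∈ u, f x < f y ↔ x < y) (r : Bool) (k : ℕ) :
    move r k (u.map f) = (move r k u).map f := by
  induction k generalizing u with
  | zero =>
    match u with
    | [] | [_] | [_, _] => rfl
    | x :: y :: z :: t =>
      have h1 := hf x (by simp) z (by simp)
      have h2 := hf y (by simp) x (by simp)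
      simp only [List.map_cons, move_zero_cons, h1, h2]
      split_ifs <;> rfl
  | succ k ih =>
    match u with
    | [] => rfl
    | x :: t =>
      simp only [List.map_cons, move_cons_succ]
      rw [ih fun a ha b hb => hf a (List.mem_cons_of_mem _ ha) b (List.mem_cons_of_mem _ hb)]

theorem desc_map (hf : ∀ x ∈ u, ∀ y ∈ u, f x < f y ↔ x < y) (p : ℕ) :
    desc (u.map f) p = desc u p := by
  induction p generalizing u with
  | zero =>
    match u with
    | [] | [_] => rfl
    | x :: y :: t => simp [hf y (by simp) x (by simp)]
  | succ p ih =>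
    match u with
    | [] => rfl
    | x :: t =>
      simp only [List.map_cons, desc_cons_succ]
      exact ih fun a ha b hb => hf a (List.mem_cons_of_mem _ ha) b (List.mem_cons_of_mem _ hb)

theorem adm_map (hf : ∀ x ∈ u, ∀ y ∈ u, f x < f y ↔ x < y) (k : ℕ) :
    adm k (u.map f) = adm k u := by
  induction k generalizing u with
  | zero =>
    match u with
    | [] | [_] | [_, _] => rfl
    | x :: y :: z :: t => simp [hf y (by simp) x (by simp), hf z (by simp) y (by simp)]
  | succ k ih =>
    match u with
    | [] => rfl
    | x :: t =>
      exact ih fun a ha b hb => hf a (List.mem_cons_of_mem _ ha) b (List.mem_cons_of_mem _ hb)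

end Map

theorem countP_ble_lt_iff {u : List ℕ} {x y : ℕ} (hy : y ∈ u) :
    (u.countP fun z => Nat.ble z x) < (u.countP fun z => Nat.ble z y) ↔ x < y := by
  constructor
  · intro h
    by_contra! hc
    refine absurd h (not_lt.2 (List.countP_mono_left fun z _ hz => ?_))
    rw [Nat.ble_eq] at hz ⊢
    omega
  · intro h
    induction u with
    | nil => simp at hy
    | cons a u ih =>
      have h1 : (u.countP fun z => Nat.ble z x) ≤ (u.countP fun z => Nat.ble z y) :=
        List.countP_mono_left fun z _ hz => by
          rw [Nat.ble_eq] at hz ⊢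
          omega
      rw [List.countP_cons, List.countP_cons]
      rcases List.mem_cons.1 hy with rfl | hy
      · rw [if_neg (by rw [Nat.ble_eq]; omega), if_pos (by rw [Nat.ble_eq])]
        omega
      · have h2 := ih hy
        split_ifs with h3 h4
        · omega
        · rw [Nat.ble_eq] at h3 h4
          omega
        · omega
        · omega

/-- Patterns of rearrangements of the same letters are obtained by one common order-preserving
relabelling. This makes `std` commute with moves and injective on rearrangements. -/
theorem std_eq_map_of_perm {u v : List ℕ} (h : v.Perm u) :
    std v = v.map fun x => u.countP fun y => Nat.ble y x :=
  List.map_congr_left fun _ _ => h.countP_eq _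

theorem std_move (r : Bool) (k : ℕ) (u : List ℕ) : std (move r k u) = move r k (std u) := by
  rw [std_eq_map_of_perm (move_perm r k u), std, move_map fun x _ y hy => countP_ble_lt_iff hy]

theorem desc_std (u : List ℕ) (p : ℕ) : desc (std u) p = desc u p :=
  desc_map (fun _ _ _ hy => countP_ble_lt_iff hy) p

theorem adm_std (k : ℕ) (u : List ℕ) : adm k (std u) = adm k u :=
  adm_map (fun _ _ _ hy => countP_ble_lt_iff hy) k

theorem eq_of_map_eq_map {f : ℕ → ℕ} {u v : List ℕ} (hf : ∀ a ∈ v, ∀ b ∈ u, f a = f b → a = b)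
    (h : v.map f = u.map f) : v = u := by
  induction v generalizing u with
  | nil => simpa using h
  | cons a v ih =>
    match u, h with
    | b :: u, h =>
      simp only [List.map_cons, List.cons.injEq] at h
      rw [hf a List.mem_cons_self b List.mem_cons_self h.1,
        ih (fun c hc d hd => hf c (List.mem_cons_of_mem _ hc) d (List.mem_cons_of_mem _ hd)) h.2]

theorem std_injective_of_perm {u v : List ℕ} (h : v.Perm u) (he : std v = std u) : v = u := by
  rw [std_eq_map_of_perm h, std] at he
  refine eq_of_map_eq_map (fun a ha b hb hab => ?_) he
  have h1 := countP_ble_lt_iff (x := a) hb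
  have h2 := countP_ble_lt_iff (x := b) (h.mem_iff.1 ha)
  omega

theorem std_perm {u : List ℕ} (hu : u.Nodup) : (std u).Perm (List.range' 1 u.length) := by
  have h1 : (std u).Nodup := by
    refine (List.nodup_map_iff_inj_on hu).2 fun x hx y hy hxy => ?_
    have h2 := countP_ble_lt_iff (x := x) hy
    have h3 := countP_ble_lt_iff (x := y) hx
    omega
  refine (List.subperm_of_subset h1 fun a ha => ?_).perm_of_length_le (by simp [std])
  obtain ⟨x, hx, rfl⟩ := List.mem_map.1 ha
  rw [List.mem_range'_1]
  have h2 : 0 < u.countP fun y => Nat.ble y x :=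
    List.countP_pos_iff.2 ⟨x, hx, by rw [Nat.ble_eq]⟩
  have h3 := List.countP_le_length (p := fun y => Nat.ble y x) (l := u)
  omega

/-! ### Local Schur positivity -/

theorem sum_sum_map_comm {α β M : Type*} [AddCommMonoid M] (A : Finset α) (l : List β)
    (f : β → α → M) :
    ∑ x ∈ A, (l.map fun p => f p x).sum = (l.map fun p => ∑ x ∈ A, f p x).sum := by
  induction l with
  | nil => simp
  | cons p l ih => simp only [List.map_cons, List.sum_cons, Finset.sum_add_distrib, ih]

/-- The positions of the cuts of a composition, as a binary number. -/
def cutMask : List ℕ → ℕ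
  | [] => 0
  | a :: c => Nat.lor (2 ^ (a + c.sum) / 2) (cutMask c)

theorem testBit_cutMask (c : List ℕ) (p : ℕ) :
    (cutMask c).testBit p = true ↔ p + 1 ∈ suffixSums c := by
  induction c with
  | nil => simp [cutMask, suffixSums]
  | cons a c ih =>
    have h1 : (Nat.lor (2 ^ (a + c.sum) / 2) (cutMask c)).testBit p =
        ((2 ^ (a + c.sum) / 2).testBit p || (cutMask c).testBit p) := Nat.testBit_or _ _ _
    rw [cutMask, h1, ← Nat.testBit_succ, Nat.testBit_two_pow, Bool.or_eq_true, ih, suffixSums,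
      List.mem_cons, decide_eq_true_eq, eq_comm]

/-- The compositions of `r`, for `r ≤ fuel`. -/
def compositions : ℕ → ℕ → List (List ℕ)
  | _, 0 => [[]]
  | 0, _ + 1 => []
  | fuel + 1, r + 1 => (List.range (r + 1)).flatMap fun s =>
      (compositions fuel s).map ((r + 1 - s) :: ·)

theorem mem_compositions {fuel r : ℕ} (hr : r ≤ fuel) {c : List ℕ} (hc : ∀ a ∈ c, 0 < a)
    (hs : c.sum = r) : c ∈ compositions fuel r := by
  induction c generalizing fuel r with
  | nil =>
    subst hs
    simp [compositions]
  | cons a c ih =>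
    have ha := hc a List.mem_cons_self
    rw [List.sum_cons] at hs
    obtain ⟨r, rfl⟩ : ∃ r', r = r' + 1 := ⟨r - 1, by omega⟩
    obtain ⟨fuel, rfl⟩ : ∃ f, fuel = f + 1 := ⟨fuel - 1, by omega⟩
    rw [compositions, List.mem_flatMap]
    refine ⟨c.sum, List.mem_range.2 (by omega), List.mem_map.2 ⟨c, ?_, ?_⟩⟩
    · exact ih (by omega) (fun b hb => hc b (List.mem_cons_of_mem _ hb)) rfl
    · rw [show r + 1 - c.sum = a by omega]

/-- The weight of an entry: the multiplicities of the submasks of `T`. -/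
def submaskWeight (T : ℕ) : List (ℕ × ℤ) → ℤ
  | [] => 0
  | p :: l => bif Nat.beq (Nat.land p.1 T) p.1 then p.2 + submaskWeight T l else submaskWeight T l

/-- The entry of a certificate at the index `t` and the remaining letters `key`. -/
def certEntry (t : ℕ) (key : List ℕ) : List (ℕ × List ℕ × List (ℕ × ℤ)) → List (ℕ × ℤ)
  | [] => []
  | e :: C => bif Nat.beq e.1 t && e.2.1 == key then e.2.2 else certEntry t key C

/-- A function on words that is negated by all moves of the letters of indices `t`, `t + 1`,
`t + 2`. -/
def altWeight (C : List (ℕ × List ℕ × List (ℕ × ℤ))) (T t : ℕ) (w : List ℕ) : ℤ :=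
  bif adm t w then
    bif desc w t then submaskWeight T (certEntry t (w.take t ++ w.drop (t + 3)) C)
    else -submaskWeight T (certEntry t (w.take t ++ w.drop (t + 3)) C)
  else 0

/-- For all permutations `w` of `d` and all compositions `c` of `d`, whether the descents of `w`
are cuts of `c` agrees with the sum of `kostka c l` over those `(l, p)` in `P` for which `p w` holds,
up to functions that are negated by moves. -/
def localCheck (d : ℕ) (P : List (List ℕ × (List ℕ → Bool)))
    (C : List (ℕ × List ℕ × List (ℕ × ℤ))) : Bool :=
  (List.range' 1 d).permutations'.all fun w => (compositions d d).all fun c =>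
    (if Nat.land (desMask w) (cutMask c) = desMask w then (1 : ℤ) else 0) ==
      (P.map fun p => bif p.2 w then (kostka c p.1 : ℤ) else 0).sum +
      ((List.range (d - 2)).map fun t => altWeight C (cutMask c) t w).sum

theorem take_move_self (r : Bool) (t : ℕ) (w : List ℕ) : (move r t w).take t = w.take t := by
  induction t generalizing w with
  | zero => simp
  | succ t ih =>
    match w with
    | [] => rfl
    | x :: w => simp [ih]

theorem drop_move_self (r : Bool) (t : ℕ) (w : List ℕ) :
    (move r t w).drop (t + 3) = w.drop (t + 3) := by
  induction t generalizing w with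
  | zero =>
    match w with
    | [] | [_] | [_, _] => rfl
    | x :: y :: z :: w =>
      rw [move_zero_cons]
      split_ifs <;> rfl
  | succ t ih =>
    match w with
    | [] => rfl
    | x :: w => exact ih w

/-- Both kinds of move flip the descent at `t`, which is the sign, and leave the letters outside of
the window in place, which are the key of the certificate. -/
theorem altWeight_move (C : List (ℕ × List ℕ × List (ℕ × ℤ))) (T : ℕ) {t : ℕ} {w : List ℕ}
    (h : adm t w = true) (hw : w.Nodup) (r : Bool) :
    altWeight C T t (move r t w) = -altWeight C T t w := by
  rw [altWeight, altWeight, adm_move h hw, h, (desc_move h hw r).1, take_move_self, drop_move_self]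
  cases desc w t <;> simp

namespace SignedColoredGraph

theorem reachable_restrict_of_adj {n : ℕ} {V : Type*} {G : SignedColoredGraph n V} {k d t : ℕ}
    {v w x : V} (ht : 2 ≤ t ∧ t < d) (hw : (G.restrict k d).underlying.Reachable v w)
    (hx : (G.edge (k + t)).Adj w x) : (G.restrict k d).underlying.Reachable v x := by
  refine hw.trans (SimpleGraph.Adj.reachable ?_)
  rw [underlying, SimpleGraph.iSup_adj]
  exact ⟨t, by rw [restrict]; dsimp only; rwa [if_pos ht]⟩

end SignedColoredGraph

namespace IsMoveSystem

variable {n : ℕ} {S : Finset (List ℕ)} {rot : List ℕ → ℕ → Bool} {h : IsMoveSystem n S rot}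

/-- The edges of color `k + t + 2` form a matching of the admissible vertices in `A`, and the
weights of matched vertices cancel; the other vertices have weight 0. -/
theorem sum_altWeight_eq_zero (C : List (ℕ × List ℕ × List (ℕ × ℤ))) (T k : ℕ) {d t : ℕ}
    (ht : t + 3 ≤ d) (A : Finset {w : List ℕ // w ∈ h.graph.verts})
    (hA : ∀ x ∈ A, ∀ y, (h.signed.edge (k + t + 2)).Adj x y → y ∈ A) :
    ∑ x ∈ A, altWeight C T t (std (window k d x.1)) = 0 := by
  classical
  have hmem : ∀ x : {w : List ℕ // w ∈ h.graph.verts}, adm (k + t) x.1 = true →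
      move (rot x.1 (k + t)) (k + t) x.1 ∈ h.graph.verts := fun x hx => h.mem x.1 x.2 _ hx
  let f : {w : List ℕ // w ∈ h.graph.verts} → {w : List ℕ // w ∈ h.graph.verts} := fun x =>
    if hx : adm (k + t) x.1 = true then ⟨_, hmem x hx⟩ else x
  have hf : ∀ x (hx : adm (k + t) x.1 = true), f x = ⟨_, hmem x hx⟩ := fun x hx => dif_pos hx
  have hf' : ∀ x : {w : List ℕ // w ∈ h.graph.verts}, ¬ adm (k + t) x.1 = true → f x = x :=
    fun x hx => dif_neg hx
  have hneg : ∀ x : {w : List ℕ // w ∈ h.graph.verts}, altWeight C T t (std (window k d (f x).1)) =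
      -altWeight C T t (std (window k d x.1)) := by
    intro x
    by_cases hx : adm (k + t) x.1 = true
    · have h1 : adm t (std (window k d x.1)) = true := by rwa [adm_std, adm_window k ht]
      have h2 : (std (window k d x.1)).Nodup :=
        (std_perm (nodup_window (nodup x))).nodup_iff.2 (List.nodup_range' (step := 1))
      rw [hf x hx, window_move _ _ ht, std_move, altWeight_move _ _ h1 h2]
    · have h1 : adm t (std (window k d x.1)) = false := by
        rw [adm_std, adm_window k ht]
        simpa using hx
      rw [hf' x hx, altWeight, h1]
      simp
  refine Finset.sum_involution (fun x _ => f x) (fun x _ => ?_) (fun x _ hx hfx => ?_)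
    (fun x hx => ?_) (fun x _ => ?_)
  · rw [hneg, add_neg_cancel]
  -- The involution negates the weight, so a fixed point has weight 0.
  · have h1 := hneg x
    rw [hfx] at h1
    omega
  · by_cases hx' : adm (k + t) x.1 = true
    · rw [hf x hx']
      exact hA x hx _ (adj_add_two_iff.2 ⟨hx', rfl⟩)
    · rwa [hf' x hx']
  · by_cases hx' : adm (k + t) x.1 = true
    · have h2 : adm (k + t) (f x).1 = true := by
        rw [hf x hx']
        exact adm_move hx' (nodup x) _
      rw [hf _ h2, Subtype.ext_iff]
      dsimp only
      rw [hf x hx']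
      dsimp only
      rw [h.rot_self x.1 x.2 _ hx', move_move hx' (nodup x)]
    · rw [hf' x hx', hf' x hx']

/-- The checked identity is summed over a component: its sign-changing terms vanish, and what
remains is the Schur expansion in which the coefficient belonging to `(l, p)` is the number of
vertices whose pattern satisfies `p`. Such coefficients are nonnegative, whatever rotation edges are
present. -/
theorem lsp_of_localCheck {d : ℕ} {P : List (List ℕ × (List ℕ → Bool))}
    {C : List (ℕ × List ℕ × List (ℕ × ℤ))} (hP : ∀ p ∈ P, p.1.SortedGE ∧ p.1.sum = d)
    (hcheck : localCheck d P C = true) : h.signed.LSP d := by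
  classical
  intro k hk v
  unfold SignedColoredGraph.componentGenFun
  set A := Finset.univ.filter fun w => (h.signed.restrict k d).underlying.Reachable v w with hAdef
  have hA : ∀ t, t + 3 ≤ d → ∀ x ∈ A, ∀ y, (h.signed.edge (k + t + 2)).Adj x y → y ∈ A := by
    intro t ht x hx y hxy
    rw [hAdef, Finset.mem_filter] at hx ⊢
    exact ⟨Finset.mem_univ _, SignedColoredGraph.reachable_restrict_of_adj (t := t + 2)
      ⟨by omega, by omega⟩ hx.2 hxy⟩
  let L : List (ℤ × List ℕ) := P.map fun p =>
    (((A.filter fun x => p.2 (std (window k d x.1)) = true).card : ℤ), p.1)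
  have hL : ∀ p ∈ L, 0 ≤ p.1 ∧ p.2.SortedGE ∧ p.2.sum = d := by
    intro p hp
    obtain ⟨q, hq, rfl⟩ := List.mem_map.1 hp
    exact ⟨Int.natCast_nonneg _, hP q hq⟩
  have key : ∑ x ∈ A, fundamentalQSym d {i | (h.signed.restrict k d).σ x i = -1} =
      (L.map fun p => p.1 • schurFunction (diagram p.2)).sum := by
    refine sum_fundamentalQSym_eq A _ d L (fun p hp => (hL p hp).2) fun c hc hs => ?_
    have h1 : ∀ x ∈ A, (if ∀ j, 1 ≤ j → j < d → j ∈ {i | (h.signed.restrict k d).σ x i = -1} →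
        j ∈ suffixSums c then (1 : ℤ) else 0) =
        (P.map fun p => bif p.2 (std (window k d x.1)) then (kostka c p.1 : ℤ) else 0).sum +
        ((List.range (d - 2)).map fun t =>
          altWeight C (cutMask c) t (std (window k d x.1))).sum := by
      intro x _
      have hlen : (window k d x.1).length = d := length_window (by rw [length]; exact hk)
      have hperm := std_perm (nodup_window (k := k) (d := d) (nodup x))
      rw [hlen] at hperm
      have h2 := List.all_eq_true.1 (List.all_eq_true.1 hcheck _ (List.mem_permutations'.2 hperm))
        c (mem_compositions le_rfl hc hs)
      rw [beq_iff_eq] at h2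
      rw [← h2]
      have h3 : (∀ j, 1 ≤ j → j < d → j ∈ {i | (h.signed.restrict k d).σ x i = -1} →
          j ∈ suffixSums c) ↔ Nat.land (desMask (std (window k d x.1))) (cutMask c) =
            desMask (std (window k d x.1)) := by
        refine Iff.trans ?_ (land_eq_left_iff _ _).symm
        have h4 : ∀ p, p + 1 < d → (p + 1 ∈ {i | (h.signed.restrict k d).σ x i = -1} ↔
            (desMask (std (window k d x.1))).testBit p = true) := by
          intro p hp
          rw [testBit_desMask, desc_std, desc_window k hp]
          change h.signed.σ x (k + p + 1) = -1 ↔ _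
          rw [σ_eq]
          cases desc x.1 (k + p) <;> decide
        constructor
        · intro h5 p hp
          have hp' : p + 1 < d := by
            by_contra hc
            rw [testBit_desMask, desc_eq_false_of_length_le (by rw [std, List.length_map]; omega)]
              at hp
            exact Bool.false_ne_true hp
          exact (testBit_cutMask c p).2 (h5 _ (by omega) hp' ((h4 p hp').2 hp))
        · intro h5 j hj hj' hm
          obtain ⟨p, rfl⟩ : ∃ p, j = p + 1 := ⟨j - 1, by omega⟩
          exact (testBit_cutMask c p).1 (h5 p ((h4 p hj').1 hm))
      split_ifs with h4 h5 h5
      · rfl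
      · exact absurd (h3.1 h4) h5
      · exact absurd (h3.2 h5) h4
      · rfl
    -- The component is closed under the edges of each window inside the interval, so every
    -- alternating term sums to 0.
    rw [Finset.sum_congr rfl h1, Finset.sum_add_distrib, sum_sum_map_comm,
      sum_sum_map_comm, List.map_congr_left (g := fun _ => (0 : ℤ)) (l := List.range (d - 2))
        fun t ht => sum_altWeight_eq_zero C (cutMask c) k
          (by rw [List.mem_range] at ht; omega) A (hA t (by rw [List.mem_range] at ht; omega))]
    rw [List.map_const', List.sum_replicate, smul_zero, add_zero, List.map_map]
    refine congrArg _ (List.map_congr_left fun p _ => ?_)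
    rw [Function.comp_apply, Finset.card_filter, Nat.cast_sum, Finset.sum_mul]
    refine Finset.sum_congr rfl fun x _ => ?_
    cases p.2 (std (window k d x.1)) <;> simp
  have h2 := schurPositive_list_sum fun p hp => (hL p hp).1
  rw [← key] at h2
  convert h2 using 2
  ext w
  simp only [hAdef, Finset.mem_filter]

end IsMoveSystem

/-! ### Certificates for patterns of four and five letters -/

/-- The certificate of local Schur positivity for patterns of length 4. -/
def certificate4 : List (ℕ × List ℕ × List (ℕ × ℤ)) :=
  [(0, [1], [(3, 1), (5, 1)]), (0, [2], [(3, 1), (5, 1)]), (0, [3], [(1, 1)]), (0, [4], [(1, 1)]),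
   (1, [1], [(1, 1), (2, 1)]), (1, [2], [(1, 1), (2, 1)]), (1, [3], [(3, 1)]), (1, [4], [(3, 1)])]

/-- The certificate of local Schur positivity for patterns of length 5. -/
def certificate5 : List (ℕ × List ℕ × List (ℕ × ℤ)) :=
  [(0, [1, 2], [(5, 1), (11, 1)]), (0, [1, 3], [(5, 1), (11, 1)]), (0, [1, 4], [(5, 1), (11, 1)]),
   (0, [1, 5], [(2, -1), (11, 1)]), (0, [2, 1], [(7, 1), (11, 1), (13, 1)]),
   (0, [2, 3], [(3, 1), (5, 1)]), (0, [2, 4], [(3, 1), (5, 1)]), (0, [2, 5], [(2, -1), (3, 1)]),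
   (0, [3, 1], [(7, 1), (11, 1), (13, 1)]), (0, [3, 2], [(7, 1), (11, 1), (13, 1)]),
   (0, [3, 4], [(1, 1)]), (0, [3, 5], [(1, 1)]), (0, [4, 1], [(3, 1), (9, 1), (11, -1)]),
   (0, [4, 2], [(9, 1)]), (0, [4, 3], [(9, 1)]), (0, [4, 5], [(1, 1)]),
   (0, [5, 1], [(2, 1), (3, 1), (5, 1), (9, 1), (11, -1)]), (0, [5, 2], [(2, 1), (5, 1), (9, 1)]),
   (0, [5, 3], [(2, 1), (5, 1), (9, 1)]), (0, [5, 4], [(2, 1), (5, 1), (9, 1)]),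
   (1, [1, 2], [(3, 1), (5, 1), (9, 1), (6, 1), (10, 1)]),
   (1, [1, 3], [(3, 1), (5, 1), (9, 1), (6, 1), (10, 1)]), (1, [1, 4], [(1, 1), (2, 1)]),
   (1, [1, 5], [(1, 1), (2, 1)]), (1, [2, 1], [(3, 1), (5, 1), (9, 1), (6, 1), (10, 1)]),
   (1, [2, 3], [(5, 1), (9, 1), (6, 1), (10, 1), (11, 1)]), (1, [2, 4], [(1, 1), (2, 1)]),
   (1, [2, 5], [(1, 1), (2, 1)]), (1, [3, 1], [(3, 1), (5, 1), (9, 1), (6, 1), (10, 1)]),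
   (1, [3, 2], [(5, 1), (9, 1), (6, 1), (10, 1), (11, 1)]), (1, [3, 4], [(2, 1), (3, 1), (5, 1)]),
   (1, [3, 5], [(3, 1)]), (1, [4, 1], [(7, 1), (11, 1)]), (1, [4, 2], [(7, 1), (11, 1)]),
   (1, [4, 3], [(2, 1), (3, 1), (5, 1)]), (1, [4, 5], [(3, 1)]), (1, [5, 1], [(7, 1), (11, 1)]),
   (1, [5, 2], [(7, 1), (11, 1)]), (1, [5, 3], [(3, 1)]), (1, [5, 4], [(3, 1)]),
   (2, [1, 2], [(1, 1), (2, 1), (4, 1)]), (2, [1, 3], [(1, 1), (2, 1), (4, 1)]),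
   (2, [1, 4], [(2, -1), (3, 1), (6, 1)]), (2, [1, 5], [(3, 1), (5, 1), (6, 1)]),
   (2, [2, 1], [(2, 1), (5, 1)]), (2, [2, 3], [(1, 1), (2, 1), (4, 1)]),
   (2, [2, 4], [(2, -1), (6, 1), (11, 1)]), (2, [2, 5], [(5, 1), (6, 1), (11, 1)]),
   (2, [3, 1], [(2, 1), (5, 1)]), (2, [3, 2], [(2, 1), (3, 1), (5, 1), (11, -1)]),
   (2, [3, 4], [(2, -1), (6, 1), (11, 1)]), (2, [3, 5], [(5, 1), (6, 1), (11, 1)]),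
   (2, [4, 1], [(2, 1), (5, 1)]), (2, [4, 2], [(2, 1), (3, 1), (5, 1), (11, -1)]),
   (2, [4, 3], [(7, 1)]), (2, [4, 5], [(5, 1), (6, 1), (11, 1)]), (2, [5, 2], [(3, 1), (11, -1)]),
   (2, [5, 3], [(7, 1)]), (2, [5, 4], [(7, 1)])]

/-- Functions counting the Schur functions in components of degree 4. -/
def schurWitness4 : List (List ℕ × (List ℕ → Bool)) :=
  [([4], fun w => desMask w == 0), ([3, 1], fun w => desMask w == 4),
   ([2, 2], fun w => [[2, 1, 4, 3], [3, 4, 1, 2]].elem w), ([2, 1, 1], fun w => desMask w == 6),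
   ([1, 1, 1, 1], fun w => desMask w == 7)]

/-- Functions counting the Schur functions in components of degree 5. -/
def schurWitness5 : List (List ℕ × (List ℕ → Bool)) :=
  [([5], fun w => desMask w == 0), ([4, 1], fun w => desMask w == 8),
   ([3, 2], fun w => [[1, 3, 2, 5, 4], [1, 4, 5, 2, 3], [2, 3, 1, 5, 4], [2, 4, 5, 1, 3],
      [3, 4, 5, 1, 2]].elem w),
   ([3, 1, 1], fun w => desMask w == 12),
   ([2, 2, 1], fun w => [[2, 1, 5, 4, 3], [3, 1, 5, 4, 2], [3, 2, 5, 4, 1], [4, 5, 1, 3, 2],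
      [4, 5, 2, 3, 1]].elem w),
   ([2, 1, 1, 1], fun w => desMask w == 14), ([1, 1, 1, 1, 1], fun w => desMask w == 15)]

/-- A pair `(M, q)` in a certificate contributes `q` whenever all elements of the mask `M` are cuts,
that is, `q` times the fundamental function of `M`; missing keys count as 0. All permutations and
compositions of the given degree are tested, independently of any particular graph. -/
theorem localCheck_four : localCheck 4 schurWitness4 certificate4 = true := by decide +kernel

theorem localCheck_five : localCheck 5 schurWitness5 certificate5 = true := by decide +kernel

namespace IsMoveSystem

variable {n : ℕ} {S : Finset (List ℕ)} {rot : List ℕ → ℕ → Bool} {h : IsMoveSystem n S rot}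

theorem lsp_four : h.signed.LSP 4 := lsp_of_localCheck (by decide) localCheck_four

theorem lsp_five : h.signed.LSP 5 := lsp_of_localCheck (by decide) localCheck_five

end IsMoveSystem

/-! ### Permutations with a given inverse descent set -/

/-- The word `w` is a permutation of `bs.length + 1`, and for each `v ≤ bs.length` the letter
`v + 1` is to the left of `v` if and only if the entry of `bs` with index `bs.length - v` is true. -/
def inClass : List Bool → List ℕ → Bool
  | [], w => w == [1]
  | b :: bs, w =>
    (w.filter fun z => Nat.beq z (bs.length + 1) || Nat.beq z (bs.length + 2)) ==
        (bif b then [bs.length + 2, bs.length + 1] else [bs.length + 1, bs.length + 2]) &&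
      inClass bs (w.filter fun z => !Nat.beq z (bs.length + 2))

/-- The numbers of letters to the left of a new maximal letter, if it is inserted in a word of
length `L` to the left (if `b` is true) or to the right of the letter of index `p`. -/
def insertionSites (b : Bool) (p L : ℕ) : List ℕ :=
  bif b then List.range (p + 1) else (List.range (L - p)).map fun q => p + 1 + q

/-- The words `w` with `inClass bs w`. -/
def classWords : List Bool → List (List ℕ)
  | [] => [[1]]
  | b :: bs => (classWords bs).flatMap fun u =>
      (insertionSites b (u.idxOf (bs.length + 1)) (bs.length + 1)).map fun q =>
        u.take q ++ (bs.length + 2) :: u.drop q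

/-- The descents of a word after the insertion of a new maximal letter to the right of `q` letters
in a word of length `L` with descents `M`. -/
def insertMask : ℕ → ℕ → ℕ → ℕ
  | 0, L, M => bif Nat.blt 0 L then 2 * M + 1 else 2 * M
  | 1, L, M => 2 * insertMask 0 (L - 1) (M / 2)
  | q + 2, L, M => M % 2 + 2 * insertMask (q + 1) (L - 1) (M / 2)

/-- The positions of the maximal letter and the descents of the words in `classWords bs`. -/
def classStates : List Bool → List (ℕ × ℕ)
  | [] => [(0, 0)]
  | b :: bs => (classStates bs).flatMap fun s =>
      (insertionSites b s.1 (bs.length + 1)).map fun q => (q, insertMask q (bs.length + 1) s.2)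

theorem natBeq_eq_decide (a b : ℕ) : Nat.beq a b = decide (a = b) := by
  rw [Bool.eq_iff_iff, decide_eq_true_eq, Nat.beq_eq]

theorem filter_natBeq_eq {u : List ℕ} (hu : u.Nodup) {n : ℕ} (hn : n ∈ u) :
    (u.filter fun z => Nat.beq z n) = [n] := by
  have h := List.Nodup.filter (fun z => Nat.beq z n) hu
  have h1 : ∀ x ∈ u.filter fun z => Nat.beq z n, x = n := fun x hx => by
    have := (List.mem_filter.1 hx).2
    rwa [Nat.beq_eq] at this
  have h2 : n ∈ u.filter fun z => Nat.beq z n := List.mem_filter.2 ⟨hn, by rw [Nat.beq_eq]⟩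
  match hl : u.filter fun z => Nat.beq z n with
  | [] => rw [hl] at h2; simp at h2
  | [x] => rw [hl] at h1; simpa using h1 x (by simp)
  | x :: y :: t =>
    rw [hl] at h1 h
    have h3 := h1 x (by simp)
    have h4 := h1 y (by simp)
    simp [h3, h4] at h

theorem perm_of_inClass {bs : List Bool} {w : List ℕ} (h : inClass bs w = true) :
    w.Perm (List.range' 1 (bs.length + 1)) := by
  induction bs generalizing w with
  | nil => rw [inClass, beq_iff_eq] at h; rw [h]; rfl
  | cons b bs ih =>
    rw [inClass, Bool.and_eq_true, beq_iff_eq] at h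
    have h1 := List.filter_append_perm (fun z => !Nat.beq z (bs.length + 2)) w
    -- The condition on the relative order of the two largest letters also says that the largest one
    -- occurs exactly once.
    have h2 : (w.filter fun z => !!Nat.beq z (bs.length + 2)) = [bs.length + 2] := by
      have h3 := congrArg (List.filter fun z => Nat.beq z (bs.length + 2)) h.1
      rw [List.filter_filter] at h3
      have h4 : (fun z => Nat.beq z (bs.length + 2) &&
          (Nat.beq z (bs.length + 1) || Nat.beq z (bs.length + 2))) =
          fun z => !!Nat.beq z (bs.length + 2) := by
        funext z
        cases Nat.beq z (bs.length + 2) <;> simp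
      rw [h4] at h3
      rw [h3]
      cases b <;> simp [natBeq_eq_decide]
    rw [h2] at h1
    refine h1.symm.trans ?_
    rw [List.length_cons, List.range'_1_concat]
    exact (ih h.2).append (by rw [show 1 + (bs.length + 1) = bs.length + 2 by omega])

/-- Only the relative order of letters with consecutive values matters, and `a`, `c` are not
consecutive. -/
theorem inClass_swap (bs : List Bool) (p s : List ℕ) {a c : ℕ} (hac : a + 1 < c) :
    inClass bs (p ++ a :: c :: s) = inClass bs (p ++ c :: a :: s) := by
  induction bs generalizing p s with
  | nil =>
    -- For the empty list of signs both sides are false: the words have at least two letters.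
    rw [inClass, inClass, beq_eq_false_iff_ne.2, beq_eq_false_iff_ne.2] <;>
    · intro h
      have := congrArg List.length h
      simp at this
      omega
  | cons b bs ih =>
    rw [inClass, inClass]
    congr 1
    · congr 1
      simp only [List.filter_append, List.filter_cons, natBeq_eq_decide]
      split_ifs with h1 h2 <;> first | rfl | (simp at h1 h2; omega)
    · simp only [List.filter_append, List.filter_cons, natBeq_eq_decide]
      split_ifs
      · exact ih _ _
      all_goals rfl

/-- A Knuth move exchanges adjacent letters that have a third letter of the window strictly between
them in value, so they differ by at least 2. -/
theorem inClass_move_false (bs : List Bool) {w : List ℕ} (hw : w.Nodup) {k : ℕ}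
    (h : adm k w = true) : inClass bs (move false k w) = inClass bs w := by
  obtain ⟨v, x, y, z, t, rfl, rfl, h0⟩ := exists_of_adm h
  have hd : x ≠ y ∧ x ≠ z ∧ y ≠ z := by
    have := hw.of_append_right
    simp only [List.nodup_cons, List.mem_cons, not_or] at this
    exact ⟨this.1.1, this.1.2.1, this.2.1.1⟩
  rw [move_length_append, move_zero_cons, if_neg Bool.false_ne_true, if_neg Bool.false_ne_true]
  simp only [bne_iff_ne, ne_eq, decide_eq_decide] at h0
  have key : ∀ (p s : List ℕ) (a c : ℕ), a + 1 < c ∨ c + 1 < a →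
      inClass bs (p ++ a :: c :: s) = inClass bs (p ++ c :: a :: s) := by
    rintro p s a c (h | h)
    exacts [inClass_swap bs p s h, (inClass_swap bs p s h).symm]
  split_ifs with h1
  · have := key (v ++ [x]) t z y (by omega)
    simpa using this
  · exact key v (z :: t) y x (by omega)

theorem mem_insertionSites {b : Bool} {p L q : ℕ} (hp : p < L) :
    q ∈ insertionSites b p L ↔ if b then q ≤ p else p < q ∧ q ≤ L := by
  cases b
  · simp only [insertionSites, cond_false, List.mem_map, List.mem_range, Bool.false_eq_true,
      if_false]
    constructor
    · rintro ⟨i, hi, rfl⟩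
      omega
    · rintro ⟨h1, h2⟩
      exact ⟨q - (p + 1), by omega, by omega⟩
  · simp [insertionSites]

/-- The only new condition is that the new largest letter is on the prescribed side of the previous
one; removing it restores the old word. -/
theorem inClass_insert_iff {b : Bool} {bs : List Bool} {a c : List ℕ}
    (hu : inClass bs (a ++ c) = true) :
    inClass (b :: bs) (a ++ (bs.length + 2) :: c) = true ↔
      a.length ∈ insertionSites b ((a ++ c).idxOf (bs.length + 1)) (bs.length + 1) := by
  have hperm := perm_of_inClass hu
  have hnodup : (a ++ c).Nodup := hperm.nodup_iff.2 (List.nodup_range' (step := 1))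
  have hmem : ∀ x, x ∈ a ++ c ↔ 1 ≤ x ∧ x < 1 + (bs.length + 1) := fun x => by
    rw [hperm.mem_iff, List.mem_range'_1]
  have hm : bs.length + 2 ∉ a ++ c := by
    rw [hmem]
    omega
  have hn : bs.length + 1 ∈ a ++ c := by
    rw [hmem]
    omega
  have hlen : (a ++ c).length = bs.length + 1 := by rw [hperm.length_eq, List.length_range']
  have hidx : (a ++ c).idxOf (bs.length + 1) < bs.length + 1 := by
    have := List.idxOf_lt_length_iff.2 hn
    omega
  have hfilter : ((a ++ (bs.length + 2) :: c).filter fun z => !Nat.beq z (bs.length + 2)) = a ++ c := by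
    rw [List.filter_append, List.filter_cons, if_neg (by simp),
      ← List.filter_append]
    refine List.filter_eq_self.2 fun x hx => ?_
    rw [natBeq_eq_decide]
    have : x ≠ bs.length + 2 := by rintro rfl; exact hm hx
    simp [this]
  have hpair : ∀ l : List ℕ, bs.length + 2 ∉ l →
      (l.filter fun z => Nat.beq z (bs.length + 1) || Nat.beq z (bs.length + 2)) =
        l.filter fun z => Nat.beq z (bs.length + 1) := by
    intro l hl
    refine List.filter_congr fun x hx => ?_
    have : x ≠ bs.length + 2 := by rintro rfl; exact hl hx
    simp [natBeq_eq_decide, this]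
  have hma : bs.length + 2 ∉ a := fun h => hm (List.mem_append_left _ h)
  have hmc : bs.length + 2 ∉ c := fun h => hm (List.mem_append_right _ h)
  have hempty : ∀ l : List ℕ, bs.length + 1 ∉ l →
      (l.filter fun z => Nat.beq z (bs.length + 1)) = [] := by
    intro l hl
    refine List.filter_eq_nil_iff.2 fun x hx h => hl ?_
    rw [Nat.beq_eq] at h
    rwa [← h]
  rw [inClass, hfilter, hu, Bool.and_true, beq_iff_eq, mem_insertionSites hidx, List.filter_append,
    List.filter_cons, if_pos (by simp [natBeq_eq_decide]), hpair a hma, hpair c hmc]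
  have htake : bs.length + 1 ∈ a ↔ (a ++ c).idxOf (bs.length + 1) < a.length := by
    rw [← List.mem_take_iff_idxOf_lt hn, List.take_left]
  have hal : a.length ≤ bs.length + 1 := by
    rw [← hlen, List.length_append]
    omega
  rw [List.nodup_append'] at hnodup
  by_cases h1 : bs.length + 1 ∈ a
  · have h2 : bs.length + 1 ∉ c := fun h => hnodup.2.2 h1 h
    rw [filter_natBeq_eq hnodup.1 h1, hempty c h2]
    rw [htake] at h1
    cases b
    · simp
      omega
    · simp
      omega
  · have h2 : bs.length + 1 ∈ c := (List.mem_append.1 hn).resolve_left h1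
    rw [filter_natBeq_eq hnodup.2.1 h2, hempty a h1]
    rw [htake] at h1
    cases b
    · simp
      omega
    · simp
      omega

theorem mem_classWords {bs : List Bool} {w : List ℕ} :
    w ∈ classWords bs ↔ inClass bs w = true := by
  induction bs generalizing w with
  | nil => simp [classWords, inClass]
  | cons b bs ih =>
    rw [classWords, List.mem_flatMap]
    constructor
    · rintro ⟨u, hu, hw⟩
      obtain ⟨q, hq, rfl⟩ := List.mem_map.1 hw
      rw [ih] at hu
      have hlen := (perm_of_inClass hu).length_eq
      rw [List.length_range'] at hlen
      have hidx : u.idxOf (bs.length + 1) < bs.length + 1 := by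
        rw [← hlen]
        refine List.idxOf_lt_length_iff.2 ((perm_of_inClass hu).mem_iff.2 ?_)
        rw [List.mem_range'_1]
        omega
      have hql : q ≤ u.length := by
        rw [mem_insertionSites hidx] at hq
        split_ifs at hq <;> omega
      rw [inClass_insert_iff (by rwa [List.take_append_drop]), List.take_append_drop,
        List.length_take_of_le hql]
      exact hq
    · intro hw
      have h1 := hw
      rw [inClass, Bool.and_eq_true] at h1
      have hperm := perm_of_inClass hw
      have hm : bs.length + 2 ∈ w := hperm.mem_iff.2 (by
        rw [List.mem_range'_1, List.length_cons]
        omega)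
      obtain ⟨a, c, rfl⟩ := List.mem_iff_append.1 hm
      have hnodup := hperm.nodup_iff.2 (List.nodup_range' (step := 1))
      rw [List.nodup_middle, List.nodup_cons] at hnodup
      have h2 : ((a ++ (bs.length + 2) :: c).filter fun z => !Nat.beq z (bs.length + 2)) =
          a ++ c := by
        rw [List.filter_append, List.filter_cons, if_neg (by simp),
          ← List.filter_append]
        refine List.filter_eq_self.2 fun x hx => ?_
        rw [natBeq_eq_decide]
        have : x ≠ bs.length + 2 := by rintro rfl; exact hnodup.1 hx
        simp [this]
      rw [h2] at h1
      exact ⟨a ++ c, ih.2 h1.2, List.mem_map.2 ⟨a.length, (inClass_insert_iff h1.2).1 hw, by simp⟩⟩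

/-- A new largest letter is preceded by an ascent and followed by a descent, if it has neighbors
there; other descents are kept or shifted. So the new mask depends only on the old one, on `q` and
on the length. -/
theorem desMask_insert {m : ℕ} (u : List ℕ) (hu : ∀ x ∈ u, x < m) {q : ℕ} (hq : q ≤ u.length) :
    desMask (u.take q ++ m :: u.drop q) = insertMask q u.length (desMask u) := by
  have hhalf : ∀ (x : ℕ) (t : List ℕ), desMask (x :: t) / 2 = desMask t := by
    intro x t
    match t with
    | [] => simp [desMask]
    | y :: t =>
      rw [desMask]
      cases Nat.blt y x
      · rw [cond_false, Nat.mul_div_cancel_left _ (by norm_num)]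
      · rw [cond_true]
        omega
  have hzero : ∀ u : List ℕ, (∀ x ∈ u, x < m) →
      desMask (m :: u) = insertMask 0 u.length (desMask u) := by
    intro u hu
    match u with
    | [] => rfl
    | x :: t =>
      rw [desMask, insertMask, blt_eq_decide, decide_eq_true (hu x (by simp)), cond_true,
        List.length_cons, blt_eq_decide, decide_eq_true (by omega), cond_true]
  induction q generalizing u with
  | zero => simpa using hzero u hu
  | succ q ih =>
    match u, hu, hq with
    | x :: t, hu, hq =>
      have ht : ∀ y ∈ t, y < m := fun y hy => hu y (List.mem_cons_of_mem _ hy)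
      rw [List.take_succ_cons, List.drop_succ_cons, List.cons_append, List.length_cons]
      cases q with
      | zero =>
        have := hu x (by simp)
        rw [insertMask, hhalf, List.take_zero, List.nil_append, List.drop_zero, desMask,
          blt_eq_decide, decide_eq_false (by omega), cond_false, hzero t ht, Nat.add_sub_cancel]
      | succ q =>
        have h1 := ih t ht (by simpa using hq)
        match t, ht, hq, h1 with
        | y :: t, ht, hq, h1 =>
          rw [insertMask, hhalf, Nat.add_sub_cancel, ← h1, List.take_succ_cons, List.cons_append]
          rw [desMask, desMask, blt_eq_decide]
          cases decide (y < x)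
          · simp
          · simp
            omega

/-- The position of the largest letter and the descents evolve without reference to the word, so
descent sets of a class are counted without enumerating its words. -/
theorem map_classWords (bs : List Bool) :
    ((classWords bs).map fun w => (w.idxOf (bs.length + 1), desMask w)) = classStates bs := by
  induction bs with
  | nil => rfl
  | cons b bs ih =>
    rw [classWords, classStates, ← ih, List.map_flatMap, List.flatMap_map]
    refine List.flatMap_congr fun u hu => ?_
    rw [List.map_map]
    have hperm := perm_of_inClass (mem_classWords.1 hu)
    have hlen := hperm.length_eq
    rw [List.length_range'] at hlen
    have hidx : u.idxOf (bs.length + 1) < bs.length + 1 := by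
      rw [← hlen]
      refine List.idxOf_lt_length_iff.2 (hperm.mem_iff.2 ?_)
      rw [List.mem_range'_1]
      omega
    have hlt : ∀ x ∈ u, x < bs.length + 2 := fun x hx => by
      rw [hperm.mem_iff, List.mem_range'_1] at hx
      omega
    refine List.map_congr_left fun q hq => ?_
    have hql : q ≤ u.length := by
      rw [mem_insertionSites hidx] at hq
      split_ifs at hq <;> omega
    rw [Function.comp_apply, desMask_insert u hlt hql, hlen, List.length_cons,
      List.idxOf_append_of_notMem fun h => absurd (hlt _ (List.mem_of_mem_take h)) (lt_irrefl _),
      List.idxOf_cons_self, List.length_take_of_le hql, add_zero]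

/-- Deleting the largest letter recovers the smaller word, and its position recovers the place of
insertion. -/
theorem nodup_classWords (bs : List Bool) : (classWords bs).Nodup := by
  induction bs with
  | nil => simp [classWords]
  | cons b bs ih =>
    have hfilter : ∀ u ∈ classWords bs, ∀ q, ((u.take q ++ (bs.length + 2) :: u.drop q).filter
        fun z => !Nat.beq z (bs.length + 2)) = u := by
      intro u hu q
      rw [List.filter_append, List.filter_cons, if_neg (by simp),
        ← List.filter_append, List.take_append_drop]
      refine List.filter_eq_self.2 fun x hx => ?_
      rw [(perm_of_inClass (mem_classWords.1 hu)).mem_iff, List.mem_range'_1] at hx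
      rw [natBeq_eq_decide, decide_eq_false (by omega)]
      rfl
    rw [classWords, List.nodup_flatMap]
    constructor
    · intro u hu
      have hperm := perm_of_inClass (mem_classWords.1 hu)
      have hlen := hperm.length_eq
      rw [List.length_range'] at hlen
      have hidx : u.idxOf (bs.length + 1) < bs.length + 1 := by
        rw [← hlen]
        refine List.idxOf_lt_length_iff.2 (hperm.mem_iff.2 ?_)
        rw [List.mem_range'_1]
        omega
      refine (List.nodup_map_iff_inj_on ?_).2 fun q hq q' hq' h => ?_
      · unfold insertionSites
        cases b
        · exact List.nodup_range.map fun _ _ h => by omega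
        · exact List.nodup_range
      · have h1 : ∀ q, q ≤ u.length →
            (u.take q ++ (bs.length + 2) :: u.drop q).idxOf (bs.length + 2) = q := by
          intro q hql
          rw [List.idxOf_append_of_notMem, List.idxOf_cons_self,
            List.length_take_of_le hql, add_zero]
          intro h
          have := List.mem_of_mem_take h
          rw [hperm.mem_iff, List.mem_range'_1] at this
          omega
        rw [mem_insertionSites hidx] at hq hq'
        rw [← h1 q (by split_ifs at hq <;> omega), h, h1 q' (by split_ifs at hq' <;> omega)]
    · refine List.Pairwise.imp_of_mem ?_ ih
      intro u u' hu hu' hne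
      rw [Function.onFun, List.disjoint_left]
      intro w hw hw'
      obtain ⟨q, -, rfl⟩ := List.mem_map.1 hw
      obtain ⟨q', -, h⟩ := List.mem_map.1 hw'
      exact hne (by rw [← hfilter u hu q, ← h, hfilter u' hu' q'])

theorem eq_of_inClass {bs bs' : List Bool} (hl : bs.length = bs'.length) {w : List ℕ}
    (h : inClass bs w = true) (h' : inClass bs' w = true) : bs = bs' := by
  induction bs generalizing bs' w with
  | nil => exact (List.eq_nil_of_length_eq_zero hl.symm).symm
  | cons b bs ih =>
    match bs', hl with
    | b' :: bs', hl =>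
      have hl : bs.length = bs'.length := by simpa using hl
      rw [inClass, Bool.and_eq_true, beq_iff_eq] at h h'
      rw [← hl] at h'
      rw [ih hl h.2 h'.2]
      have := h.1.symm.trans h'.1
      cases b <;> cases b' <;> simp at this <;> rfl

/-! ### Local checks along moves -/

/-- The neighbor of a word in the direction `k`. -/
def nb (rot : List ℕ → ℕ → Bool) (k : ℕ) (w : List ℕ) : List ℕ := move (rot w k) k w

/-- The words on the path from `w`, without `w`, whose steps are alternatingly in the directions `a`
and `b`. -/
def walk (rot : List ℕ → ℕ → Bool) : ℕ → ℕ → ℕ → List ℕ → List (List ℕ)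
  | 0, _, _, _ => []
  | n + 1, a, b, w => bif adm a w then nb rot a w :: walk rot n b a (nb rot a w) else []

/-- The path through `w` whose steps are in the directions `l` and `l + 1`. -/
def string (rot : List ℕ → ℕ → Bool) (l : ℕ) (w : List ℕ) : List (List ℕ) :=
  w :: (walk rot 6 l (l + 1) w ++ walk rot 6 (l + 1) l w)

/-- The list `s` is closed under steps in the directions `l` and `l + 1`. -/
def isClosed (rot : List ℕ → ℕ → Bool) (l : ℕ) (s : List (List ℕ)) : Bool :=
  s.all fun z => (!adm l z || s.elem (nb rot l z)) &&
    (!adm (l + 1) z || s.elem (nb rot (l + 1) z))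

/-- The word and its neighbor in the direction `l + 2` have neighbors in the direction `l`. -/
def linked (rot : List ℕ → ℕ → Bool) (l : ℕ) (w : List ℕ) : Bool :=
  adm l w && adm (l + 2) w && adm l (nb rot (l + 2) w)

/-- The condition of a weak flat step on its end. -/
def flatEnd (rot : List ℕ → ℕ → Bool) (l : ℕ) (z : List ℕ) : Bool :=
  !(adm (l + 1) (nb rot l z) && (desc (nb rot l z) (l + 2) != desc z (l + 2)))

/-- A check on all weak flat chains in which `a`, `nb rot (l + 2) a` are neither the first nor the
last two words. -/
def chainCheck (rot : List ℕ → ℕ → Bool) (l : ℕ) (W₁ W₂ : List ℕ → Bool) (a : List ℕ) : Bool :=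
  !(W₁ a && linked rot l a && flatEnd rot l a) ||
  (isClosed rot l (string rot l a) && (string rot l a).all fun y =>
    y == a || y == nb rot (l + 2) a || !linked rot l y ||
    (isClosed rot l (string rot l (nb rot (l + 2) a)) &&
      (string rot l (nb rot (l + 2) a)).all fun z =>
        [a, nb rot (l + 2) a, y, nb rot (l + 2) y].elem z || !(linked rot l z && flatEnd rot l z) ||
        (W₂ z && isClosed rot l (string rot l (nb rot (l + 2) z)) &&
          (string rot l (nb rot (l + 2) z)).all fun v =>
            [a, nb rot (l + 2) a, y, nb rot (l + 2) y, z, nb rot (l + 2) z].elem v ||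
            !(linked rot l v && flatEnd rot l v))))

/-- The word has type W in the direction `l + 3`. -/
def typeW (rot : List ℕ → ℕ → Bool) (l : ℕ) (w : List ℕ) : Bool :=
  adm (l + 3) w && (adm (l + 2) w && (desc w (l + 4) != desc (nb rot (l + 2) w) (l + 4)))

/-- A check for the equality of the generating functions of two components of degree 4. -/
def componentCheck (rot : List ℕ → ℕ → Bool) (l : ℕ) (w : List ℕ) : Bool :=
  !(rot w (l + 1) && adm (l + 1) w && (desc w l != desc (nb rot (l + 1) w) l) &&
    (desc w (l + 3) != desc (nb rot (l + 1) w) (l + 3)) &&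
    !(adm (l + 2) w && nb rot (l + 1) w == nb rot (l + 2) w)) ||
  (isClosed rot l (string rot l w) && isClosed rot (l + 1) (string rot (l + 1) w) &&
    decide (string rot l w).Nodup && decide (string rot (l + 1) w).Nodup &&
    ((string rot l w).map fun u => desMask (u.drop l) % 8).isPerm
      ((string rot (l + 1) w).map fun u => desMask (u.drop (l + 1)) % 8))

/-! ### Labelled prefix trees -/

/-- A prefix tree of words, each word labelled by a natural number. -/
inductive WordTrie where
  | nil : WordTrie
  | leaf (label : ℕ) : WordTrie
  | cons (letter : ℕ) (child sibling : WordTrie) : WordTrie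

namespace WordTrie

/-- The label of a word. -/
def look : WordTrie → List ℕ → Option ℕ
  | leaf c, [] => some c
  | cons a t s, b :: w => bif Nat.beq a b then look t w else look s (b :: w)
  | _, _ => none

/-- The tree of a single word. -/
def single (c : ℕ) : List ℕ → WordTrie
  | [] => leaf c
  | a :: w => cons a (single c w) nil

/-- Add a word with the label `c`. -/
def insert (c : ℕ) : WordTrie → List ℕ → WordTrie
  | nil, w => single c w
  | cons a t s, b :: w =>
      bif Nat.beq a b then cons a (insert c t w) s else cons a t (insert c s (b :: w))
  | T, _ => T

/-- The words in the tree with their labels. -/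
def entries : WordTrie → List (List ℕ × ℕ)
  | nil => []
  | leaf c => [([], c)]
  | cons a t s => (entries t).map (fun p => (a :: p.1, p.2)) ++ entries s

/-- Evaluate a tree before a function is applied to it. -/
def force {β : Sort*} : WordTrie → (WordTrie → β) → β
  | nil, f => f nil
  | leaf c, f => f (leaf c)
  | cons a t s, f => force t fun t' => force s fun s' => f (cons a t' s')

theorem force_eq {β : Sort*} (T : WordTrie) (f : WordTrie → β) : T.force f = f T := by
  induction T generalizing f with
  | nil => rfl
  | leaf c => rfl
  | cons a t s iht ihs => rw [force, iht, ihs]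

theorem mem_entries_of_look {T : WordTrie} {w : List ℕ} {c : ℕ} (h : T.look w = some c) :
    (w, c) ∈ T.entries := by
  induction T generalizing w with
  | nil => simp [look] at h
  | leaf d =>
    match w with
    | [] => simp [look] at h; simp [entries, h]
    | _ :: _ => simp [look] at h
  | cons a t s iht ihs =>
    match w with
    | [] => simp [look] at h
    | b :: w =>
      rw [look] at h
      rw [entries, List.mem_append]
      by_cases hab : a = b
      · subst hab
        rw [natBeq_eq_decide, decide_eq_true rfl, cond_true] at h
        exact .inl (List.mem_map.2 ⟨(w, c), iht h, rfl⟩)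
      · rw [natBeq_eq_decide, decide_eq_false hab, cond_false] at h
        exact .inr (ihs h)

end WordTrie

/-! ### The data -/

/-- The digits of a number with eight digits. -/
def digits8 (n : ℕ) : List ℕ :=
  [n / 10000000 % 10, n / 1000000 % 10, n / 100000 % 10, n / 10000 % 10, n / 1000 % 10,
    n / 100 % 10, n / 10 % 10, n % 10]

/-- The words of the exceptional component; the bit `k` of the label of `w` is set if the
neighbor of `w` in the direction `k` is its rotation neighbor. -/
def coreData : List (ℕ × ℕ) := [
  (32187654, 0), (32817654, 0), (32871654, 16), (32875164, 48), (32875416, 32), (38217654, 0),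
  (38271654, 16), (38275164, 52), (38275416, 36), (38521764, 1), (38527164, 37), (38527416, 45),
  (38542176, 1), (38542716, 9), (53276481, 32), (53276814, 48), (53276841, 0), (53278164, 24),
  (53278614, 0), (53278641, 0), (53281764, 12), (53287164, 32), (53287416, 32), (53726481, 32),
  (53726814, 48), (53726841, 0), (53728164, 24), (53728614, 0), (53728641, 0), (53762481, 32),
  (53762814, 48), (53762841, 0), (53768124, 24), (53768214, 0), (53768241, 0), (53781264, 12),
  (53781624, 12), (53782164, 0), (53782614, 0), (53782641, 0), (53786124, 0), (53786214, 0),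
  (53786241, 0), (53812764, 6), (53817264, 6), (53817624, 6), (53821764, 1), (53827164, 33),
  (53827416, 41), (53842176, 3), (53842716, 11), (53871264, 0), (53871624, 0), (53876124, 0),
  (54321876, 0), (54328176, 0), (54328716, 0), (54382176, 2), (54382716, 2), (57326481, 32),
  (57326814, 48), (57326841, 0), (57328164, 24), (57328614, 0), (57328641, 0), (57362481, 32),
  (57362814, 48), (57362841, 0), (57368124, 24), (57368214, 0), (57368241, 0), (57381264, 12),
  (57381624, 12), (57382164, 0), (57382614, 0), (57382641, 0), (57386124, 0), (57386214, 0),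
  (57386241, 0), (57813264, 6), (57813624, 6), (57831264, 0), (57831624, 0), (57832164, 0),
  (57832614, 0), (57832641, 0), (57836124, 0), (57836214, 0), (57836241, 0), (58132764, 3),
  (58137264, 3), (58137624, 3), (58173264, 3), (58173624, 3), (58312764, 0), (58317264, 0),
  (58317624, 0), (58371264, 0), (58371624, 0), (58376124, 0), (58713264, 0), (58713624, 0),
  (58731264, 0), (58731624, 0), (58736124, 0), (81532764, 1), (81537264, 1), (81537624, 1),
  (81573264, 1), (81573624, 1), (85132764, 0), (85137264, 0), (85137624, 0), (85173264, 0),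
  (85173624, 0), (85312764, 0), (85317264, 0), (85317624, 0), (85371264, 0), (85371624, 0),
  (85376124, 0), (85713264, 0), (85713624, 0), (85731264, 0), (85731624, 0), (85736124, 0)]

/-- The words of the exceptional component in a prefix tree. -/
def coreTrie : WordTrie := coreData.foldr (fun p T => T.insert p.2 (digits8 p.1)) .nil

/-- The kinds of moves given by a labelled prefix tree. -/
def WordTrie.rot (T : WordTrie) (w : List ℕ) (k : ℕ) : Bool :=
  match T.look w with
  | some c => c.testBit k
  | none => false

/-- The binary digits of a number below `2 ^ 7`. -/
def bits7 (M : ℕ) : List Bool := [M.testBit 6, M.testBit 5, M.testBit 4, M.testBit 3, M.testBit 2,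
  M.testBit 1, M.testBit 0]

/-- The inverse descent sets of the vertices in the components without rotation edges. -/
def padClasses : List (List Bool) :=
  [0, 1, 2, 3, 4, 5, 6, 8, 9, 10, 12, 16, 17, 18, 20, 24, 32, 33, 34, 36, 40, 48, 64, 65, 66, 67, 68,
    72, 79, 80, 96, 97].map bits7

/-- The inverse descent sets of the vertices in the exceptional component. -/
def coreClasses : List (List Bool) := [111, 123, 43, 107, 42, 106].map bits7

/-- The words in the components without rotation edges. -/
def padWords : List (List ℕ) := padClasses.flatMap classWords

/-- The words of the exceptional component. -/
def coreWords : List (List ℕ) := coreTrie.entries.map Prod.fst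

/-- A check that a labelled word belongs to an exceptional class, and that its neighbors are in the
tree, with the same kinds of moves in the same direction and in the directions far from it. -/
def edgeCheck (T : WordTrie) (p : List ℕ × ℕ) : Bool :=
  T.look p.1 == some p.2 && (coreClasses.any fun bs => inClass bs p.1) &&
  (List.range 6).all fun k => !adm k p.1 ||
    match T.look (move (p.2.testBit k) k p.1) with
    | none => false
    | some c => c.testBit k == p.2.testBit k && (List.range 6).all fun j =>
        !(Nat.ble (j + 3) k || Nat.ble (k + 3) j) || c.testBit j == p.2.testBit j

/-! ### Weak flat chains -/

namespace IsMoveSystem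

variable {n : ℕ} {S : Finset (List ℕ)} {rot : List ℕ → ℕ → Bool} {h : IsMoveSystem n S rot}

theorem typeW_iff {k : ℕ} {x y : {w : List ℕ // w ∈ h.graph.verts}}
    (hxy : (h.signed.edge (k + 2)).Adj x y) :
    h.signed.TypeW (k + 3) x ↔ adm (k + 1) x.1 = true ∧ desc x.1 (k + 2) ≠ desc y.1 (k + 2) := by
  unfold SignedColoredGraph.TypeW
  rw [admits_add_two_iff, show k + 3 - 1 = k + 2 by omega]
  refine and_congr_right fun _ => ?_
  constructor
  · rintro ⟨u, hu, hs⟩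
    rw [axiom0 _ _ _ _ hxy hu]
    exact σ_eq_neg_σ_iff.1 hs
  · exact fun hd => ⟨y, hxy, σ_eq_neg_σ_iff.2 hd⟩

/-- An edge of color `k + 2` flips the sign with index `k + 2`. If the sign with index `k + 3` flips
too, the two remain opposite, so the other end also admits a neighbor of color `k + 3`. -/
theorem typeW_iff_of_adj {k : ℕ} {x y : {w : List ℕ // w ∈ h.graph.verts}}
    (hxy : (h.signed.edge (k + 2)).Adj x y) (hk : k + 3 < n) :
    h.signed.TypeW (k + 3) x ↔ h.signed.TypeW (k + 3) y := by
  obtain ⟨h1, h2⟩ := adj_add_two_iff.1 hxy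
  have h3 := (desc_move h1 (nodup x) (rot x.1 k)).2
  rw [← h2] at h3
  rw [typeW_iff hxy, typeW_iff hxy.symm, adm_iff (by rw [length]; omega),
    adm_iff (by rw [length]; omega), h3, show k + 1 + 1 = k + 2 by omega]
  cases desc x.1 (k + 1) <;> cases desc x.1 (k + 2) <;> cases desc y.1 (k + 2) <;> simp

/-- A model, by words with moves of kinds `rot'` in the directions `l'`, `l' + 1`, `l' + 2`, of the
edges in the directions `l`, `l + 1`, `l + 2` between the vertices in `A`. -/
structure IsLocalModel (h : IsMoveSystem n S rot) (l : ℕ) (A : Set {w : List ℕ // w ∈ h.graph.verts})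
    (R : {w : List ℕ // w ∈ h.graph.verts} → {w : List ℕ // w ∈ h.graph.verts} → Prop)
    (φ : {w : List ℕ // w ∈ h.graph.verts} → List ℕ) (rot' : List ℕ → ℕ → Bool) (l' : ℕ) :
    Prop where
  adm_eq : ∀ x ∈ A, ∀ t ≤ 2, adm (l' + t) (φ x) = adm (l + t) x.1
  of_adj : ∀ x ∈ A, ∀ t ≤ 2, ∀ y, (h.signed.edge (l + t + 2)).Adj x y →
    y ∈ A ∧ φ y = nb rot' (l' + t) (φ x) ∧ R x y
  desc_eq : ∀ x ∈ A, desc (φ x) (l' + 2) = desc x.1 (l + 2)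
  equivalence : Equivalence R
  inj : ∀ x ∈ A, ∀ y ∈ A, R x y → φ x = φ y → x = y

namespace IsLocalModel

variable {l : ℕ} {A : Set {w : List ℕ // w ∈ h.graph.verts}}
  {R : {w : List ℕ // w ∈ h.graph.verts} → {w : List ℕ // w ∈ h.graph.verts} → Prop}
  {φ : {w : List ℕ // w ∈ h.graph.verts} → List ℕ} {rot' : List ℕ → ℕ → Bool} {l' : ℕ}

/-- A list of model words that is closed under two directions and meets the image of a component
contains the whole image. Thus finite paths computed in the model capture all possible weak flat
steps. -/
theorem of_reachable (M : IsLocalModel h l A R φ rot' l') {x y : {w : List ℕ // w ∈ h.graph.verts}}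
    (hx : x ∈ A) (hxy : (h.signed.edge (l + 2) ⊔ h.signed.edge (l + 3)).Reachable x y) :
    y ∈ A ∧ R x y ∧ ∀ s, isClosed rot' l' s = true → φ x ∈ s → φ y ∈ s := by
  rw [SimpleGraph.reachable_iff_reflTransGen] at hxy
  induction hxy with
  | refl => exact ⟨hx, M.equivalence.refl _, fun _ _ hs => hs⟩
  | @tail u z _ huz ih =>
    obtain ⟨h1, h2, h3⟩ := ih
    have key : ∀ t ≤ 1, (h.signed.edge (l + t + 2)).Adj u z →
        z ∈ A ∧ R x z ∧ ∀ s, isClosed rot' l' s = true → φ x ∈ s → φ z ∈ s := by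
      intro t ht huz
      obtain ⟨h4, h5, h6⟩ := M.of_adj u h1 t (by omega) z huz
      refine ⟨h4, M.equivalence.trans h2 h6, fun s hs hxs => ?_⟩
      have h7 := List.all_eq_true.1 hs _ (h3 s hs hxs)
      have h8 := (adj_add_two_iff.1 huz).1
      rw [← M.adm_eq u h1 t (by omega)] at h8
      rw [Bool.and_eq_true] at h7
      have h9 : t = 0 ∨ t = 1 := by omega
      rcases h9 with rfl | rfl
      · have h10 := h7.1
        rw [add_zero] at h8 h5
        rw [h8, ← h5] at h10
        simpa using h10
      · have h10 := h7.2
        rw [h8, ← h5] at h10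
        simpa using h10
    rcases huz with h4 | h4
    · exact key 0 (by omega) h4
    · exact key 1 (by omega) h4

theorem linked_eq_true (M : IsLocalModel h l A R φ rot' l')
    {x y : {w : List ℕ // w ∈ h.graph.verts}} (hx : x ∈ A) (hxy : (h.signed.edge (l + 4)).Adj x y)
    (h1 : h.signed.Admits (l + 2) x) (h2 : h.signed.Admits (l + 2) y) :
    linked rot' l' (φ x) = true := by
  obtain ⟨hy, h3, -⟩ := M.of_adj x hx 2 le_rfl y hxy
  have h4 := M.adm_eq x hx 0 (by omega)
  have h5 := M.adm_eq y hy 0 (by omega)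
  rw [admits_add_two_iff] at h1 h2
  rw [linked, ← h3, M.adm_eq x hx 2 le_rfl, (adj_add_two_iff (k := l + 2).1 hxy).1]
  simp only [add_zero] at h4 h5
  rw [h4, h5, h1, h2]
  rfl

theorem flatEnd_eq_true (M : IsLocalModel h l A R φ rot' l')
    {z u : {w : List ℕ // w ∈ h.graph.verts}} (hz : z ∈ A) (hzu : (h.signed.edge (l + 2)).Adj z u)
    (hu : ¬ h.signed.TypeW (l + 3) u) : flatEnd rot' l' (φ z) = true := by
  obtain ⟨hu', h3, -⟩ := M.of_adj z hz 0 (by omega) u hzu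
  rw [add_zero] at h3
  rw [typeW_iff hzu.symm] at hu
  rw [flatEnd, ← h3, M.adm_eq u hu' 1 (by omega), M.desc_eq u hu', M.desc_eq z hz]
  by_contra hc
  refine hu ?_
  simpa using hc

/-- The check at a vertex `a` of type W inside the chain retraces the chain: for each possible
predecessor `y` of `a` and each possible next pair starting with `z`, the vertex `z` has type W and
no pair can follow it. So the pair after `a` is the last one, and everything from `a` on has type W.
If `W₂` is never true, the check excludes such chains altogether. Distinctness in the model follows
from injectivity along the relation `R`. -/
theorem chainCondition (M : IsLocalModel h l A R φ rot' l') (hl : l + 5 < n)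
    {W₁ W₂ : List ℕ → Bool} (hW₁ : ∀ x ∈ A, h.signed.TypeW (l + 5) x → W₁ (φ x) = true)
    (hW₂ : ∀ x ∈ A, W₂ (φ x) = true → h.signed.TypeW (l + 5) x)
    (hcheck : ∀ x ∈ A, chainCheck rot' l' W₁ W₂ (φ x) = true) {m : ℕ}
    {x : ℕ → {w : List ℕ // w ∈ h.graph.verts}} (hx : h.signed.WeakFlatChain (l + 4) m x)
    (hA : x 1 ∈ A) : h.signed.ChainCondition (l + 4) m x := by
  obtain ⟨hinj, hadm, hadj, hstep⟩ := hx
  rw [show l + 4 - 2 = l + 2 by omega] at hadm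
  have hadj' : ∀ p, p + 1 ≤ m → (h.signed.edge (l + 4)).Adj (x (2 * p + 1)) (x (2 * p + 2)) :=
    fun p hp => (hadj (p + 1) (by omega) hp).symm
  have hstep' : ∀ p, p + 2 ≤ m → h.signed.WeakFlatStep (l + 4) (x (2 * p + 2)) (x (2 * p + 3)) :=
    fun p hp => hstep (p + 1) (by omega) hp
  have hmem : ∀ p, p + 1 ≤ m → x (2 * p + 1) ∈ A ∧ x (2 * p + 2) ∈ A ∧
      R (x 1) (x (2 * p + 1)) ∧ R (x 1) (x (2 * p + 2)) := by
    intro p hp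
    induction p with
    | zero =>
      obtain ⟨h1, -, h2⟩ := M.of_adj _ hA 2 le_rfl _ (hadj' 0 hp)
      exact ⟨hA, h1, M.equivalence.refl _, h2⟩
    | succ p ih =>
      obtain ⟨-, h1, -, h2⟩ := ih (by omega)
      obtain ⟨h3, h4, -⟩ := M.of_reachable h1 (hstep' p (by omega)).1
      obtain ⟨h5, -, h6⟩ := M.of_adj _ h3 2 le_rfl _ (hadj' (p + 1) hp)
      have h7 := M.equivalence.trans h2 h4
      exact ⟨h3, h5, h7, M.equivalence.trans h7 h6⟩
  have hmemA : ∀ q, 1 ≤ q → q ≤ 2 * m → x q ∈ A ∧ R (x 1) (x q) := by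
    intro q h1 h2
    rcases Nat.even_or_odd' q with ⟨p, rfl | rfl⟩
    · obtain ⟨p, rfl⟩ : ∃ p', p = p' + 1 := ⟨p - 1, by omega⟩
      have := hmem p (by omega)
      exact ⟨this.2.1, this.2.2.2⟩
    · have := hmem p (by omega)
      exact ⟨this.1, this.2.2.1⟩
  have hne : ∀ p q, 1 ≤ p → p ≤ 2 * m → 1 ≤ q → q ≤ 2 * m → p ≠ q → φ (x p) ≠ φ (x q) := by
    intro p q h1 h2 h3 h4 hpq he
    have h5 := hmemA p h1 h2
    have h6 := hmemA q h3 h4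
    exact hpq (hinj ⟨h1, h2⟩ ⟨h3, h4⟩ (M.inj _ h5.1 _ h6.1
      (M.equivalence.trans (M.equivalence.symm h5.2) h6.2) he))
  have hlink : ∀ p, p + 1 ≤ m → linked rot' l' (φ (x (2 * p + 1))) = true ∧
      linked rot' l' (φ (x (2 * p + 2))) = true := fun p hp =>
    ⟨M.linked_eq_true (hmem p hp).1 (hadj' p hp) (hadm _ (by omega) (by omega))
      (hadm _ (by omega) (by omega)),
    M.linked_eq_true (hmem p hp).2.1 (hadj' p hp).symm (hadm _ (by omega) (by omega))
      (hadm _ (by omega) (by omega))⟩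
  have hnb : ∀ p, p + 1 ≤ m → φ (x (2 * p + 2)) = nb rot' (l' + 2) (φ (x (2 * p + 1))) ∧
      φ (x (2 * p + 1)) = nb rot' (l' + 2) (φ (x (2 * p + 2))) := fun p hp =>
    ⟨(M.of_adj _ (hmem p hp).1 2 le_rfl _ (hadj' p hp)).2.1,
      (M.of_adj _ (hmem p hp).2.1 2 le_rfl _ (hadj' p hp).symm).2.1⟩
  have hflat : ∀ p, p + 2 ≤ m → flatEnd rot' l' (φ (x (2 * p + 3))) = true := by
    intro p hp
    obtain ⟨u, h1, h2⟩ := (hstep' p hp).2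
    exact M.flatEnd_eq_true (hmem (p + 1) (by omega)).1 h1 h2
  have hself : ∀ w, w ∈ string rot' l' w := fun w => List.mem_cons_self
  have hsucc : ∀ p, p + 2 ≤ m → isClosed rot' l' (string rot' l' (φ (x (2 * p + 2)))) = true →
      φ (x (2 * p + 3)) ∈ string rot' l' (φ (x (2 * p + 2))) := fun p hp hc =>
    (M.of_reachable (hmem p (by omega)).2.1 (hstep' p hp).1).2.2 _ hc (hself _)
  have hpred : ∀ p, p + 2 ≤ m → isClosed rot' l' (string rot' l' (φ (x (2 * p + 3)))) = true →
      φ (x (2 * p + 2)) ∈ string rot' l' (φ (x (2 * p + 3))) := fun p hp hc =>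
    (M.of_reachable (hmem (p + 1) hp).1 (hstep' p hp).1.symm).2.2 _ hc (hself _)
  have hW : ∀ p, p + 1 ≤ m →
      (h.signed.TypeW (l + 5) (x (2 * p + 1)) ↔ h.signed.TypeW (l + 5) (x (2 * p + 2))) :=
    fun p hp => typeW_iff_of_adj (k := l + 2) (hadj' p hp) (by omega)
  intro j hj1 hj2 hj
  -- The pair joined by an `i`-edge that contains `x j`. It is neither the first nor the last pair,
  -- and both its members have type W.
  obtain ⟨p, hp⟩ : ∃ p, j = 2 * p + 3 ∨ j = 2 * p + 4 := ⟨(j - 3) / 2, by omega⟩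
  have hpm : p + 3 ≤ m := by omega
  have hWa : h.signed.TypeW (l + 5) (x (2 * p + 3)) := by
    rcases hp with rfl | rfl
    · exact hj
    · exact (hW (p + 1) (by omega)).2 hj
  have h0 := hcheck _ (hmem (p + 1) (by omega)).1
  have e1 := (hnb (p + 1) (by omega)).1
  have e2 := (hnb p (by omega)).2
  have e3 := (hnb (p + 2) (by omega)).1
  rw [show 2 * (p + 1) + 1 = 2 * p + 3 by omega, show 2 * (p + 1) + 2 = 2 * p + 4 by omega] at e1
  rw [show 2 * (p + 2) + 1 = 2 * p + 5 by omega, show 2 * (p + 2) + 2 = 2 * p + 6 by omega] at e3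
  have e4 := (hlink (p + 1) (by omega)).1
  rw [show 2 * (p + 1) + 1 = 2 * p + 3 by omega] at e4
  rw [show 2 * (p + 1) + 1 = 2 * p + 3 by omega, chainCheck, ← e1, hW₁ _ (hmemA _ (by omega)
    (by omega)).1 hWa, e4, hflat p (by omega)] at h0
  simp only [Bool.and_self, Bool.not_true, Bool.false_or, Bool.and_eq_true, List.all_eq_true] at h0
  -- The predecessor is the start of a step, so only `linked`, not `flatEnd`, is available for it;
  -- the steps end at vertices of odd index.
  have h1 := h0.2 _ (hpred p (by omega) h0.1)
  have n1 := beq_eq_false_iff_ne.2 (hne (2 * p + 2) (2 * p + 3) (by omega) (by omega) (by omega)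
    (by omega) (by omega))
  have n2 := beq_eq_false_iff_ne.2 (hne (2 * p + 2) (2 * p + 4) (by omega) (by omega) (by omega)
    (by omega) (by omega))
  rw [n1, n2, (hlink p (by omega)).2, ← e2] at h1
  simp only [Bool.not_true, Bool.false_or, Bool.and_eq_true, List.all_eq_true] at h1
  have h2 := h1.2 _ (hsucc (p + 1) (by omega) h1.1)
  have n3 : [φ (x (2 * p + 3)), φ (x (2 * p + 4)), φ (x (2 * p + 2)), φ (x (2 * p + 1))].elem
      (φ (x (2 * p + 5))) = false := by
    rw [List.elem_eq_mem, decide_eq_false_iff_not]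
    simp only [List.mem_cons, List.not_mem_nil, or_false, not_or]
    refine ⟨?_, ?_, ?_, ?_⟩ <;> exact hne _ _ (by omega) (by omega) (by omega) (by omega) (by omega)
  have h3 := (hlink (p + 2) (by omega)).1
  have h4 := hflat (p + 1) (by omega)
  rw [show 2 * (p + 1) + 3 = 2 * p + 5 by omega] at h2 h4
  rw [show 2 * (p + 2) + 1 = 2 * p + 5 by omega] at h3
  rw [n3, h3, h4, ← e3] at h2
  simp only [Bool.and_self, Bool.not_true, Bool.false_or, Bool.and_eq_true, List.all_eq_true] at h2
  have hWz := hW₂ _ (hmemA (2 * p + 5) (by omega) (by omega)).1 h2.1.1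
  -- A further pair would begin with a vertex `v` that the check rules out.
  have hlast : m = p + 3 := by
    by_contra hc
    have h5 := h2.2 _ (hsucc (p + 2) (by omega) h2.1.2)
    have n4 : [φ (x (2 * p + 3)), φ (x (2 * p + 4)), φ (x (2 * p + 2)), φ (x (2 * p + 1)),
        φ (x (2 * p + 5)), φ (x (2 * p + 6))].elem (φ (x (2 * p + 7))) = false := by
      rw [List.elem_eq_mem, decide_eq_false_iff_not]
      simp only [List.mem_cons, List.not_mem_nil, or_false, not_or]
      refine ⟨?_, ?_, ?_, ?_, ?_, ?_⟩ <;>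
        exact hne _ _ (by omega) (by omega) (by omega) (by omega) (by omega)
    have h6 := (hlink (p + 3) (by omega)).1
    have h7 := hflat (p + 2) (by omega)
    rw [show 2 * (p + 2) + 3 = 2 * p + 7 by omega] at h5 h7
    rw [show 2 * (p + 3) + 1 = 2 * p + 7 by omega] at h6
    rw [n4, h6, h7] at h5
    simp at h5
  right
  intro q hq1 hq2
  have hq : q = 2 * p + 3 ∨ q = 2 * p + 4 ∨ q = 2 * p + 5 ∨ q = 2 * p + 6 := by omega
  rcases hq with rfl | rfl | rfl | rfl
  · exact hWa
  · exact (hW (p + 1) (by omega)).1 hWa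
  · exact hWz
  · exact (hW (p + 2) (by omega)).1 hWz

end IsLocalModel

end IsMoveSystem

/-! ### Components of degree 4 -/

theorem fundamentalQSym_congr {n : ℕ} {D D' : Set ℕ}
    (h : ∀ j, 1 ≤ j → j < n → (j ∈ D ↔ j ∈ D')) : fundamentalQSym n D = fundamentalQSym n D' := by
  funext m
  unfold fundamentalQSym
  congr 2
  congr 1
  ext s
  refine and_congr_right fun _ => and_congr_left fun _ => ?_
  refine forall_congr' fun j => forall_congr' fun hj => ?_
  rw [h (j + 1) (by omega) hj]

theorem SignedColoredGraph.componentGenFun_eq_sum {n : ℕ} {V : Type*} [Fintype V]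
    (G : SignedColoredGraph n V) {v : V} {s : Finset V}
    (hs : ∀ w, w ∈ s ↔ G.underlying.Reachable v w) :
    G.componentGenFun v = ∑ w ∈ s, fundamentalQSym n {i | G.σ w i = -1} := by
  unfold SignedColoredGraph.componentGenFun
  refine Finset.sum_congr ?_ fun _ _ => rfl
  ext w
  simp [hs]

namespace IsMoveSystem

variable {n : ℕ} {S : Finset (List ℕ)} {rot : List ℕ → ℕ → Bool} {h : IsMoveSystem n S rot}

theorem adj_restrict {k t : ℕ} (ht : t ≤ 1) {x y : {w : List ℕ // w ∈ h.graph.verts}}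
    (hxy : (h.signed.edge (k + t + 2)).Adj x y) :
    (h.signed.restrict k 4).underlying.Reachable x y :=
  SignedColoredGraph.reachable_restrict_of_adj (t := t + 2) ⟨by omega, by omega⟩
    (SimpleGraph.Reachable.refl x) hxy

theorem exists_of_mem_walk {k : ℕ} (m : ℕ) {s t : ℕ} (hs : s ≤ 1) (ht : t ≤ 1)
    (x : {w : List ℕ // w ∈ h.graph.verts}) {w : List ℕ}
    (hw : w ∈ walk rot m (k + s) (k + t) x.1) :
    ∃ y : {w : List ℕ // w ∈ h.graph.verts}, y.1 = w ∧
      (h.signed.restrict k 4).underlying.Reachable x y := by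
  induction m generalizing s t x with
  | zero => simp [walk] at hw
  | succ m ih =>
    rw [walk] at hw
    by_cases hx : adm (k + s) x.1 = true
    · rw [hx, cond_true, List.mem_cons] at hw
      have hxy : (h.signed.edge (k + s + 2)).Adj x ⟨nb rot (k + s) x.1, h.mem x.1 x.2 _ hx⟩ :=
        adj_add_two_iff.2 ⟨hx, rfl⟩
      rcases hw with rfl | hw
      · exact ⟨_, rfl, adj_restrict hs hxy⟩
      · obtain ⟨y, h1, h2⟩ := ih ht hs ⟨nb rot (k + s) x.1, h.mem x.1 x.2 _ hx⟩ hw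
        exact ⟨y, h1, (adj_restrict hs hxy).trans h2⟩
    · rw [Bool.eq_false_iff.2 hx, cond_false] at hw
      simp at hw

theorem mem_string_of_reachable {k : ℕ} {x y : {w : List ℕ // w ∈ h.graph.verts}}
    (hc : isClosed rot k (string rot k x.1) = true)
    (hxy : (h.signed.restrict k 4).underlying.Reachable x y) : y.1 ∈ string rot k x.1 := by
  rw [SimpleGraph.reachable_iff_reflTransGen] at hxy
  induction hxy with
  | refl => exact List.mem_cons_self
  | @tail u z _ huz ih =>
    rw [SignedColoredGraph.underlying, SimpleGraph.iSup_adj] at huz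
    obtain ⟨t, ht⟩ := huz
    rw [SignedColoredGraph.restrict] at ht
    dsimp only at ht
    split_ifs at ht with h1
    · have h2 := List.all_eq_true.1 hc _ ih
      rw [Bool.and_eq_true] at h2
      have h3 : t = 2 ∨ t = 3 := by omega
      rcases h3 with rfl | rfl
      · obtain ⟨h4, h5⟩ := adj_add_two_iff.1 ht
        have h6 := h2.1
        rw [h4, nb, ← h5] at h6
        simpa using h6
      · obtain ⟨h4, h5⟩ := adj_add_two_iff (k := k + 1).1 ht
        have h6 := h2.2
        rw [h4, nb, ← h5] at h6
        simpa using h6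
    · exact ht.elim

/-- A restriction of degree 4 has only two colors, so a list that is closed and consists of vertices
on the two alternating paths from `x` is the component. The reduction modulo 8 keeps the three
descents of the interval. -/
theorem componentGenFun_restrict_four {k : ℕ} {x : {w : List ℕ // w ∈ h.graph.verts}}
    (hc : isClosed rot k (string rot k x.1) = true) (hn : (string rot k x.1).Nodup) :
    (h.signed.restrict k 4).componentGenFun x =
      (((string rot k x.1).map fun u => desMask (u.drop k) % 8).map fun M =>
        fundamentalQSym 4 {j | M.testBit (j - 1) = true}).sum := by
  classical
  have h1 : ∀ y : {w : List ℕ // w ∈ h.graph.verts},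
      fundamentalQSym 4 {i | (h.signed.restrict k 4).σ y i = -1} =
        fundamentalQSym 4 {j | (desMask (y.1.drop k) % 8).testBit (j - 1) = true} := by
    intro y
    refine fundamentalQSym_congr fun j hj hj' => ?_
    obtain ⟨p, rfl⟩ : ∃ p, j = p + 1 := ⟨j - 1, by omega⟩
    change h.signed.σ y (k + p + 1) = -1 ↔ (desMask (y.1.drop k) % 2 ^ 3).testBit p = true
    rw [σ_eq, Nat.testBit_mod_two_pow, testBit_desMask, desc_drop, decide_eq_true (by omega)]
    cases desc y.1 (k + p) <;> simp
  obtain ⟨s, hs⟩ : ∃ s : Finset {w : List ℕ // w ∈ h.graph.verts}, ∀ y, y ∈ s ↔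
      (h.signed.restrict k 4).underlying.Reachable x y :=
    ⟨Finset.univ.filter fun y => (h.signed.restrict k 4).underlying.Reachable x y, by simp⟩
  rw [SignedColoredGraph.componentGenFun_eq_sum _ hs, Finset.sum_congr rfl fun y _ => h1 y, List.map_map, ← List.sum_toFinset _ hn]
  refine Finset.sum_bij (fun y _ => y.1) (fun y hy => ?_) (fun y _ y' _ hyy => Subtype.ext hyy)
    (fun w hw => ?_) (fun y _ => rfl)
  · exact List.mem_toFinset.2 (mem_string_of_reachable hc ((hs y).1 hy))
  · rw [List.mem_toFinset, string, List.mem_cons, List.mem_append] at hw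
    rcases hw with rfl | hw | hw
    · exact ⟨x, (hs x).2 (SimpleGraph.Reachable.refl x), rfl⟩
    · obtain ⟨y, rfl, hy⟩ := exists_of_mem_walk (s := 0) (t := 1) 6 (by omega) le_rfl x hw
      exact ⟨y, (hs y).2 hy, rfl⟩
    · obtain ⟨y, rfl, hy⟩ := exists_of_mem_walk (s := 1) (t := 0) 6 le_rfl (by omega) x hw
      exact ⟨y, (hs y).2 hy, rfl⟩

/-- By `knuth_desc_left_or_right`, both outer signs can change only along a rotation edge. There the
two components are listed and their descent masks compared as multisets. -/
theorem axiom4a (hcheck : ∀ x ∈ S, ∀ l, l + 4 < n → rot x (l + 1) = true →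
    componentCheck rot l x = true) : h.signed.Axiom4a := by
  intro i x y hi hin hxy hnot h1 h2
  obtain ⟨l, rfl⟩ : ∃ l, i = l + 4 := ⟨i - 4, by omega⟩
  have hxy : (h.signed.edge (l + 1 + 2)).Adj x y := hxy
  obtain ⟨h3, h4⟩ := adj_add_two_iff.1 hxy
  have h1 : ¬ h.signed.σ x (l + 1) = h.signed.σ y (l + 1) := h1
  have h2 : ¬ h.signed.σ x (l + 3 + 1) = h.signed.σ y (l + 3 + 1) := h2
  rw [σ_eq_σ_iff, h4] at h1 h2
  have hrot : rot x.1 (l + 1) = true := by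
    by_contra hc
    rw [Bool.not_eq_true] at hc
    rw [hc] at h1 h2
    rcases knuth_desc_left_or_right h3 (nodup x) with h5 | h5
    exacts [h1 h5.symm, h2 h5.symm]
  have h5 := hcheck x.1 x.2 l hin hrot
  have h6 : (adm (l + 2) x.1 && nb rot (l + 1) x.1 == nb rot (l + 2) x.1) = false := by
    rw [Bool.eq_false_iff, Ne, Bool.and_eq_true, beq_iff_eq]
    rintro ⟨h7, h8⟩
    exact hnot (adj_add_two_iff (k := l + 2).2 ⟨h7, h4.trans h8⟩)
  have h7 : (desc x.1 l != desc (nb rot (l + 1) x.1) l) = true := bne_iff_ne.2 h1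
  have h8 : (desc x.1 (l + 3) != desc (nb rot (l + 1) x.1) (l + 3)) = true := bne_iff_ne.2 h2
  rw [componentCheck, hrot, h3, h6, h7, h8] at h5
  simp only [Bool.and_self, Bool.not_false, Bool.not_true, Bool.false_or, Bool.and_eq_true,
    decide_eq_true_eq] at h5
  obtain ⟨⟨⟨⟨h9, h10⟩, h11⟩, h12⟩, h13⟩ := h5
  change (h.signed.restrict l 4).componentGenFun x =
    (h.signed.restrict (l + 1) 4).componentGenFun x
  rw [componentGenFun_restrict_four h9 h11, componentGenFun_restrict_four h10 h12]
  exact ((List.isPerm_iff.1 h13).map _).sum_eq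

end IsMoveSystem

/-! ### The vertex set -/

theorem coreTrie_edgeCheck : ∀ p ∈ coreTrie.entries, edgeCheck coreTrie p = true := by
  have h : (coreTrie.force fun T => T.entries.all (edgeCheck T)) = true := by decide +kernel
  rwa [WordTrie.force_eq, List.all_eq_true] at h

theorem coreTrie_componentCheck : ∀ p ∈ coreTrie.entries, ∀ l < 4,
    componentCheck coreTrie.rot l p.1 = true := by
  have h : (coreTrie.force fun T => T.entries.all fun p => (List.range 4).all fun l =>
    componentCheck T.rot l p.1) = true := by decide +kernel
  rw [WordTrie.force_eq, List.all_eq_true] at h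
  exact fun p hp l hl => List.all_eq_true.1 (h p hp) l (List.mem_range.2 hl)

theorem coreTrie_chainCheck : ∀ p ∈ coreTrie.entries, ∀ l < 3,
    chainCheck coreTrie.rot l (typeW coreTrie.rot l) (typeW coreTrie.rot l) p.1 = true := by
  have h : (coreTrie.force fun T => T.entries.all fun p => (List.range 3).all fun l =>
    chainCheck T.rot l (typeW T.rot l) (typeW T.rot l) p.1) = true := by decide +kernel
  rw [WordTrie.force_eq, List.all_eq_true] at h
  exact fun p hp l hl => List.all_eq_true.1 (h p hp) l (List.mem_range.2 hl)

/-- Here everything counts as type W for the hypothesis and nothing for the conclusion: with Knuth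
edges alone, no weak flat chain has three pairs. -/
theorem chainCheck_pattern : ∀ w ∈ (List.range' 1 5).permutations',
    chainCheck (fun _ _ => false) 0 (fun _ => true) (fun _ => false) w = true := by
  have h : ((List.range' 1 5).permutations'.all
    (chainCheck (fun _ _ => false) 0 (fun _ => true) (fun _ => false))) = true := by decide +kernel
  rwa [List.all_eq_true] at h

theorem length_of_mem_classes {bs : List Bool} (h : bs ∈ padClasses ++ coreClasses) :
    bs.length = 7 := by
  simp only [padClasses, coreClasses, List.mem_append, List.mem_map] at h
  rcases h with ⟨M, -, rfl⟩ | ⟨M, -, rfl⟩ <;> rfl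

/-- Makes the inverse descent classes disjoint from each other and from the exceptional words. -/
theorem nodup_classes : (padClasses ++ coreClasses).Nodup := by decide +kernel

theorem mem_padWords {w : List ℕ} : w ∈ padWords ↔ ∃ bs ∈ padClasses, inClass bs w = true := by
  simp only [padWords, List.mem_flatMap, mem_classWords]

theorem mem_coreWords {w : List ℕ} : w ∈ coreWords ↔ ∃ c, (w, c) ∈ coreTrie.entries := by
  simp [coreWords]

theorem look_of_mem_entries {p : List ℕ × ℕ} (h : p ∈ coreTrie.entries) :
    coreTrie.look p.1 = some p.2 := by
  have := coreTrie_edgeCheck p h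
  simp only [edgeCheck, Bool.and_eq_true, beq_iff_eq] at this
  exact this.1.1

theorem exists_inClass_of_mem_entries {p : List ℕ × ℕ} (h : p ∈ coreTrie.entries) :
    ∃ bs ∈ coreClasses, inClass bs p.1 = true := by
  have := coreTrie_edgeCheck p h
  simp only [edgeCheck, Bool.and_eq_true, List.any_eq_true] at this
  exact this.1.2

theorem rot_of_mem_entries {w : List ℕ} {c : ℕ} (h : (w, c) ∈ coreTrie.entries) (k : ℕ) :
    coreTrie.rot w k = c.testBit k := by
  have := look_of_mem_entries h
  dsimp only at this
  rw [WordTrie.rot, this]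

theorem perm_of_mem {w : List ℕ} (h : w ∈ padWords ∨ w ∈ coreWords) :
    w.Perm (List.range' 1 8) := by
  have key : ∃ bs ∈ padClasses ++ coreClasses, inClass bs w = true := by
    rcases h with h | h
    · obtain ⟨bs, h1, h2⟩ := mem_padWords.1 h
      exact ⟨bs, List.mem_append_left _ h1, h2⟩
    · obtain ⟨c, hc⟩ := mem_coreWords.1 h
      obtain ⟨bs, h1, h2⟩ := exists_inClass_of_mem_entries hc
      exact ⟨bs, List.mem_append_right _ h1, h2⟩
  obtain ⟨bs, h1, h2⟩ := key
  have := perm_of_inClass h2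
  rwa [length_of_mem_classes h1] at this

theorem disjoint_padWords_coreWords : padWords.Disjoint coreWords := by
  intro w h1 h2
  obtain ⟨bs, h3, h4⟩ := mem_padWords.1 h1
  obtain ⟨c, hc⟩ := mem_coreWords.1 h2
  obtain ⟨bs', h5, h6⟩ := exists_inClass_of_mem_entries hc
  have h7 := eq_of_inClass ((length_of_mem_classes (List.mem_append_left _ h3)).trans
    (length_of_mem_classes (List.mem_append_right _ h5)).symm) h4 h6
  exact (List.nodup_append'.1 nodup_classes).2.2 h3 (h7 ▸ h5)

theorem rot_of_mem_padWords {w : List ℕ} (h : w ∈ padWords) (k : ℕ) :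
    coreTrie.rot w k = false := by
  rw [WordTrie.rot]
  split
  · next c hc =>
    exact absurd (mem_coreWords.2 ⟨c, WordTrie.mem_entries_of_look hc⟩)
      (disjoint_padWords_coreWords h)
  · rfl

theorem nodup_of_mem {w : List ℕ} (h : w ∈ padWords ∨ w ∈ coreWords) : w.Nodup :=
  (perm_of_mem h).nodup_iff.2 (List.nodup_range' (step := 1))

theorem length_of_mem {w : List ℕ} (h : w ∈ padWords ∨ w ∈ coreWords) : w.length = 8 :=
  (perm_of_mem h).length_eq.trans List.length_range'

theorem move_mem_padWords {w : List ℕ} (h : w ∈ padWords) {k : ℕ} (hk : adm k w = true) :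
    move false k w ∈ padWords := by
  obtain ⟨bs, h1, h2⟩ := mem_padWords.1 h
  exact mem_padWords.2 ⟨bs, h1, by rwa [inClass_move_false bs (nodup_of_mem (.inl h)) hk]⟩

theorem move_mem_coreWords {w : List ℕ} (h : w ∈ coreWords) {k : ℕ} (hk : adm k w = true) :
    move (coreTrie.rot w k) k w ∈ coreWords ∧
      coreTrie.rot (move (coreTrie.rot w k) k w) k = coreTrie.rot w k ∧
      ∀ j < 6, j + 3 ≤ k ∨ k + 3 ≤ j →
        coreTrie.rot (move (coreTrie.rot w k) k w) j = coreTrie.rot w j := by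
  obtain ⟨c, hc⟩ := mem_coreWords.1 h
  have h1 := coreTrie_edgeCheck _ hc
  have h2 := lt_length_of_adm hk
  rw [length_of_mem (.inr h)] at h2
  simp only [edgeCheck, Bool.and_eq_true, List.all_eq_true] at h1
  have h3 := h1.2 k (List.mem_range.2 (by omega))
  rw [hk, Bool.not_true, Bool.false_or] at h3
  simp only [rot_of_mem_entries hc]
  split at h3
  · simp at h3
  · next c' hc' =>
    have h4 := WordTrie.mem_entries_of_look hc'
    simp only [rot_of_mem_entries h4, Bool.and_eq_true, beq_iff_eq, List.all_eq_true] at h3 ⊢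
    refine ⟨mem_coreWords.2 ⟨c', h4⟩, h3.1, fun j hj hjk => ?_⟩
    have h5 := h3.2 j (List.mem_range.2 hj)
    have h6 : (Nat.ble (j + 3) k || Nat.ble (k + 3) j) = true := by
      rw [Bool.or_eq_true, Nat.ble_eq, Nat.ble_eq]
      exact hjk
    rw [h6, Bool.not_true, Bool.false_or, beq_iff_eq] at h5
    exact h5

/-- The vertex set of the graph. -/
def vertexSet : Finset (List ℕ) := (padWords ++ coreWords).toFinset

theorem mem_vertexSet {w : List ℕ} : w ∈ vertexSet ↔ w ∈ padWords ∨ w ∈ coreWords := by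
  rw [vertexSet, List.mem_toFinset, List.mem_append]

theorem isMoveSystem_vertexSet : IsMoveSystem 8 vertexSet coreTrie.rot where
  word w hw := by
    rw [mem_vertexSet] at hw
    refine ⟨length_of_mem hw, nodup_of_mem hw, fun a ha => ?_⟩
    rw [(perm_of_mem hw).mem_iff, List.mem_range'_1] at ha
    omega
  mem w hw k hk := by
    rw [mem_vertexSet] at hw ⊢
    rcases hw with hw | hw
    · rw [rot_of_mem_padWords hw]
      exact .inl (move_mem_padWords hw hk)
    · exact .inr (move_mem_coreWords hw hk).1
  rot_self w hw k hk := by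
    rw [mem_vertexSet] at hw
    rcases hw with hw | hw
    · rw [rot_of_mem_padWords hw, rot_of_mem_padWords (move_mem_padWords hw hk)]
    · exact (move_mem_coreWords hw hk).2.1
  rot_far w hw j k hj hk hjk := by
    rw [mem_vertexSet] at hw
    rcases hw with hw | hw
    · rw [rot_of_mem_padWords hw, rot_of_mem_padWords hw,
        rot_of_mem_padWords (move_mem_padWords hw hj)]
    · have := lt_length_of_adm hk
      rw [length_of_mem (.inr hw)] at this
      exact (move_mem_coreWords hw hj).2.2 k (by omega) hjk.symm

theorem axiom4a_vertexSet : isMoveSystem_vertexSet.signed.Axiom4a := by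
  refine IsMoveSystem.axiom4a fun w hw l hl hrot => ?_
  rcases mem_vertexSet.1 hw with hw | hw
  · rw [rot_of_mem_padWords hw] at hrot
    exact absurd hrot Bool.false_ne_true
  · obtain ⟨c, hc⟩ := mem_coreWords.1 hw
    exact coreTrie_componentCheck _ hc l (by omega)

/-- The exceptional words are their own model, because the kind of a move there may depend on the
whole word. -/
theorem isLocalModel_core (l : ℕ) : IsMoveSystem.IsLocalModel isMoveSystem_vertexSet l
    {x | x.1 ∈ coreWords} (fun _ _ => True) Subtype.val coreTrie.rot l where
  adm_eq _ _ _ _ := rfl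
  of_adj x hx t _ y hxy := by
    obtain ⟨h1, h2⟩ := IsMoveSystem.adj_add_two_iff.1 hxy
    have hx : x.1 ∈ coreWords := hx
    have hy : y.1 ∈ coreWords := by
      rw [h2]
      exact (move_mem_coreWords hx h1).1
    exact ⟨hy, h2, trivial⟩
  desc_eq _ _ := rfl
  equivalence := ⟨fun _ => trivial, fun _ => trivial, fun _ _ => trivial⟩
  inj _ _ _ _ _ hxy := Subtype.ext hxy

/-- The three directions involve only the five letters with indices `l, …, l + 4`, and Knuth moves
depend only on their pattern. Words in one chain agree outside of this window and have the same
letters inside, so the pattern determines the word. -/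
theorem isLocalModel_pad (l : ℕ) : IsMoveSystem.IsLocalModel isMoveSystem_vertexSet l
    {x | x.1 ∈ padWords} (fun x y => x.1.take l = y.1.take l ∧ x.1.drop (l + 5) = y.1.drop (l + 5) ∧
      (window l 5 x.1).Perm (window l 5 y.1))
    (fun x => std (window l 5 x.1)) (fun _ _ => false) 0 where
  adm_eq x _ t ht := by rw [zero_add, adm_std, adm_window l (by omega)]
  of_adj x hx t ht y hxy := by
    obtain ⟨h1, h2⟩ := IsMoveSystem.adj_add_two_iff.1 hxy
    rw [rot_of_mem_padWords hx] at h2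
    have h3 : window l 5 y.1 = move false t (window l 5 x.1) := by
      rw [h2, window_move false l (by omega)]
    refine ⟨show y.1 ∈ padWords from h2 ▸ move_mem_padWords hx h1, ?_, ?_, ?_, ?_⟩
    · rw [h3, std_move, zero_add, nb]
    · have h4 := congrArg (List.take l) (take_move_self false (l + t) x.1)
      rw [List.take_take, List.take_take, Nat.min_eq_left (by omega)] at h4
      rw [h2, h4]
    · have h4 := congrArg (List.drop (2 - t)) (drop_move_self false (l + t) x.1)
      rw [List.drop_drop, List.drop_drop, show l + t + 3 + (2 - t) = l + 5 by omega] at h4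
      rw [h2, h4]
    · rw [h3]
      exact (move_perm _ _ _).symm
  desc_eq x _ := by rw [desc_std, desc_window l (by omega)]
  equivalence := ⟨fun _ => ⟨rfl, rfl, List.Perm.refl _⟩,
    fun h => ⟨h.1.symm, h.2.1.symm, h.2.2.symm⟩,
    fun h h' => ⟨h.1.trans h'.1, h.2.1.trans h'.2.1, h.2.2.trans h'.2.2⟩⟩
  inj x _ y _ hxy he := by
    have h1 := std_injective_of_perm hxy.2.2 he
    have h2 : ∀ w : List ℕ, w = w.take l ++ (window l 5 w ++ w.drop (l + 5)) := by
      intro w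
      rw [window, ← List.drop_drop, List.take_append_drop, List.take_append_drop]
    exact Subtype.ext (by rw [h2 x.1, h2 y.1, hxy.1, hxy.2.1, h1])

theorem axiom4bStrong_vertexSet : isMoveSystem_vertexSet.signed.Axiom4bStrong := by
  intro i m x hi hi' hx
  obtain ⟨l, rfl⟩ : ∃ l, i = l + 4 := ⟨i - 4, by omega⟩
  by_cases hl : l < 3
  · rcases mem_vertexSet.1 (x 1).2 with h1 | h1
    · refine (isLocalModel_pad l).chainCondition (by omega) (W₁ := fun _ => true)
        (W₂ := fun _ => false) (fun _ _ _ => rfl) (fun _ _ h => absurd h Bool.false_ne_true)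
        (fun y hy => ?_) hx h1
      refine chainCheck_pattern _ (List.mem_permutations'.2 ?_)
      have := std_perm (nodup_window (k := l) (d := 5) (nodup_of_mem (.inl hy)))
      rwa [length_window (by rw [length_of_mem (.inl hy)]; omega)] at this
    · have hW : ∀ y : {w : List ℕ // w ∈ isMoveSystem_vertexSet.graph.verts}, y.1 ∈ coreWords →
          (isMoveSystem_vertexSet.signed.TypeW (l + 5) y ↔ typeW coreTrie.rot l y.1 = true) := by
        intro y hy
        rw [typeW, Bool.and_eq_true, Bool.and_eq_true, bne_iff_ne]
        constructor
        · intro h2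
          obtain ⟨u, hu, -⟩ := h2.2
          obtain ⟨h3, h4⟩ := (IsMoveSystem.adj_add_two_iff (k := l + 2)).1 hu
          rw [IsMoveSystem.typeW_iff (k := l + 2) hu, h4] at h2
          exact ⟨h2.1, h3, h2.2⟩
        · rintro ⟨h2, h3, h4⟩
          have hu : (isMoveSystem_vertexSet.signed.edge (l + 2 + 2)).Adj y
              ⟨nb coreTrie.rot (l + 2) y.1, isMoveSystem_vertexSet.mem y.1 y.2 _ h3⟩ :=
            IsMoveSystem.adj_add_two_iff.2 ⟨h3, rfl⟩
          exact (IsMoveSystem.typeW_iff (k := l + 2) hu).2 ⟨h2, h4⟩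
      refine (isLocalModel_core l).chainCondition (by omega) (fun y hy => (hW y hy).1)
        (fun y hy => (hW y hy).2) (fun y hy => ?_) hx h1
      have hy : y.1 ∈ coreWords := hy
      obtain ⟨c, hc⟩ := mem_coreWords.1 hy
      exact coreTrie_chainCheck _ hc l hl
  -- For `i = 7`, type W in color 8 would require a move of a window extending beyond the eighth
  -- letter, so the condition is vacuous.
  · intro j _ _ hj
    have h1 := (IsMoveSystem.admits_add_two_iff (k := l + 3)).1 hj.1
    have := lt_length_of_adm h1
    rw [IsMoveSystem.length] at this
    omega

/-! ### The generating function -/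

/-- The multiplicities of the descent sets in the components without rotation edges, as the digits
of a number in base `2 ^ 16`. -/
def padHistogram : ℕ :=
  1751908410352939910508765521407080373554070477285632326475666005367894001428588932914795154659755199510505853897943748888387353314836842250921276094977465706699806235925405465734050700461131526735734299151781326570347907079211657769095854818456619319207797251255464189526263168059802603642395957014967454465431853242702193716614114319174711149239774108392490987016982508457877618806929813265656455431235948440236346501903206919946128305680380858832842736743477233700507356137819826694806460795438456943555947965671213422172629171415044048260786867679612250077236840798183364664707214623621834539009

/-- The multiplicities of the descent sets in the exceptional component, as the digits of a number
in base `2 ^ 16`. -/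
def coreHistogram : ℕ :=
  26732000877946953387764168452228617231251540665320388167369900087755517316741650395909456110944719353033759264968070426561929717175406823124028608630358505546605919301394856666353784612081326320906864981521273424620858004475889917440319307819183905676465859845243675583000718928260119952838561628964008796929199242950603394459313328017053114082781781506073804930689183164906805303065308466779000811970085398314454518248450154730111984115278237561483949127160160777692011947716200273878786844491004142204553646230957940892440495565605640136864432967930961301350800942972654133972450733977501696

/-- The expansion of the generating function in Schur functions. -/
def schurTerms : List (ℤ × List ℕ) :=
  [(1, [8]), (7, [7, 1]), (20, [6, 2]), (21, [6, 1, 1]), (18, [5, 3]), (26, [5, 2, 1]),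
   (2, [5, 1, 1, 1]), (7, [4, 4]), (15, [4, 3, 1]), (6, [4, 2, 2]), (4, [3, 3, 2]),
   (1, [3, 2, 2, 1]), (1, [3, 2, 1, 1, 1]), (1, [3, 1, 1, 1, 1, 1]), (-1, [2, 2, 2, 2]),
   (1, [2, 2, 2, 1, 1])]

theorem sum_classStates :
    (padClasses.map fun bs => ((classStates bs).map fun s => (2 ^ 16) ^ s.2).sum).sum =
      padHistogram := by decide +kernel

theorem length_classStates : (padClasses.map fun bs => (classStates bs).length).sum = 4824 := by
  decide +kernel

theorem sum_coreTrie_entries :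
    (coreTrie.entries.map fun p => (2 ^ 16) ^ desMask p.1).sum = coreHistogram := by decide +kernel

theorem length_coreWords : coreWords.length = 126 := by decide +kernel

theorem nodup_coreWords : coreWords.Nodup := by decide +kernel

theorem expansionCheck_schurTerms :
    expansionCheck (2 ^ 16) (padHistogram + coreHistogram) 128 8 8 (2 ^ 8) schurTerms = true := by
  decide +kernel

theorem sum_padWords (g : ℕ → ℕ) : (padWords.map fun w => g (desMask w)).sum =
    (padClasses.map fun bs => ((classStates bs).map fun s => g s.2).sum).sum := by
  unfold padWords
  induction padClasses with
  | nil => rfl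
  | cons bs L ih =>
    rw [List.flatMap_cons, List.map_append, List.sum_append, ih, List.map_cons, List.sum_cons,
      ← map_classWords, List.map_map]
    rfl

theorem length_padWords : padWords.length = 4824 := by
  have h := sum_padWords fun _ => 1
  simp only [List.map_const', List.sum_replicate, smul_eq_mul, mul_one] at h
  rw [h, length_classStates]

theorem nodup_padWords : padWords.Nodup := by
  rw [padWords, List.nodup_flatMap]
  refine ⟨fun bs _ => nodup_classWords bs, ?_⟩
  refine List.Pairwise.imp_of_mem ?_ (List.nodup_append'.1 nodup_classes).1
  intro bs bs' hbs hbs' hne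
  rw [Function.onFun, List.disjoint_left]
  intro w hw hw'
  exact hne (eq_of_inClass ((length_of_mem_classes (List.mem_append_left _ hbs)).trans
    (length_of_mem_classes (List.mem_append_left _ hbs')).symm) (mem_classWords.1 hw)
    (mem_classWords.1 hw'))

theorem nodup_padWords_append_coreWords : (padWords ++ coreWords).Nodup :=
  List.nodup_append'.2 ⟨nodup_padWords, nodup_coreWords, disjoint_padWords_coreWords⟩

theorem card_vertexSet : vertexSet.card = 4950 := by
  rw [vertexSet, List.toFinset_card_of_nodup nodup_padWords_append_coreWords, List.length_append,
    length_padWords, length_coreWords]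

theorem sum_vertexSet :
    ∑ w ∈ vertexSet, (2 ^ 16) ^ desMask w = padHistogram + coreHistogram := by
  have h : (coreWords.map fun w => (2 ^ 16) ^ desMask w).sum = coreHistogram := by
    rw [← sum_coreTrie_entries, coreWords, List.map_map]
    exact congrArg List.sum (List.map_congr_left fun _ _ => rfl)
  rw [vertexSet, List.sum_toFinset _ nodup_padWords_append_coreWords, List.map_append,
    List.sum_append, sum_padWords fun M => (2 ^ 16) ^ M, sum_classStates, h]

/-- The base `2 ^ 16` exceeds the number 4950 of vertices, so the digits of the histogram are true
multiplicities; words of length 8 have seven possible descents, hence 128 masks. -/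
theorem genFun_vertexSet : isMoveSystem_vertexSet.graph.genFun =
    (schurTerms.map fun p => p.1 • schurFunction (diagram p.2)).sum := by
  refine sum_fundamentalQSym_eq_of_check (f := desMask) (X := 2 ^ 16) (m := 128)
    (K := padHistogram + coreHistogram) ?_ (fun w hw => ?_) (fun w hw j => ?_) sum_vertexSet
    (by decide) expansionCheck_schurTerms
  · rw [show isMoveSystem_vertexSet.graph.verts = vertexSet from rfl, card_vertexSet]
    norm_num
  · exact desMask_lt w (n := 7) (isMoveSystem_vertexSet.word w hw).1.le
  · rw [testBit_desMask, mem_descentSet]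
    refine ⟨fun hd => ⟨?_, hd⟩, fun hd => hd.2⟩
    by_contra hc
    rw [desc_eq_false_of_length_le
      (by rw [(isMoveSystem_vertexSet.word w hw).1]; omega)] at hd
    exact Bool.false_ne_true hd

theorem hasSchurCoeff_vertexSet :
    HasSchurCoeff isMoveSystem_vertexSet.graph.genFun shape2222 (-1) := by
  have h := hasSchurCoeff_list_sum (L := schurTerms) (by decide) (by decide) (l := [2, 2, 2, 2])
    (by decide) (by decide)
  rw [← genFun_vertexSet, show diagram [2, 2, 2, 2] = shape2222 from dif_pos (by decide)] at h
  exact h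

theorem genFun_toSignedColoredGraph {n N : ℕ} (G : D0Graph n N) :
    G.toSignedColoredGraph.genFun = G.genFun := by
  unfold SignedColoredGraph.genFun D0Graph.genFun
  rw [← Finset.sum_coe_sort G.verts fun w => fundamentalQSym n (descentSet w)]
  refine Finset.sum_congr rfl fun w _ => congrArg _ ?_
  ext i
  by_cases h : i ∈ descentSet w.1 <;> simp [D0Graph.toSignedColoredGraph, h]

theorem isDGraph_vertexSet : isMoveSystem_vertexSet.signed.IsDGraph :=
  ⟨IsMoveSystem.axiom1, IsMoveSystem.axiom2, IsMoveSystem.axiom3, axiom4a_vertexSet,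
    IsMoveSystem.axiom4b axiom4bStrong_vertexSet, IsMoveSystem.axiom5, IsMoveSystem.lsp_four,
    IsMoveSystem.lsp_five⟩

theorem mainTheorem1 :
    (∃ G : D0Graph 8 8,
      G.verts.card = 4950 ∧
      G.toSignedColoredGraph.Axiom4bStrong ∧
      G.toSignedColoredGraph.Axiom4b ∧
      G.toSignedColoredGraph.Axiom5 ∧
      HasSchurCoeff G.genFun shape2222 (-1) ∧
      ¬ SchurPositive G.genFun ∧
      G.toSignedColoredGraph.IsDGraph) ∧
    ∃ (n : ℕ) (V : Type) (_ : Fintype V) (H : SignedColoredGraph n V),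
      H.IsDGraph ∧ ¬ SchurPositive H.genFun := by
  have hneg := hasSchurCoeff_vertexSet.not_schurPositive (by norm_num)
  refine ⟨⟨isMoveSystem_vertexSet.graph, card_vertexSet, axiom4bStrong_vertexSet,
    IsMoveSystem.axiom4b axiom4bStrong_vertexSet, IsMoveSystem.axiom5, hasSchurCoeff_vertexSet,
    hneg, isDGraph_vertexSet⟩, 8, _, _, isMoveSystem_vertexSet.signed, isDGraph_vertexSet, ?_⟩
  rwa [genFun_toSignedColoredGraph]
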